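/- Let $n\in\mathbb{N}$ and let $\mathcal{S}_n$ be the set of permutations of $[n]=\{1,\dots,n\}$. For $\sigma\in\mathcal{S}_n$ and $j\in[n]$ put $\mathrm{Inv}_j(\sigma)=|\{i<j:\sigma(i)>\sigma(j)\}|$ and $\mathrm{Inv}(\sigma)=\sum_{j=1}^n\mathrm{Inv}_j(\sigma)$, and for $q\ge 0$ let $\pi_{n,q}(\sigma)=q^{\mathrm{Inv}(\sigma)}\big/\prod_{k=1}^n\sum_{\ell=0}^{k-1}q^\ell$ be the Mallows distribution on $\mathcal{S}_n$. A regular Mallows process is a càdlàg $\mathcal{S}_n$-valued process $(\mathcal{M}_t)_{t\in[0,\infty)}$ such that (a) $\mathcal{M}_t$ has law $\pi_{n,t}$ for every $t\ge 0$; (b) it is smooth: almost surely, $\mathrm{Inv}(\mathcal{M}_t)\le\mathrm{Inv}(\mathcal{M}_{t'})$ and $\mathrm{Inv}_j(\mathcal{M}_t)\le\mathrm{Inv}_j(\mathcal{M}_{t'})$ for all $t<t'$ and $j\in[n]$, and $\mathrm{Inv}(\mathcal{M}_t)\le\mathrm{Inv}(\mathcal{M}_{t-})+1$ for all $t>0$;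 (c) the processes $(\mathrm{Inv}_j(\mathcal{M}_t))_{t\in[0,\infty)}$, $j\in[n]$, are independent. For $j\in[n]$, $t\ge0$ and $0\le k\le j-1$ let $$p_j(t,k)=\frac{1}{\sum_{\ell=0}^{j-1}t^\ell}\left[(k+1)\sum_{\ell=0}^{j-2}(\ell+1)t^\ell-j\sum_{\ell=j-k-2}^{j-2}(\ell-j+k+2)t^\ell\right],$$ where a summand with coefficient $0$ is read as $0$. By a birth process with rates $p_j$ we mean a càdlàg Markov process $(B_j(t))_{t\in[0,\infty)}$ with values in $\{0,\dots,j-1\}$ such that $B_j(0)=0$ almost surely, $B_j(t-)=B_j(t)$ almost surely for each fixed $t>0$, and, for all $t\ge 0$ and $k$ with $\mathbb{P}(B_j(t)=k)>0$, as $h\downarrow0$, $\mathbb{P}(B_j(t+h)=m\mid B_j(t)=k)$ equals $1-h\,p_j(t,k)+o(h)$ if $m=k$, $h\,p_j(t,k)+o(h)$ if $m=k+1$, and $o(h)$ for every other $m$. Let $\Phi$ be the bijection from $\mathcal{E}_n=\{(I_1,\dots,I_n):0\le I_j\le j-1 \text{ for all } j\}$ to $\mathcal{S}_n$ determined by $\mathrm{Inv}_j(\Phi(I))=I_j$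 for all $j$. A birth Mallows process is a process of the form $\mathcal{M}_t=\Phi(B_1(t),\dots,B_n(t))$, where $B_1,\dots,B_n$ are independent and $B_j$ is a birth process with rates $p_j$. Then there exists a regular Mallows process on $\mathcal{S}_n$ that is a Markov process. It is unique: any two such processes, possibly defined on different probability spaces, have the same law. Moreover, a process is a regular Mallows process with the Markov property if and only if it is a birth Mallows process. -/

import Mathlib

open MeasureTheory ProbabilityTheory Filter Topology
open scoped NNReal

universe u v

/-- The symmetric group on `n` letters carries its discrete σ-algebra. -/
instance instMeasurableSpacePermFin (n : ℕ) : MeasurableSpace (Equiv.Perm (Fin n)) := ⊤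

noncomputable section

namespace Mallows

/-! ### Inversions

The set `[n] = {1, …, n}` is modelled by `Fin n`, so `j : Fin n` stands for the integer `j + 1`. -/

/-- `Inv(σ) = |{i < j : σ(i) > σ(j)}|`. -/
def inv {n : ℕ} (σ : Equiv.Perm (Fin n)) : ℕ :=
  (Finset.univ.filter fun x : Fin n × Fin n => x.1 < x.2 ∧ σ x.2 < σ x.1).card

/-- `Inv_j(σ) = |{i < j : σ(i) > σ(j)}|`, with `j` fixed. -/
def invAt {n : ℕ} (σ : Equiv.Perm (Fin n)) (j : Fin n) : ℕ :=
  (Finset.univ.filter fun i : Fin n => i < j ∧ σ j < σ i).card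

theorem invAt_lt {n : ℕ} (σ : Equiv.Perm (Fin n)) (j : Fin n) : invAt σ j < (j : ℕ) + 1 := by
  unfold invAt
  rw [Nat.lt_succ_iff]
  calc _ ≤ (Finset.Iio j).card := by
        apply Finset.card_le_card
        intro i hi
        simp only [Finset.mem_filter, Finset.mem_univ, true_and] at hi
        exact Finset.mem_Iio.2 hi.1
    _ = j := by simp

/-- The set `ℰ_n` of sequences `(I_1, …, I_n)` with `0 ≤ I_j ≤ j - 1`. -/
abbrev Code (n : ℕ) : Type := (j : Fin n) → Fin ((j : ℕ) + 1)

/-- The map `σ ↦ (Inv_1(σ), …, Inv_n(σ))`. -/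
def toCode {n : ℕ} (σ : Equiv.Perm (Fin n)) : Code n := fun j => ⟨invAt σ j, invAt_lt σ j⟩

theorem toCode_injective (n : ℕ) : Function.Injective (toCode (n := n)) := by
  have key : ∀ (σ τ : Equiv.Perm (Fin n)) (j : Fin n), (∀ i, j < i → σ i = τ i) →
      invAt σ j = invAt τ j → ¬ σ j < τ j := by
    intro σ τ j hag hinv hlt
    have himg : ∀ (ρ : Equiv.Perm (Fin n)), invAt ρ j =
        (Finset.univ.filter fun a : Fin n => ρ.symm a < j ∧ ρ j < a).card := by
      intro ρ
      unfold invAt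
      refine Finset.card_bij (fun i _ => ρ i) ?_ ?_ ?_
      · intro i hi; simpa using hi
      · intro a _ b _ h; exact ρ.injective h
      · intro b hb; exact ⟨ρ.symm b, by simpa using hb, by simp⟩
    rw [himg σ, himg τ] at hinv
    have hsymm : ∀ a, ¬ j < σ.symm a ↔ ¬ j < τ.symm a := by
      intro a
      rw [not_iff_not]
      constructor
      · intro h
        have h1 := hag _ h
        rw [Equiv.apply_symm_apply] at h1
        have : τ.symm a = σ.symm a := by rw [Equiv.symm_apply_eq]; exact h1
        rwa [this]
      · intro h
        have h1 := hag _ h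
        rw [Equiv.apply_symm_apply] at h1
        have : σ.symm a = τ.symm a := by rw [Equiv.symm_apply_eq]; exact h1.symm
        rwa [this]
    have hss : (Finset.univ.filter fun a : Fin n => τ.symm a < j ∧ τ j < a) ⊂
        (Finset.univ.filter fun a : Fin n => σ.symm a < j ∧ σ j < a) := by
      rw [Finset.ssubset_iff_of_subset]
      · refine ⟨τ j, ?_, by simp⟩
        have h1 := (hsymm (τ j)).2 (by simp)
        have h2 : σ.symm (τ j) ≠ j := by
          intro h
          rw [Equiv.symm_apply_eq] at h
          exact hlt.ne h.symm
        simp only [Finset.mem_filter, Finset.mem_univ, true_and]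
        exact ⟨lt_of_le_of_ne (not_lt.1 h1) h2, hlt⟩
      · intro a ha
        simp only [Finset.mem_filter, Finset.mem_univ, true_and] at ha ⊢
        have h1 := (hsymm a).2 (not_lt.2 ha.1.le)
        have h2 : σ.symm a ≠ j := by
          intro h
          rw [Equiv.symm_apply_eq] at h
          exact (hlt.trans ha.2).ne h.symm
        exact ⟨lt_of_le_of_ne (not_lt.1 h1) h2, hlt.trans ha.2⟩
    exact (Finset.card_lt_card hss).ne hinv.symm
  intro σ τ h
  have hinv : ∀ j, invAt σ j = invAt τ j := fun j => congrArg Fin.val (congrFun h j)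
  have hall : ∀ (m : ℕ) (j : Fin n), n - (j : ℕ) = m → σ j = τ j := by
    intro m
    induction m using Nat.strong_induction_on with
    | _ m ih =>
      intro j hj
      have hag : ∀ i, j < i → σ i = τ i := by
        intro i hi
        refine ih (n - (i : ℕ)) ?_ i rfl
        have := i.isLt
        have : (j : ℕ) < i := hi
        omega
      exact le_antisymm (not_lt.1 (key τ σ j (fun i hi => (hag i hi).symm) (hinv j).symm))
        (not_lt.1 (key σ τ j hag (hinv j)))
  exact Equiv.ext fun j => hall _ j rfl

theorem toCode_bijective (n : ℕ) : Function.Bijective (toCode (n := n)) := by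
  rw [Fintype.bijective_iff_injective_and_card]
  refine ⟨toCode_injective n, ?_⟩
  rw [Fintype.card_perm, Fintype.card_fin, Fintype.card_pi]
  simp only [Fintype.card_fin]
  rw [Fin.prod_univ_eq_prod_range (fun i => i + 1) n, Finset.prod_range_add_one_eq_factorial]

/-- The bijection `Φ : ℰ_n → S_n` characterized by `Inv_j(Φ(I)) = I_j` for all `j`. -/
def Phi (n : ℕ) : Code n ≃ Equiv.Perm (Fin n) :=
  (Equiv.ofBijective toCode (toCode_bijective n)).symm

/-! ### Processes with values in a discrete space -/

section DiscretePaths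

variable {Ω : Type*} {α : Type*}

/-- `x_{t-} = a`: for a discrete state space this means that `x = a` just before time `t`. -/
def HasLeftLimit (x : ℝ≥0 → α) (t : ℝ≥0) (a : α) : Prop := ∀ᶠ s in 𝓝[<] t, x s = a

/-- A càdlàg path in a discrete state space: right-continuous at each `t ≥ 0`, with a left limit at
each `t > 0`. -/
def IsCadlag (x : ℝ≥0 → α) : Prop :=
  (∀ t, ∀ᶠ s in 𝓝[>] t, x s = x t) ∧ ∀ t, 0 < t → ∃ a, HasLeftLimit x t a

/-- The Markov property of a process with values in a finite or countable discrete space: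
`P(X_t = y | X_{s_0} = x_0, …, X_{s_k} = x_k) = P(X_t = y | X_{s_k} = x_k)` for all times
`s_0 < ⋯ < s_k < t` and all states such that the conditioning event has positive probability. -/
def IsMarkov [MeasurableSpace Ω] (X : ℝ≥0 → Ω → α) (P : Measure Ω) : Prop :=
  ∀ (k : ℕ) (s : Fin (k + 1) → ℝ≥0) (t : ℝ≥0), StrictMono s → s (Fin.last k) < t →
    ∀ (x : Fin (k + 1) → α) (y : α), P {ω | ∀ i, X (s i) ω = x i} ≠ 0 →
      P[|{ω | ∀ i, X (s i) ω = x i}] {ω | X t ω = y}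
        = P[|{ω | X (s (Fin.last k)) ω = x (Fin.last k)}] {ω | X t ω = y}

end DiscretePaths

/-! ### Regular Mallows processes -/

/-- The Mallows distribution `π_{n,q}(σ) = q ^ Inv(σ) / Z_{n,q}`, where
`Z_{n,q} = ∏_{k=1}^n ∑_{ℓ=0}^{k-1} q ^ ℓ`. -/
def mallowsProb (n : ℕ) (q : ℝ) (σ : Equiv.Perm (Fin n)) : ℝ :=
  q ^ inv σ / ∏ k ∈ Finset.Icc 1 n, ∑ l ∈ Finset.range k, q ^ l

section MallowsProcess

variable {Ω : Type*} [MeasurableSpace Ω] {n : ℕ}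

/-- A Mallows process: a càdlàg `S_n`-valued process `(M_t)_{t ≥ 0}` such that `M_t` is
`π_{n,t}`-distributed for each `t`. -/
structure IsMallowsProcess (M : ℝ≥0 → Ω → Equiv.Perm (Fin n)) (P : Measure Ω) : Prop where
  measurable : ∀ t, Measurable (M t)
  cadlag : ∀ ω, IsCadlag fun t => M t ω
  marginal : ∀ t σ, P.real {ω | M t ω = σ} = mallowsProb n t σ

/-- Almost surely, `Inv(M_t)` is non-decreasing in `t`. -/
def IsMonotone (M : ℝ≥0 → Ω → Equiv.Perm (Fin n)) (P : Measure Ω) : Prop :=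
  ∀ᵐ ω ∂P, ∀ t t', t < t' → inv (M t ω) ≤ inv (M t' ω)

/-- Almost surely, `Inv(M_t)` and every `Inv_j(M_t)` are non-decreasing in `t`. -/
def IsStronglyMonotone (M : ℝ≥0 → Ω → Equiv.Perm (Fin n)) (P : Measure Ω) : Prop :=
  IsMonotone M P ∧ ∀ᵐ ω ∂P, ∀ t t', t < t' → ∀ j, invAt (M t ω) j ≤ invAt (M t' ω) j

/-- Strong monotonicity, and almost surely `Inv(M_t) ≤ Inv(M_{t-}) + 1` for all `t`. -/
def IsSmooth (M : ℝ≥0 → Ω → Equiv.Perm (Fin n)) (P : Measure Ω) : Prop :=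
  IsStronglyMonotone M P ∧
    ∀ᵐ ω ∂P, ∀ t, 0 < t → ∀ σ, HasLeftLimit (fun s => M s ω) t σ → inv (M t ω) ≤ inv σ + 1

/-- The processes `(Inv_j(M_t))_{t ≥ 0}`, `j ∈ [n]`, are independent. -/
def HasIndependentInversions (M : ℝ≥0 → Ω → Equiv.Perm (Fin n)) (P : Measure Ω) : Prop :=
  iIndepFun (fun (j : Fin n) (ω : Ω) (t : ℝ≥0) => invAt (M t ω) j) P

/-- A regular Mallows process: a smooth Mallows process with independent inversions. -/
structure IsRegularMallowsProcess (M : ℝ≥0 → Ω → Equiv.Perm (Fin n)) (P : Measure Ω) : Prop where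
  mallows : IsMallowsProcess M P
  smooth : IsSmooth M P
  indep : HasIndependentInversions M P

end MallowsProcess

/-! ### The birth Mallows process -/

/-- The rates `p_j(t, k)`, for `j ≥ 1` and `0 ≤ k ≤ j - 1`. In the second sum `ℓ` runs from
`j - k - 2` to `j - 2`; for `k = j - 1` the summand at `ℓ = -1` is zero, and the truncated
subtraction leaves it out. -/
def rate (j : ℕ) (t : ℝ) (k : ℕ) : ℝ :=
  (((k : ℝ) + 1) * ∑ l ∈ Finset.range (j - 1), ((l : ℝ) + 1) * t ^ l
      - (j : ℝ) * ∑ l ∈ Finset.Ico (j - k - 2) (j - 1), ((l : ℝ) - j + k + 2) * t ^ l)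
    / ∑ l ∈ Finset.range j, t ^ l

section BirthProcess

variable {Ω : Type*} [MeasurableSpace Ω]

/-- A time-inhomogeneous birth process with rates `p(t, k)`, started at `0`: a càdlàg Markov process
on the non-negative integers without fixed times of discontinuity such that, as `h ↓ 0`,
`P(X_{t+h} = m | X_t = k)` is `1 - h p(t,k) + o(h)` for `m = k`, `h p(t,k) + o(h)` for `m = k + 1`
and `o(h)` otherwise, for all `t` and `k` with `P(X_t = k) > 0`. The absence of fixed times of
discontinuity is implicit in saying that the process is governed by its rates: a jump at a
deterministic time is not seen by the rates. -/
structure IsBirthProcess (p : ℝ → ℕ → ℝ) (X : ℝ≥0 → Ω → ℕ) (P : Measure Ω) : Prop where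
  measurable : ∀ t, Measurable (X t)
  cadlag : ∀ ω, IsCadlag fun t => X t ω
  no_fixed_jump : ∀ t, 0 < t → ∀ᵐ ω ∂P, HasLeftLimit (fun s => X s ω) t (X t ω)
  initial : ∀ᵐ ω ∂P, X 0 ω = 0
  markov : IsMarkov X P
  rates : ∀ (t : ℝ≥0) (k m : ℕ), P {ω | X t ω = k} ≠ 0 →
    (fun h : ℝ≥0 => (P[|{ω | X t ω = k}]).real {ω | X (t + h) ω = m}
        - (if m = k then 1 - (h : ℝ) * p t k else if m = k + 1 then (h : ℝ) * p t k else 0))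
      =o[𝓝[>] 0] fun h : ℝ≥0 => (h : ℝ)

/-- `M` is a birth Mallows process: `M_t = Φ(B_1(t), …, B_n(t))` for independent birth processes
`B_1, …, B_n` with rates `p_1, …, p_n`. -/
def IsBirthMallowsProcess {n : ℕ} (M : ℝ≥0 → Ω → Equiv.Perm (Fin n)) (P : Measure Ω) : Prop :=
  ∃ B : ℝ≥0 → Ω → Code n,
    (∀ j : Fin n, IsBirthProcess (rate ((j : ℕ) + 1)) (fun t ω => (B t ω j : ℕ)) P) ∧
    iIndepFun (fun (j : Fin n) (ω : Ω) (t : ℝ≥0) => (B t ω j : ℕ)) P ∧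
    ∀ t ω, M t ω = Phi n (B t ω)

end BirthProcess

end Mallows

end

noncomputable section

namespace Mallows

/-! The map sending a permutation to its code (Inv_1, …, Inv_n) turns the Mallows law into a product
of truncated geometric laws π_j(k) = t^k / (1 + … + t^(j-1)) (`mallowsProb_eq_prod`). With
independent inversions the problem therefore splits into n one-dimensional problems. The Markov
property also passes between the permutation and its coordinates in both directions
(`isMarkov_of_invAt`, `IsMarkov.invAt`).

In one coordinate, let F_k be the distribution function of the truncated geometric law. A
non-decreasing process with these marginals satisfies P(X_s ≤ k < X_t) = F_k(s) - F_k(t), so its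
flux across every level is prescribed. If two jumps in time h have probability o(h), this flux comes
from state k alone, which forces the rate from k to be -F_k' / π(k). The polynomial identity
`geomSum_wronskian` shows that this quotient is the given rate (`hasDerivAt_truncGeomCdf`). The o(h)
estimate is the delicate point: unit jumps exclude only simultaneous births. For t > 0,
`IsTruncGeomProcess.two_jumps_le` combines the Markov property on a fine grid with a positive lower
bound for the probability of the intermediate state; at t = 0 the vanishing flux across level 1
suffices.

Rates in turn determine the law. By the Markov property the probabilities P(E ∩ {X_t = m}), with E
in the past, solve the Kolmogorov forward equation with right derivatives. They are continuous
because there are no fixed jump times. The equation is triangular and has a unique solution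
(`IsRateFamily.eq_of_forward`), so all finite-dimensional distributions are explicit in terms of
`trans`. The truncated geometric laws solve the same equation, so birth processes have the right
marginals. For the total inversion number, two increments in time h have probability O(h²) by
independence, and a grid argument makes all its jumps at most one.

Existence comes from Kolmogorov extension applied to `trans`, a right-continuous modification of
each coordinate, and a product over the coordinates. -/

/-- Birth rates on the states `0, …, J - 1`: continuous, non-negative, and zero from `J - 1` on. -/
structure IsRateFamily (p : ℝ → ℕ → ℝ) (J : ℕ) : Prop where
  continuous : ∀ k, Continuous fun t => p t k
  nonneg : ∀ t k, 0 ≤ p t k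
  eq_zero : ∀ t k, J ≤ k + 1 → p t k = 0

/-- The right-hand side of the Kolmogorov forward equation of a pure birth process. -/
def forwardRHS (p : ℝ → ℕ → ℝ) (t : ℝ) (v : ℕ → ℝ) : ℕ → ℝ
  | 0 => -(v 0 * p t 0)
  | m + 1 => v m * p t m - v (m + 1) * p t (m + 1)

/-- The cumulated rate `∫₀ᵗ p(u, m) du`. -/
def cumRate (p : ℝ → ℕ → ℝ) (m : ℕ) (t : ℝ) : ℝ := ∫ u in (0 : ℝ)..t, p u m

/-- The transition function of the pure birth process with rates `p`: `trans p k m s t` is the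
probability of being in `m` at time `t` when starting from `k` at time `s`. -/
def trans (p : ℝ → ℕ → ℝ) (k : ℕ) : ℕ → ℝ → ℝ → ℝ
  | 0, s, t => Real.exp (-cumRate p 0 t) * (if k = 0 then Real.exp (cumRate p 0 s) else 0)
  | m + 1, s, t => Real.exp (-cumRate p (m + 1) t) *
      ((if k = m + 1 then Real.exp (cumRate p (m + 1) s) else 0) +
        ∫ u in s..t, trans p k m s u * p u m * Real.exp (cumRate p (m + 1) u))

/-! ### The Kolmogorov forward equation of a pure birth chain -/

section Forward

variable {p : ℝ → ℕ → ℝ} {J : ℕ}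

theorem forwardRHS_sub (t : ℝ) (v w : ℕ → ℝ) (m : ℕ) :
    forwardRHS p t (fun i => v i - w i) m = forwardRHS p t v m - forwardRHS p t w m := by
  cases m <;> simp only [forwardRHS] <;> ring

theorem forwardRHS_mul_left (t c : ℝ) (v : ℕ → ℝ) (m : ℕ) :
    forwardRHS p t (fun i => c * v i) m = c * forwardRHS p t v m := by
  cases m <;> simp only [forwardRHS] <;> ring

theorem forwardRHS_sum {ι : Type*} (A : Finset ι) (t : ℝ) (v : ι → ℕ → ℝ) (m : ℕ) :
    forwardRHS p t (fun i => ∑ a ∈ A, v a i) m = ∑ a ∈ A, forwardRHS p t (v a) m := by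
  cases m <;> simp only [forwardRHS, Finset.sum_mul, Finset.sum_sub_distrib, Finset.sum_neg_distrib]

theorem IsRateFamily.hasDerivAt_cumRate (hp : IsRateFamily p J) (m : ℕ) (t : ℝ) :
    HasDerivAt (cumRate p m) (p t m) t :=
  intervalIntegral.integral_hasDerivAt_right ((hp.continuous m).intervalIntegrable _ _)
    ((hp.continuous m).stronglyMeasurableAtFilter _ _) (hp.continuous m).continuousAt

theorem IsRateFamily.continuous_cumRate (hp : IsRateFamily p J) (m : ℕ) :
    Continuous (cumRate p m) :=
  continuous_iff_continuousAt.2 fun t => (hp.hasDerivAt_cumRate m t).continuousAt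

theorem IsRateFamily.cumRate_mono (hp : IsRateFamily p J) (m : ℕ) : Monotone (cumRate p m) :=
  monotone_of_hasDerivAt_nonneg (fun t => hp.hasDerivAt_cumRate m t) fun t => hp.nonneg t m

/-- Variation of constants: the equation for state `m` is linear with decay rate `p t m` and inflow
from `m - 1`, so `trans` is built state by state with the integrating factor `exp (cumRate p m)`. -/
theorem IsRateFamily.hasDerivAt_trans (hp : IsRateFamily p J) (k m : ℕ) (s t : ℝ) :
    HasDerivAt (fun t => trans p k m s t) (forwardRHS p t (fun i => trans p k i s t) m) t := by
  have hexp : ∀ (m : ℕ) (t : ℝ), HasDerivAt (fun t => Real.exp (-cumRate p m t))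
      (Real.exp (-cumRate p m t) * -p t m) t := fun m t => (hp.hasDerivAt_cumRate m t).neg.exp
  induction m generalizing t with
  | zero =>
    simp only [trans, forwardRHS]
    refine ((hexp 0 t).mul_const _).congr_deriv ?_
    ring
  | succ m ih =>
    have hc : Continuous fun u => trans p k m s u * p u m * Real.exp (cumRate p (m + 1) u) := by
      have h1 : Continuous fun u => trans p k m s u :=
        continuous_iff_continuousAt.2 fun u => (ih u).continuousAt
      exact (h1.mul (hp.continuous m)).mul (Real.continuous_exp.comp (hp.continuous_cumRate _))
    have hint : HasDerivAt (fun t => ∫ u in s..t, trans p k m s u * p u m *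
        Real.exp (cumRate p (m + 1) u)) _ t :=
      intervalIntegral.integral_hasDerivAt_right (hc.intervalIntegrable _ _)
        (hc.stronglyMeasurableAtFilter _ _) hc.continuousAt
    have h := (hexp (m + 1) t).mul (hint.const_add
      (if k = m + 1 then Real.exp (cumRate p (m + 1) s) else 0))
    refine h.congr_deriv ?_
    simp only [forwardRHS]
    rw [trans]
    have he : Real.exp (-cumRate p (m + 1) t) * Real.exp (cumRate p (m + 1) t) = 1 := by
      rw [← Real.exp_add]; simp
    linear_combination (trans p k m s t * p t m) * he

theorem IsRateFamily.continuous_trans (hp : IsRateFamily p J) (k m : ℕ) (s : ℝ) :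
    Continuous fun t => trans p k m s t :=
  continuous_iff_continuousAt.2 fun t => (hp.hasDerivAt_trans k m s t).continuousAt

theorem trans_self (k m : ℕ) (s : ℝ) : trans p k m s s = if k = m then 1 else 0 := by
  cases m with
  | zero => by_cases h : k = 0 <;> simp [trans, h, ← Real.exp_add]
  | succ m => by_cases h : k = m + 1 <;> simp [trans, h, ← Real.exp_add]

theorem IsRateFamily.trans_nonneg (hp : IsRateFamily p J) (k m : ℕ) {s t : ℝ} (h : s ≤ t) :
    0 ≤ trans p k m s t := by
  induction m generalizing t with
  | zero => rw [trans]; positivity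
  | succ m ih =>
    rw [trans]
    refine mul_nonneg (Real.exp_nonneg _) (add_nonneg (by positivity) ?_)
    refine intervalIntegral.integral_nonneg h fun u hu => ?_
    exact mul_nonneg (mul_nonneg (ih hu.1) (hp.nonneg _ _)) (Real.exp_nonneg _)

theorem trans_eq_zero_of_lt {k m : ℕ} (h : m < k) (s t : ℝ) : trans p k m s t = 0 := by
  induction m generalizing t with
  | zero => simp [trans, h.ne']
  | succ m ih => simp [trans, h.ne', fun t => ih (by omega) t]

/-- Mass could enter a state beyond `J - 1` only from a state whose rate vanishes. -/
theorem IsRateFamily.trans_eq_zero_of_le (hp : IsRateFamily p J) {k m : ℕ} (hk : k < J)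
    (hm : J ≤ m) (s t : ℝ) : trans p k m s t = 0 := by
  cases m with
  | zero => omega
  | succ m =>
    have : k ≠ m + 1 := by omega
    simp [trans, this, fun u => hp.eq_zero u m hm]

theorem sum_forwardRHS (t : ℝ) (v : ℕ → ℝ) (N : ℕ) :
    ∑ m ∈ Finset.range (N + 1), forwardRHS p t v m = -(v N * p t N) := by
  induction N with
  | zero => simp [forwardRHS]
  | succ N ih => rw [Finset.sum_range_succ, ih]; simp only [forwardRHS]; ring

/-- The inflows and outflows telescope (`sum_forwardRHS`), leaving only the outflow of the last
state, which is zero; total mass is conserved. -/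
theorem IsRateFamily.sum_trans (hp : IsRateFamily p J) {k : ℕ} (hk : k < J) (s t : ℝ) :
    ∑ m ∈ Finset.range J, trans p k m s t = 1 := by
  have hd : ∀ t, HasDerivAt (fun t => ∑ m ∈ Finset.range J, trans p k m s t) 0 t := by
    intro t
    refine (HasDerivAt.fun_sum fun m _ => hp.hasDerivAt_trans k m s t).congr_deriv ?_
    obtain ⟨N, rfl⟩ : ∃ N, J = N + 1 := ⟨J - 1, by omega⟩
    rw [sum_forwardRHS, hp.eq_zero _ _ le_rfl]
    simp
  have := is_const_of_deriv_eq_zero (fun t => (hd t).differentiableAt) (fun t => (hd t).deriv) t s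
  rw [this]
  simp only [trans_self]
  rw [Finset.sum_ite_eq, if_pos (Finset.mem_range.2 hk)]

theorem IsRateFamily.trans_le_one (hp : IsRateFamily p J) {k : ℕ} (hk : k < J) (m : ℕ) {s t : ℝ}
    (h : s ≤ t) : trans p k m s t ≤ 1 := by
  by_cases hm : m < J
  · rw [← hp.sum_trans hk s t]
    exact Finset.single_le_sum (f := fun m => trans p k m s t)
      (fun i _ => hp.trans_nonneg k i h) (Finset.mem_range.2 hm)
  · rw [hp.trans_eq_zero_of_le hk (not_lt.1 hm)]; exact zero_le_one

/-- Every birth contributes one integration and hence a factor of at most `C * (t - s)`; the two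
exponentials together are at most 1 because `cumRate` is monotone. -/
theorem IsRateFamily.trans_add_le_pow (hp : IsRateFamily p J) {k : ℕ} (hk : k < J) {C s T : ℝ}
    (hC : ∀ u ∈ Set.Icc s T, ∀ k, p u k ≤ C) (i : ℕ) {t : ℝ} (hst : s ≤ t) (htT : t ≤ T) :
    trans p k (k + i) s t ≤ (C * (t - s)) ^ i := by
  have hC0 : 0 ≤ C := (hp.nonneg s 0).trans (hC s ⟨le_rfl, hst.trans htT⟩ 0)
  induction i generalizing t with
  | zero => simpa using hp.trans_le_one hk k hst
  | succ i ih =>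
    rw [← Nat.add_assoc, trans, if_neg (by omega), zero_add, ← intervalIntegral.integral_const_mul]
    have hcont : Continuous fun u => Real.exp (-cumRate p (k + i + 1) t) *
        (trans p k (k + i) s u * p u (k + i) * Real.exp (cumRate p (k + i + 1) u)) :=
      continuous_const.mul (((hp.continuous_trans _ _ _).mul (hp.continuous _)).mul
        (Real.continuous_exp.comp (hp.continuous_cumRate _)))
    calc _ ≤ ∫ _ in s..t, (C * (t - s)) ^ i * C := by
          refine intervalIntegral.integral_mono_on hst (hcont.intervalIntegrable _ _)
            (continuous_const.intervalIntegrable _ _) fun u hu => ?_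
          have h1 : trans p k (k + i) s u ≤ (C * (t - s)) ^ i := by
            refine (ih hu.1 (hu.2.trans htT)).trans ?_
            have h0 : 0 ≤ u - s := by linarith [hu.1]
            have h2 : u - s ≤ t - s := by linarith [hu.2]
            gcongr
          have h3 : Real.exp (-cumRate p (k + i + 1) t) * Real.exp (cumRate p (k + i + 1) u) ≤ 1 := by
            rw [← Real.exp_add, Real.exp_le_one_iff]
            have := hp.cumRate_mono (k + i + 1) hu.2
            linarith
          have h4 : trans p k (k + i) s u * p u (k + i) ≤ (C * (t - s)) ^ i * C :=
            mul_le_mul h1 (hC u ⟨hu.1, hu.2.trans htT⟩ _) (hp.nonneg _ _)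
              ((hp.trans_nonneg k _ hu.1).trans h1)
          have h5 : 0 ≤ trans p k (k + i) s u * p u (k + i) :=
            mul_nonneg (hp.trans_nonneg k _ hu.1) (hp.nonneg _ _)
          calc _ = trans p k (k + i) s u * p u (k + i) *
                (Real.exp (-cumRate p (k + i + 1) t) * Real.exp (cumRate p (k + i + 1) u)) := by ring
            _ ≤ trans p k (k + i) s u * p u (k + i) * 1 := by gcongr
            _ ≤ _ := by linarith
      _ = _ := by rw [intervalIntegral.integral_const, smul_eq_mul]; ring

/-- The forward equation, understood with right derivatives, has only the zero solution started
from zero. -/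
theorem IsRateFamily.eq_zero_of_forward (hp : IsRateFamily p J) {D : ℕ → ℝ → ℝ} {s : ℝ}
    (hc : ∀ m, ContinuousOn (D m) (Set.Ici s))
    (hd : ∀ m t, s ≤ t → HasDerivWithinAt (D m) (forwardRHS p t (fun i => D i t) m) (Set.Ici t) t)
    (h0 : ∀ m, D m s = 0) (m : ℕ) {t : ℝ} (ht : s ≤ t) : D m t = 0 := by
  induction m using Nat.strong_induction_on generalizing t with
  | _ m ih =>
    have hrhs : ∀ u, s ≤ u → forwardRHS p u (fun i => D i u) m = -(D m u * p u m) := by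
      intro u hu
      cases m with
      | zero => rfl
      | succ m => simp [forwardRHS, ih m (Nat.lt_succ_self m) hu]
    -- The inflow vanishes by induction, so `D m` times the integrating factor has zero right
    -- derivative.
    have hconst := constant_of_has_deriv_right_zero
      (f := fun u => D m u * Real.exp (cumRate p m u)) (a := s) (b := t)
      (((hc m).mono Set.Icc_subset_Ici_self).mul
        (Real.continuous_exp.comp (hp.continuous_cumRate m)).continuousOn) ?_ t ⟨ht, le_rfl⟩
    · simp only [h0, zero_mul] at hconst
      exact (mul_eq_zero.1 hconst).resolve_right (Real.exp_pos _).ne'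
    · intro u hu
      refine ((hd m u hu.1).mul
        (hp.hasDerivAt_cumRate m u).exp.hasDerivWithinAt).congr_deriv ?_
      rw [hrhs u hu.1]
      ring

theorem IsRateFamily.eq_of_forward (hp : IsRateFamily p J) {D D' : ℕ → ℝ → ℝ} {s : ℝ}
    (hc : ∀ m, ContinuousOn (D m) (Set.Ici s)) (hc' : ∀ m, ContinuousOn (D' m) (Set.Ici s))
    (hd : ∀ m t, s ≤ t → HasDerivWithinAt (D m) (forwardRHS p t (fun i => D i t) m) (Set.Ici t) t)
    (hd' : ∀ m t, s ≤ t →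
      HasDerivWithinAt (D' m) (forwardRHS p t (fun i => D' i t) m) (Set.Ici t) t)
    (h0 : ∀ m, D m s = D' m s) (m : ℕ) {t : ℝ} (ht : s ≤ t) : D m t = D' m t := by
  refine sub_eq_zero.1 (hp.eq_zero_of_forward (D := fun m t => D m t - D' m t)
    (fun m => (hc m).sub (hc' m)) (fun m t ht => ?_) (fun m => sub_eq_zero.2 (h0 m)) m ht)
  rw [forwardRHS_sub]
  exact (hd m t ht).sub (hd' m t ht)

/-- Both sides solve the forward equation in the final time and agree when it equals `t`. -/
theorem IsRateFamily.chapman_kolmogorov (hp : IsRateFamily p J) {k : ℕ} (hk : k < J) (m : ℕ)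
    (s : ℝ) {t u : ℝ} (htu : t ≤ u) :
    ∑ l ∈ Finset.range J, trans p k l s t * trans p l m t u = trans p k m s u := by
  refine hp.eq_of_forward (s := t)
    (D := fun m u => ∑ l ∈ Finset.range J, trans p k l s t * trans p l m t u)
    (D' := fun m u => trans p k m s u)
    (fun m => (continuous_finsetSum _ fun l _ =>
      continuous_const.mul (hp.continuous_trans l m t)).continuousOn)
    (fun m => (hp.continuous_trans k m s).continuousOn)
    (fun m v _ => ?_) (fun m v _ => (hp.hasDerivAt_trans k m s v).hasDerivWithinAt) (fun m => ?_)
    m htu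
  · rw [forwardRHS_sum]
    simp only [forwardRHS_mul_left]
    exact (HasDerivAt.fun_sum fun l _ =>
      (hp.hasDerivAt_trans l m t v).const_mul _).hasDerivWithinAt
  · simp only [trans_self, mul_ite, mul_one, mul_zero, Finset.sum_ite_eq', Finset.mem_range]
    split_ifs with hm
    · rfl
    · rw [hp.trans_eq_zero_of_le hk (not_lt.1 hm)]

end Forward

theorem IsRateFamily.exists_bound {p : ℝ → ℕ → ℝ} {J : ℕ} (hp : IsRateFamily p J) (T : ℝ) :
    ∃ C, 0 ≤ C ∧ ∀ u ∈ Set.Icc 0 T, ∀ k, p u k ≤ C := by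
  have hc : Continuous fun u => ∑ k ∈ Finset.range J, p u k :=
    continuous_finsetSum _ fun k _ => hp.continuous k
  obtain ⟨C, hC⟩ := isCompact_Icc.bddAbove_image (hc.continuousOn (s := Set.Icc 0 T))
  refine ⟨max C 0, le_max_right _ _, fun u hu k => ?_⟩
  by_cases hk : k < J
  · refine le_trans ?_ ((hC ⟨u, hu, rfl⟩).trans (le_max_left _ _))
    exact Finset.single_le_sum (f := fun k => p u k) (fun i _ => hp.nonneg u i)
      (Finset.mem_range.2 hk)
  · rw [hp.eq_zero u k (by omega)]
    exact le_max_right _ _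

/-! ### The rates as fluxes of the truncated geometric laws -/

/-- `1 + t + ⋯ + t ^ (J - 1)`. -/
def geomSum (J : ℕ) (t : ℝ) : ℝ := ∑ l ∈ Finset.range J, t ^ l

/-- The derivative of `geomSum J`. -/
def geomSumDeriv (J : ℕ) (t : ℝ) : ℝ := ∑ l ∈ Finset.range (J - 1), ((l : ℝ) + 1) * t ^ l

/-- The second sum in the numerator of the rates. -/
def rateTail (J k : ℕ) (t : ℝ) : ℝ :=
  ∑ l ∈ Finset.Ico (J - k - 2) (J - 1), ((l : ℝ) - J + k + 2) * t ^ l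

theorem rate_eq (J k : ℕ) (t : ℝ) :
    rate J t k = (((k : ℝ) + 1) * geomSumDeriv J t - J * rateTail J k t) / geomSum J t := rfl

theorem geomSum_succ (J : ℕ) (t : ℝ) : geomSum (J + 1) t = geomSum J t + t ^ J := by
  simp [geomSum, Finset.sum_range_succ]

theorem geomSumDeriv_succ (J : ℕ) (t : ℝ) :
    geomSumDeriv (J + 1) t = geomSumDeriv J t + J * t ^ (J - 1) := by
  cases J with
  | zero => simp [geomSumDeriv]
  | succ J => simp [geomSumDeriv, Finset.sum_range_succ]

theorem hasDerivAt_geomSum (J : ℕ) (t : ℝ) : HasDerivAt (geomSum J) (geomSumDeriv J t) t := by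
  induction J with
  | zero =>
    have : geomSum 0 = fun _ => 0 := funext fun t => by simp [geomSum]
    rw [this]
    simpa [geomSumDeriv] using hasDerivAt_const t (0 : ℝ)
  | succ J ih =>
    rw [geomSumDeriv_succ]
    have : geomSum (J + 1) = fun t => geomSum J t + t ^ J := funext fun t => geomSum_succ J t
    rw [this]
    exact ih.add (hasDerivAt_pow J t)

/-- This is the derivative of (t - 1) G(t) = t^J - 1, with G the geometric sum. -/
theorem geomSum_add_mul_geomSumDeriv (J : ℕ) (t : ℝ) :
    geomSum J t + t * geomSumDeriv J t = geomSumDeriv J t + J * t ^ (J - 1) := by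
  induction J with
  | zero => simp [geomSum, geomSumDeriv]
  | succ J ih =>
    rw [geomSum_succ, geomSumDeriv_succ]
    cases J with
    | zero => simp [geomSum, geomSumDeriv]
    | succ J =>
      simp only [Nat.add_sub_cancel] at ih ⊢
      push_cast at ih ⊢
      rw [pow_succ t J] at *
      linear_combination ih

theorem geomSum_ge_one {J : ℕ} (hJ : 0 < J) {t : ℝ} (ht : 0 ≤ t) : 1 ≤ geomSum J t := by
  have := Finset.single_le_sum (f := fun l => t ^ l) (fun i _ => pow_nonneg ht i)
    (Finset.mem_range.2 hJ)
  simpa [geomSum] using this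

theorem rateTail_of_le (k d : ℕ) (t : ℝ) :
    rateTail (k + 2 + d) k t = ∑ i ∈ Finset.range (k + 1), (i : ℝ) * t ^ (d + i) := by
  rw [rateTail, Finset.sum_Ico_eq_sum_range, show k + 2 + d - k - 2 = d by omega,
    show k + 2 + d - 1 - d = k + 1 by omega]
  refine Finset.sum_congr rfl fun i _ => ?_
  push_cast
  ring

/-- At the top state truncated subtraction makes the lower limit 0, where the true limit would be
-1. The coefficients become `l + 1`, so the tail is the whole derivative and the top rate vanishes.
-/
theorem rateTail_last (k : ℕ) (t : ℝ) : rateTail (k + 1) k t = geomSumDeriv (k + 1) t := by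
  rw [rateTail, show k + 1 - k - 2 = 0 by omega, geomSumDeriv, Finset.range_eq_Ico]
  refine Finset.sum_congr rfl fun i _ => ?_
  push_cast
  ring

/-- Raising `k` lowers the first index by one and raises each coefficient by one; multiplication by
`t` realigns the powers, and only the top term is new. This recursion drives the induction in
`geomSum_wronskian`. -/
theorem mul_rateTail_succ {J k : ℕ} (h : k + 2 ≤ J) (t : ℝ) :
    t * rateTail J (k + 1) t = rateTail J k t + (k + 1) * t ^ (J - 1) := by
  obtain ⟨d, rfl⟩ := Nat.exists_eq_add_of_le h
  rw [rateTail_of_le, show k + 2 + d - 1 = d + (k + 1) by omega]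
  have hs := Finset.sum_range_succ (fun i => (i : ℝ) * t ^ (d + i)) (k + 1)
  push_cast at hs
  rw [← hs, Finset.sum_range_succ']
  simp only [Nat.cast_zero, zero_mul, add_zero]
  cases d with
  | zero =>
    rw [Nat.add_zero, rateTail_last (k + 1), geomSumDeriv, Finset.mul_sum]
    refine Finset.sum_congr rfl fun i _ => ?_
    push_cast
    ring
  | succ d =>
    rw [show k + 2 + (d + 1) = (k + 1) + 2 + d by ring, rateTail_of_le, Finset.mul_sum,
      Finset.sum_range_succ']
    simp only [Nat.cast_zero, zero_mul, add_zero, mul_zero]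
    refine Finset.sum_congr rfl fun i _ => ?_
    push_cast
    ring

/-- Up to sign, the left side is the numerator of the derivative of F_k = G_(k+1) / G_J, with G_i
the sum of the first i powers. The bracket on the right is the numerator of the rate. -/
theorem geomSum_wronskian {J k : ℕ} (hk : k < J) (t : ℝ) :
    geomSum (k + 1) t * geomSumDeriv J t - geomSumDeriv (k + 1) t * geomSum J t =
      t ^ k * (((k : ℝ) + 1) * geomSumDeriv J t - J * rateTail J k t) := by
  induction k with
  | zero =>
    have h : rateTail J 0 t = 0 := by
      obtain rfl | ⟨d, rfl⟩ : J = 1 ∨ ∃ d, J = 0 + 2 + d := by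
        rcases Nat.lt_or_ge J 2 with h | h
        · left; omega
        · right; exact ⟨J - 2, by omega⟩
      · simp [rateTail]
      · rw [rateTail_of_le]; simp
    simp [h, geomSum, geomSumDeriv]
  | succ k ih =>
    have ih := ih (by omega)
    have h1 := mul_rateTail_succ (show k + 2 ≤ J by omega) t
    have h2 := geomSum_add_mul_geomSumDeriv J t
    rw [geomSum_succ (k + 1), geomSumDeriv_succ (k + 1), Nat.add_sub_cancel]
    push_cast
    rw [pow_succ]
    linear_combination ih + J * t ^ k * h1 - (k + 1) * t ^ k * h2

theorem rate_nonneg {J k : ℕ} (hk : k < J) {t : ℝ} (ht : 0 ≤ t) : 0 ≤ rate J t k := by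
  rw [rate_eq]
  refine div_nonneg ?_ (zero_le_one.trans (geomSum_ge_one (by omega) ht))
  have htail : rateTail J k t = ∑ l ∈ Finset.range (J - 1),
      if J - k - 2 ≤ l then ((l : ℝ) - J + k + 2) * t ^ l else 0 := by
    rw [rateTail, ← Finset.sum_filter]
    refine Finset.sum_congr ?_ fun _ _ => rfl
    ext l
    simp only [Finset.mem_Ico, Finset.mem_filter, Finset.mem_range]
    tauto
  rw [htail, geomSumDeriv, Finset.mul_sum, Finset.mul_sum, ← Finset.sum_sub_distrib]
  refine Finset.sum_nonneg fun l hl => ?_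
  have hl' : ((l + 1 : ℕ) : ℝ) ≤ J := by
    have := Finset.mem_range.1 hl
    exact_mod_cast (by omega : l + 1 ≤ J)
  have hk' : ((k + 1 : ℕ) : ℝ) ≤ J := by exact_mod_cast hk
  push_cast at hl' hk'
  split_ifs
  -- The coefficient factors: (k+1)(l+1) - J(l-J+k+2) = (J-1-k)(J-1-l).
  · have : 0 ≤ ((J : ℝ) - 1 - k) * (J - 1 - l) * t ^ l :=
      mul_nonneg (mul_nonneg (by linarith) (by linarith)) (pow_nonneg ht l)
    linarith
  · rw [mul_zero, sub_zero]; positivity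

theorem rate_last (k : ℕ) (t : ℝ) : rate (k + 1) t k = 0 := by
  rw [rate_eq, rateTail_last]
  push_cast
  simp

/-- The rates `rate J`, extended to a rate family on the states `0, …, J - 1` and all times. -/
def birthRate (J : ℕ) (t : ℝ) (k : ℕ) : ℝ := if k + 1 < J then rate J (max t 0) k else 0

theorem birthRate_eq {J k : ℕ} (hk : k < J) {t : ℝ} (ht : 0 ≤ t) : birthRate J t k = rate J t k := by
  rw [birthRate, max_eq_left ht]
  split_ifs with h
  · rfl
  · obtain rfl : J = k + 1 := by omega
    rw [rate_last]

/-- Clamping the time at 0 keeps the denominator at least 1, so the rates are continuous on the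
whole line. -/
theorem isRateFamily_birthRate (J : ℕ) : IsRateFamily (birthRate J) J where
  continuous k := by
    unfold birthRate
    split_ifs with h
    · simp only [rate_eq]
      have hm : Continuous fun t : ℝ => max t 0 := continuous_id.max continuous_const
      refine Continuous.div ?_ ?_ fun t => ?_
      · unfold geomSumDeriv rateTail
        fun_prop
      · unfold geomSum
        fun_prop
      · exact (zero_lt_one.trans_le (geomSum_ge_one (by omega) (le_max_right t 0))).ne'
    · exact continuous_const
  nonneg t k := by
    unfold birthRate
    split_ifs with h
    · exact rate_nonneg (by omega) (le_max_right t 0)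
    · exact le_rfl
  eq_zero t k h := if_neg (by omega)

/-- The truncated geometric distribution on `0, …, J - 1`. -/
def truncGeom (J : ℕ) (t : ℝ) (k : ℕ) : ℝ := if k < J then t ^ k / geomSum J t else 0

/-- The distribution function of the truncated geometric distribution. -/
def truncGeomCdf (J k : ℕ) (t : ℝ) : ℝ := geomSum (min (k + 1) J) t / geomSum J t

theorem sum_truncGeom (J k : ℕ) (t : ℝ) :
    ∑ i ∈ Finset.range (k + 1), truncGeom J t i = truncGeomCdf J k t := by
  unfold truncGeom truncGeomCdf
  rw [← Finset.sum_filter, ← Finset.sum_div, geomSum]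
  congr 1
  refine Finset.sum_congr ?_ fun _ _ => rfl
  ext i
  simp only [Finset.mem_filter, Finset.mem_range, lt_min_iff]

theorem truncGeom_nonneg (J k : ℕ) {t : ℝ} (ht : 0 ≤ t) : 0 ≤ truncGeom J t k := by
  unfold truncGeom
  split_ifs with h
  · exact div_nonneg (pow_nonneg ht k) (zero_le_one.trans (geomSum_ge_one (by omega) ht))
  · exact le_rfl

theorem truncGeom_pos {J k : ℕ} (hk : k < J) {t : ℝ} (ht : 0 < t) : 0 < truncGeom J t k := by
  rw [truncGeom, if_pos hk]
  exact div_pos (pow_pos ht k) (zero_lt_one.trans_le (geomSum_ge_one (by omega) ht.le))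

theorem truncGeom_le_one {J : ℕ} (k : ℕ) {t : ℝ} (ht : 0 ≤ t) : truncGeom J t k ≤ 1 := by
  unfold truncGeom
  split_ifs with h
  · rw [div_le_one (zero_lt_one.trans_le (geomSum_ge_one (by omega) ht))]
    exact Finset.single_le_sum (f := fun l => t ^ l) (fun i _ => pow_nonneg ht i)
      (Finset.mem_range.2 h)
  · exact zero_le_one

theorem truncGeom_zero {J : ℕ} (hJ : 0 < J) (k : ℕ) : truncGeom J 0 k = if k = 0 then 1 else 0 := by
  have h : geomSum J 0 = 1 := by
    obtain ⟨J, rfl⟩ : ∃ i, J = i + 1 := ⟨J - 1, by omega⟩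
    simp [geomSum, Finset.sum_range_succ']
  rw [truncGeom, h, div_one]
  rcases Nat.eq_zero_or_pos k with rfl | hk
  · simp [hJ]
  · simp [hk.ne']

/-- The origin of the rates: the set {0, …, k} loses mass exactly at the speed (mass of `k`) × (rate
from `k`). For k ≥ J - 1 there is no loss. -/
theorem hasDerivAt_truncGeomCdf {J : ℕ} (hJ : 0 < J) (k : ℕ) {t : ℝ} (ht : 0 ≤ t) :
    HasDerivAt (truncGeomCdf J k) (-(truncGeom J t k * birthRate J t k)) t := by
  have h0 : geomSum J t ≠ 0 := (zero_lt_one.trans_le (geomSum_ge_one hJ ht)).ne'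
  refine ((hasDerivAt_geomSum (min (k + 1) J) t).div (hasDerivAt_geomSum J t) h0).congr_deriv ?_
  rcases Nat.lt_or_ge (k + 1) J with h | h
  · rw [min_eq_left h.le, birthRate_eq (by omega) ht, truncGeom, if_pos (by omega), rate_eq]
    have := geomSum_wronskian (show k < J by omega) t
    field_simp
    linear_combination -this
  · rw [min_eq_right h, birthRate, if_neg (by omega)]
    simp [mul_comm]

theorem hasDerivAt_truncGeom {J : ℕ} (hJ : 0 < J) (k : ℕ) {t : ℝ} (ht : 0 ≤ t) :
    HasDerivAt (fun t => truncGeom J t k)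
      (forwardRHS (birthRate J) t (fun i => truncGeom J t i) k) t := by
  cases k with
  | zero =>
    have : (fun t => truncGeom J t 0) = truncGeomCdf J 0 := by
      ext t; rw [← sum_truncGeom]; simp
    rw [this]
    exact hasDerivAt_truncGeomCdf hJ 0 ht
  | succ k =>
    have : (fun t => truncGeom J t (k + 1)) =
        fun t => truncGeomCdf J (k + 1) t - truncGeomCdf J k t := by
      ext t; rw [← sum_truncGeom, ← sum_truncGeom, Finset.sum_range_succ _ (k + 1)]; ring
    rw [this]
    refine ((hasDerivAt_truncGeomCdf hJ (k + 1) ht).sub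
      (hasDerivAt_truncGeomCdf hJ k ht)).congr_deriv ?_
    simp only [forwardRHS]
    ring

/-! ### Cylinder events and the Markov property in product form -/

section Markov

variable {Ω : Type*} {α : Type*}

/-- The cylinder event that the process follows `x` at the times in `I`. -/
def cyl (X : ℝ≥0 → Ω → α) (I : Finset ℝ≥0) (x : ℝ≥0 → α) : Set Ω := {ω | ∀ t ∈ I, X t ω = x t}

theorem cyl_empty (X : ℝ≥0 → Ω → α) (x : ℝ≥0 → α) : cyl X ∅ x = Set.univ := by simp [cyl]

theorem cyl_insert (X : ℝ≥0 → Ω → α) (I : Finset ℝ≥0) (x : ℝ≥0 → α) (t : ℝ≥0) :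
    cyl X (insert t I) x = cyl X I x ∩ {ω | X t ω = x t} := by
  ext ω; simp [cyl, and_comm]

theorem cyl_congr (X : ℝ≥0 → Ω → α) {I : Finset ℝ≥0} {x y : ℝ≥0 → α} (h : ∀ t ∈ I, x t = y t) :
    cyl X I x = cyl X I y := by
  ext ω
  exact forall₂_congr fun t ht => by rw [h t ht]

variable [MeasurableSpace Ω] [MeasurableSpace α] [MeasurableSingletonClass α] {X : ℝ≥0 → Ω → α} {P : Measure Ω}

theorem measurableSet_eq_state (hX : ∀ t, Measurable (X t)) (t : ℝ≥0) (a : α) :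
    MeasurableSet {ω | X t ω = a} := hX t (measurableSet_singleton a)

theorem measurableSet_cyl (hX : ∀ t, Measurable (X t)) (I : Finset ℝ≥0) (x : ℝ≥0 → α) :
    MeasurableSet (cyl X I x) := by
  have : cyl X I x = ⋂ t ∈ I, {ω | X t ω = x t} := by ext ω; simp [cyl]
  rw [this]
  exact Finset.measurableSet_biInter _ fun t _ => measurableSet_eq_state hX t _

theorem condReal_apply {A : Set Ω} (hA : MeasurableSet A) (P : Measure Ω) (B : Set Ω) :
    (P[|A]).real B = (P.real A)⁻¹ * P.real (A ∩ B) := by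
  rw [measureReal_def, cond_apply hA, ENNReal.toReal_mul, ENNReal.toReal_inv]
  rfl

/-- Cross-multiplying removes the conditional probabilities: the identity is trivial on null
cylinders, and it can be summed and multiplied. Finite sets of times replace increasing tuples. -/
theorem isMarkov_iff [IsProbabilityMeasure P] (hX : ∀ t, Measurable (X t)) :
    IsMarkov X P ↔ ∀ (I : Finset ℝ≥0) (x : ℝ≥0 → α) (s t : ℝ≥0) (y : α), s ∈ I →
      (∀ u ∈ I, u ≤ s) → s < t →
      P.real (cyl X I x ∩ {ω | X t ω = y}) * P.real {ω | X s ω = x s} =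
        P.real (cyl X I x) * P.real ({ω | X s ω = x s} ∩ {ω | X t ω = y}) := by
  constructor
  · intro h I x s t y hs hmax hst
    by_cases h0 : P (cyl X I x) = 0
    · rw [measureReal_def, measureReal_def, measureReal_def P (cyl X I x), h0,
        measure_mono_null Set.inter_subset_left h0]
      simp
    obtain ⟨k, hk⟩ : ∃ k, I.card = k + 1 :=
      ⟨I.card - 1, by have := Finset.card_pos.2 ⟨s, hs⟩; omega⟩
    have hrange := I.range_orderEmbOfFin hk
    have hlast : I.orderEmbOfFin hk (Fin.last k) = s := by
      refine le_antisymm (hmax _ (Finset.orderEmbOfFin_mem I hk _)) ?_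
      obtain ⟨i, hi⟩ : s ∈ Set.range (I.orderEmbOfFin hk) := by rw [hrange]; exact hs
      rw [← hi]
      exact (I.orderEmbOfFin hk).monotone (Fin.le_last i)
    have hcyl : {ω | ∀ i, X (I.orderEmbOfFin hk i) ω = x (I.orderEmbOfFin hk i)} = cyl X I x := by
      ext ω
      simp only [cyl, Set.mem_ofPred_eq]
      refine ⟨fun h t ht => ?_, fun h i => h _ (Finset.orderEmbOfFin_mem I hk i)⟩
      obtain ⟨i, rfl⟩ : t ∈ Set.range (I.orderEmbOfFin hk) := by rw [hrange]; exact ht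
      exact h i
    have := h k (I.orderEmbOfFin hk) t (I.orderEmbOfFin hk).strictMono (by rw [hlast]; exact hst)
      (fun i => x (I.orderEmbOfFin hk i)) y (by rw [hcyl]; exact h0)
    rw [hcyl, hlast] at this
    have h2 := congrArg ENNReal.toReal this
    change (P[|_]).real _ = (P[|_]).real _ at h2
    rw [condReal_apply (measurableSet_cyl hX I x), condReal_apply (measurableSet_eq_state hX _ _)]
      at h2
    have hA : P.real (cyl X I x) ≠ 0 := by
      rw [measureReal_def]; exact (ENNReal.toReal_pos h0 (measure_ne_top _ _)).ne'
    have hB : P.real {ω | X s ω = x s} ≠ 0 := by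
      refine ((measureReal_nonneg.lt_of_ne' hA).trans_le
        (measureReal_mono (fun ω hω => hω s hs))).ne'
    field_simp at h2
    linarith
  · intro h k s t hs hst x y h0
    have hinj := hs.injective
    -- Only the values at the times `s i` matter; the default is arbitrary.
    set x' : ℝ≥0 → α := Function.extend s x fun _ => x 0 with hx'
    have hxs : ∀ i, x' (s i) = x i := fun i => hinj.extend_apply x _ i
    have hcyl : {ω | ∀ i, X (s i) ω = x i} = cyl X (Finset.univ.image s) x' := by
      ext ω; simp [cyl, hxs]
    have key := h (Finset.univ.image s) x' (s (Fin.last k)) t y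
      (Finset.mem_image_of_mem _ (Finset.mem_univ _))
      (fun u hu => by
        obtain ⟨i, -, rfl⟩ := Finset.mem_image.1 hu
        exact hs.monotone (Fin.le_last i)) hst
    rw [← hcyl, hxs] at key
    have hm1 : MeasurableSet {ω | ∀ i, X (s i) ω = x i} := by
      rw [hcyl]; exact measurableSet_cyl hX _ _
    have hA : P.real {ω | ∀ i, X (s i) ω = x i} ≠ 0 := by
      rw [measureReal_def]; exact (ENNReal.toReal_pos h0 (measure_ne_top _ _)).ne'
    have hB : P.real {ω | X (s (Fin.last k)) ω = x (Fin.last k)} ≠ 0 :=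
      ((measureReal_nonneg.lt_of_ne' hA).trans_le
        (measureReal_mono (fun ω hω => hω (Fin.last k)))).ne'
    refine (ENNReal.toReal_eq_toReal_iff' (measure_ne_top _ _) (measure_ne_top _ _)).1 ?_
    change (P[|_]).real _ = (P[|_]).real _
    rw [condReal_apply hm1, condReal_apply (measurableSet_eq_state hX _ _)]
    field_simp
    linarith

/-- The Markov property at time `t` for a cylinder event that involves times up to `t`. -/
theorem IsMarkov.cyl_inter [IsProbabilityMeasure P] (hX : ∀ t, Measurable (X t))
    (hM : IsMarkov X P) {I : Finset ℝ≥0} (x : ℝ≥0 → α) {t u : ℝ≥0} (hI : ∀ s ∈ I, s ≤ t)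
    (htu : t < u) (a b : α) :
    P.real (cyl X I x ∩ {ω | X t ω = a} ∩ {ω | X u ω = b}) * P.real {ω | X t ω = a} =
      P.real (cyl X I x ∩ {ω | X t ω = a}) * P.real ({ω | X t ω = a} ∩ {ω | X u ω = b}) := by
  classical
  -- If `x` already prescribes another value at `t`, the event is empty; otherwise `t` can be
  -- adjoined to the cylinder.
  by_cases h : t ∈ I ∧ x t ≠ a
  · have : cyl X I x ∩ {ω | X t ω = a} = ∅ := by
      ext ω
      simp only [Set.mem_inter_iff, Set.mem_ofPred_eq, Set.mem_empty_iff_false, iff_false, not_and]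
      intro h1 h2
      exact h.2 ((h1 t h.1).symm.trans h2)
    simp [this]
  · have hcyl : cyl X (insert t I) (Function.update x t a) = cyl X I x ∩ {ω | X t ω = a} := by
      rw [cyl_insert, Function.update_self]
      congr 1
      refine cyl_congr X fun s hs => ?_
      by_cases hst : s = t
      · subst hst
        rw [Function.update_self]
        by_contra hne
        exact h ⟨hs, fun e => hne e.symm⟩
      · rw [Function.update_of_ne hst]
    have := (isMarkov_iff hX).1 hM (insert t I) (Function.update x t a) t u b
      (Finset.mem_insert_self _ _) (fun s hs => by
        rcases Finset.mem_insert.1 hs with rfl | hs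
        · exact le_rfl
        · exact hI s hs) htu
    rwa [hcyl, Function.update_self] at this

end Markov

/-! ### The law of a birth process is determined by its rates -/

section Birth

variable {Ω : Type*} [MeasurableSpace Ω] {P : Measure Ω} {X : ℝ≥0 → Ω → ℕ} {p : ℝ → ℕ → ℝ} {J : ℕ}

/-- Right-continuity and the absence of a jump at the fixed time `t` combine; at 0 there is only a
right side. This yields the continuity that uniqueness for the forward equation needs. -/
theorem ae_eventually_eq (hc : ∀ ω, IsCadlag fun t => X t ω)
    (hj : ∀ t, 0 < t → ∀ᵐ ω ∂P, HasLeftLimit (fun s => X s ω) t (X t ω)) (t : ℝ≥0) :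
    ∀ᵐ ω ∂P, ∀ᶠ s in 𝓝 t, X s ω = X t ω := by
  have hright : ∀ ω, ∀ᶠ s in 𝓝[≥] t, X s ω = X t ω := by
    intro ω
    rw [← Set.Ioi_insert, nhdsWithin_insert]
    exact eventually_sup.2 ⟨rfl, (hc ω).1 t⟩
  rcases eq_or_lt_of_le (zero_le : 0 ≤ t) with h | h
  · refine ae_of_all _ fun ω => ?_
    have := hright ω
    rw [← h] at this ⊢
    rwa [show Set.Ici (0 : ℝ≥0) = Set.univ from Set.eq_univ_of_forall fun _ => Set.mem_Ici.2 zero_le,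
      nhdsWithin_univ] at this
  · filter_upwards [hj t h] with ω hω
    rw [← nhdsLT_sup_nhdsGE]
    exact eventually_sup.2 ⟨hω, hright ω⟩

variable [IsProbabilityMeasure P]

theorem continuous_measureReal_inter (hX : ∀ t, Measurable (X t))
    (he : ∀ t, ∀ᵐ ω ∂P, ∀ᶠ s in 𝓝 t, X s ω = X t ω) {E : Set Ω} (hE : MeasurableSet E) (m : ℕ) :
    Continuous fun t => P.real (E ∩ {ω | X t ω = m}) := by
  refine continuous_iff_continuousAt.2 fun t => ?_
  refine (ENNReal.tendsto_toReal (measure_ne_top P _)).comp ?_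
  refine tendsto_measure_of_ae_tendsto_indicator_of_isFiniteMeasure (𝓝 t)
    (hE.inter (measurableSet_eq_state hX _ _)) (fun s => hE.inter (measurableSet_eq_state hX _ _)) ?_
  filter_upwards [he t] with ω hω
  filter_upwards [hω] with s hs
  simp [hs]

theorem sum_measureReal_inter (hX : ∀ t, Measurable (X t)) (hlt : ∀ t ω, X t ω < J) {N : ℕ}
    (hN : J ≤ N) (t : ℝ≥0) {F : Set Ω} (hF : MeasurableSet F) :
    ∑ i ∈ Finset.range N, P.real (F ∩ {ω | X t ω = i}) = P.real F := by
  rw [← measureReal_biUnion_finset]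
  · congr 1
    ext ω
    simp only [Set.mem_iUnion, Set.mem_inter_iff, Set.mem_ofPred_eq, Finset.mem_range]
    exact ⟨fun ⟨i, _, h, _⟩ => h, fun h => ⟨X t ω, (hlt t ω).trans_le hN, h, rfl⟩⟩
  · intro i _ j _ hij
    refine Set.disjoint_left.2 fun ω h1 h2 => hij (h1.2.symm.trans h2.2)
  · exact fun i _ => hF.inter (measurableSet_eq_state hX _ _)

/-- One infinitesimal step from the mass vector `v`, with errors dropped, is an Euler step of the
forward equation. -/
theorem sum_mul_rates (v : ℕ → ℝ) (t h : ℝ) {m N : ℕ} (hm : m < N) :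
    ∑ i ∈ Finset.range N, v i * (if m = i then 1 - h * p t i else
      if m = i + 1 then h * p t i else 0) = v m + h * forwardRHS p t v m := by
  have hsplit : ∀ i, v i * (if m = i then 1 - h * p t i else if m = i + 1 then h * p t i else 0) =
      (if m = i then v i * (1 - h * p t i) else 0) + (if m = i + 1 then v i * (h * p t i) else 0) := by
    intro i
    by_cases h1 : m = i
    · simp [h1]
    · simp [h1]
  simp only [hsplit, Finset.sum_add_distrib]
  rw [Finset.sum_ite_eq, if_pos (Finset.mem_range.2 hm)]
  cases m with
  | zero => simp [forwardRHS]; ring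
  | succ m =>
    simp only [Nat.add_right_cancel_iff]
    rw [Finset.sum_ite_eq, if_pos (Finset.mem_range.2 (by omega))]
    simp only [forwardRHS]
    ring

theorem hasDerivWithinAt_of_isLittleO {f : ℝ≥0 → ℝ} {c : ℝ} {t : ℝ≥0}
    (h : (fun h : ℝ≥0 => f (t + h) - (f t + h * c)) =o[𝓝[>] 0] fun h : ℝ≥0 => (h : ℝ)) :
    HasDerivWithinAt (fun r : ℝ => f r.toNNReal) c (Set.Ici (t : ℝ)) t := by
  rw [← hasDerivWithinAt_Ioi_iff_Ici, hasDerivWithinAt_iff_isLittleO]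
  have ht : Tendsto (fun r : ℝ => (r - t).toNNReal) (𝓝[>] (t : ℝ)) (𝓝[>] 0) := by
    refine tendsto_nhdsWithin_iff.2 ⟨?_, ?_⟩
    · have : Tendsto (fun r : ℝ => (r - t).toNNReal) (𝓝 (t : ℝ)) (𝓝 ((t : ℝ) - t).toNNReal) :=
        (continuous_real_toNNReal.comp (continuous_id.sub continuous_const)).tendsto _
      rw [sub_self, Real.toNNReal_zero] at this
      exact this.mono_left nhdsWithin_le_nhds
    · filter_upwards [self_mem_nhdsWithin] with r hr
      simpa using hr
  refine (h.comp_tendsto ht).congr' ?_ ?_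
  · filter_upwards [self_mem_nhdsWithin] with r hr
    have hr' : (t : ℝ) < r := hr
    have h1 : r.toNNReal = t + (r - t).toNNReal := by
      rw [← NNReal.coe_inj]
      push_cast
      rw [Real.coe_toNNReal _ (t.2.trans hr'.le), Real.coe_toNNReal _ (by linarith)]
      ring
    simp only [Function.comp, ← h1, Real.toNNReal_coe, smul_eq_mul]
    rw [Real.coe_toNNReal _ (by linarith)]
    ring
  · filter_upwards [self_mem_nhdsWithin] with r hr
    have hr' : (t : ℝ) < r := hr
    simp only [Function.comp]
    rw [Real.coe_toNNReal _ (by linarith)]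

/-- Split according to the state at time `t`. By `hM` the event `E` enters only through the masses
`v i`, and the errors are finitely many o(h) terms. -/
theorem IsBirthProcess.hasDerivWithinAt (hB : IsBirthProcess p X P) (hlt : ∀ t ω, X t ω < J)
    {E : Set Ω} (hE : MeasurableSet E) {t : ℝ≥0}
    (hM : ∀ u > t, ∀ i m, P.real (E ∩ {ω | X t ω = i} ∩ {ω | X u ω = m}) * P.real {ω | X t ω = i} =
      P.real (E ∩ {ω | X t ω = i}) * P.real ({ω | X t ω = i} ∩ {ω | X u ω = m})) (m : ℕ) :
    HasDerivWithinAt (fun r : ℝ => P.real (E ∩ {ω | X r.toNNReal ω = m}))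
      (forwardRHS p t (fun i => P.real (E ∩ {ω | X t ω = i})) m) (Set.Ici (t : ℝ)) t := by
  refine hasDerivWithinAt_of_isLittleO (f := fun r => P.real (E ∩ {ω | X r ω = m})) ?_
  set v : ℕ → ℝ := fun i => P.real (E ∩ {ω | X t ω = i}) with hv
  -- The range contains all states and also `m`, which may exceed them.
  have hterm : ∀ i ∈ Finset.range (J + m + 1),
      (fun h : ℝ≥0 => v i * ((P[|{ω | X t ω = i}]).real {ω | X (t + h) ω = m}
        - (if m = i then 1 - (h : ℝ) * p t i else if m = i + 1 then (h : ℝ) * p t i else 0)))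
      =o[𝓝[>] 0] fun h : ℝ≥0 => (h : ℝ) := by
    intro i _
    by_cases h0 : P {ω | X t ω = i} = 0
    · have : v i = 0 := by
        simp only [hv]
        rw [measureReal_def, measure_mono_null Set.inter_subset_right h0, ENNReal.toReal_zero]
      simp only [this, zero_mul]
      exact Asymptotics.isLittleO_zero _ _
    · exact (hB.rates t i m h0).const_mul_left _
  have hsum := Asymptotics.IsLittleO.sum hterm
  refine hsum.congr' ?_ (EventuallyEq.refl _ _)
  filter_upwards [self_mem_nhdsWithin] with h hh
  have hh' : t < t + h := lt_add_of_pos_right t hh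
  rw [Finset.sum_apply]
  simp only [mul_sub, Finset.sum_sub_distrib]
  rw [sum_mul_rates v t h (by omega : m < J + m + 1)]
  congr 1
  rw [← sum_measureReal_inter hB.measurable hlt (by omega : J ≤ J + m + 1) t
    (hE.inter (measurableSet_eq_state hB.measurable (t + h) m))]
  refine Finset.sum_congr rfl fun i _ => ?_
  rw [Set.inter_right_comm, condReal_apply (measurableSet_eq_state hB.measurable _ _)]
  by_cases h0 : P.real {ω | X t ω = i} = 0
  · have h1 : v i = 0 := le_antisymm ((measureReal_mono Set.inter_subset_right).trans h0.le)
      measureReal_nonneg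
    have h2 : P.real (E ∩ {ω | X t ω = i} ∩ {ω | X (t + h) ω = m}) = 0 :=
      le_antisymm ((measureReal_mono Set.inter_subset_left).trans h1.le) measureReal_nonneg
    rw [h1, h2, zero_mul]
  · have := hM (t + h) hh' i m
    rw [hv]
    field_simp
    linarith

/-- The transition probabilities of a birth process are given by `trans`. -/
theorem IsBirthProcess.measureReal_cyl_inter (hp : IsRateFamily p J) (hB : IsBirthProcess p X P)
    (hlt : ∀ t ω, X t ω < J) {I : Finset ℝ≥0} (x : ℝ≥0 → ℕ) {s t : ℝ≥0} (hI : ∀ u ∈ I, u ≤ s)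
    (hst : s ≤ t) (m : ℕ) :
    P.real (cyl X I x ∩ {ω | X t ω = m}) =
      ∑ k ∈ Finset.range J, P.real (cyl X I x ∩ {ω | X s ω = k}) * trans p k m s t := by
  have hE := measurableSet_cyl hB.measurable I x
  have hcont : ∀ m, Continuous fun r : ℝ => P.real (cyl X I x ∩ {ω | X r.toNNReal ω = m}) :=
    fun m => (continuous_measureReal_inter hB.measurable
      (ae_eventually_eq hB.cadlag hB.no_fixed_jump) hE m).comp continuous_real_toNNReal
  -- Both sides solve the forward equation from time `s` with the same initial masses.
  have := hp.eq_of_forward (s := s)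
    (D := fun m r => P.real (cyl X I x ∩ {ω | X r.toNNReal ω = m}))
    (D' := fun m r => ∑ k ∈ Finset.range J, P.real (cyl X I x ∩ {ω | X s ω = k}) * trans p k m s r)
    (fun m => (hcont m).continuousOn)
    (fun m => (continuous_finsetSum _ fun l _ =>
      continuous_const.mul (hp.continuous_trans l m s)).continuousOn)
    (fun m r hr => ?_) (fun m r _ => ?_) (fun m => ?_) m (NNReal.coe_le_coe.2 hst)
  · simpa using this
  · have hr0 : 0 ≤ r := s.2.trans hr
    have h := hB.hasDerivWithinAt hlt hE (t := r.toNNReal)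
      (fun u hu i m => hB.markov.cyl_inter hB.measurable x
        (fun v hv => (hI v hv).trans (NNReal.le_toNNReal_of_coe_le hr)) hu i m) m
    rwa [Real.coe_toNNReal _ hr0] at h
  · rw [forwardRHS_sum]
    simp only [forwardRHS_mul_left]
    exact (HasDerivAt.fun_sum fun l _ =>
      (hp.hasDerivAt_trans l m s r).const_mul _).hasDerivWithinAt
  · simp only [Real.toNNReal_coe, trans_self, mul_ite, mul_one, mul_zero, Finset.sum_ite_eq',
      Finset.mem_range]
    split_ifs with hm
    · rfl
    · have : {ω | X s ω = m} = ∅ := by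
        ext ω
        have := hlt s ω
        simp only [Set.mem_ofPred_eq, Set.mem_empty_iff_false, iff_false]
        omega
      simp [this]

theorem IsBirthProcess.measureReal_cyl_inter_of_mem (hp : IsRateFamily p J)
    (hB : IsBirthProcess p X P) (hlt : ∀ t ω, X t ω < J) {I : Finset ℝ≥0} (x : ℝ≥0 → ℕ)
    {s t : ℝ≥0} (hI : ∀ u ∈ I, u ≤ s) (hs : s ∈ I) (hst : s ≤ t) (m : ℕ) :
    P.real (cyl X I x ∩ {ω | X t ω = m}) = P.real (cyl X I x) * trans p (x s) m s t := by
  rw [hB.measureReal_cyl_inter hp hlt x hI hst m]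
  have hk : ∀ k, P.real (cyl X I x ∩ {ω | X s ω = k}) = if x s = k then P.real (cyl X I x) else 0 := by
    intro k
    split_ifs with h
    · congr 1
      exact Set.inter_eq_left.2 fun ω hω => (hω s hs).trans h
    · have : cyl X I x ∩ {ω | X s ω = k} = ∅ := by
        ext ω
        simp only [Set.mem_inter_iff, Set.mem_ofPred_eq, Set.mem_empty_iff_false, iff_false, not_and]
        exact fun h1 h2 => h ((h1 s hs).symm.trans h2)
      simp [this]
  simp only [hk, ite_mul, zero_mul, Finset.sum_ite_eq, Finset.mem_range]
  split_ifs with h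
  · rfl
  · have : cyl X I x = ∅ := by
      ext ω
      have h2 := hlt s ω
      simp only [Set.mem_empty_iff_false, iff_false]
      intro h1
      rw [h1 s hs] at h2
      exact h h2
    simp [this]

theorem IsBirthProcess.measureReal_eq (hp : IsRateFamily p J) (hB : IsBirthProcess p X P)
    (hlt : ∀ t ω, X t ω < J) (t : ℝ≥0) (m : ℕ) :
    P.real {ω | X t ω = m} = trans p 0 m 0 t := by
  have h := hB.measureReal_cyl_inter hp hlt (I := ∅) (fun _ => 0) (s := 0) (t := t) (by simp)
    zero_le m
  rw [cyl_empty] at h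
  simp only [Set.univ_inter] at h
  rw [h]
  have hJ : 0 < J := by
    obtain ⟨ω⟩ := nonempty_of_isProbabilityMeasure P
    exact (Nat.zero_le _).trans_lt (hlt 0 ω)
  have hk : ∀ k, P.real {ω | X 0 ω = k} = if 0 = k then 1 else 0 := by
    intro k
    split_ifs with h
    · subst h
      rw [measureReal_def, (prob_compl_eq_zero_iff (measurableSet_eq_state hB.measurable 0 0)).1
        hB.initial, ENNReal.toReal_one]
    · rw [measureReal_def, measure_eq_zero_iff_ae_notMem.2, ENNReal.toReal_zero]
      filter_upwards [hB.initial] with ω hω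
      simp [hω, h]
  simp [hk, hJ]

/-- The law of a birth process is determined by its rates. -/
theorem IsBirthProcess.measureReal_cyl_eq {Ω' : Type*} [MeasurableSpace Ω'] {P' : Measure Ω'}
    [IsProbabilityMeasure P'] {X' : ℝ≥0 → Ω' → ℕ} (hp : IsRateFamily p J)
    (hB : IsBirthProcess p X P) (hlt : ∀ t ω, X t ω < J) (hB' : IsBirthProcess p X' P')
    (hlt' : ∀ t ω, X' t ω < J) (I : Finset ℝ≥0) (x : ℝ≥0 → ℕ) :
    P.real (cyl X I x) = P'.real (cyl X' I x) := by
  induction I using Finset.induction_on_max with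
  | empty => simp [cyl_empty]
  | insert t I hI ih =>
    rw [cyl_insert, cyl_insert]
    rcases I.eq_empty_or_nonempty with rfl | hne
    · simp only [cyl_empty, Set.univ_inter]
      rw [hB.measureReal_eq hp hlt, hB'.measureReal_eq hp hlt']
    · have hmax : ∀ u ∈ I, u ≤ I.max' hne := fun u hu => I.le_max' u hu
      have hlt2 := (hI _ (I.max'_mem hne)).le
      rw [hB.measureReal_cyl_inter_of_mem hp hlt x hmax (I.max'_mem hne) hlt2,
        hB'.measureReal_cyl_inter_of_mem hp hlt' x hmax (I.max'_mem hne) hlt2, ih]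

theorem IsBirthProcess.measureReal_inter (hp : IsRateFamily p J) (hB : IsBirthProcess p X P)
    (hlt : ∀ t ω, X t ω < J) {s t : ℝ≥0} (hst : s ≤ t) (k m : ℕ) :
    P.real ({ω | X s ω = k} ∩ {ω | X t ω = m}) =
      P.real {ω | X s ω = k} * trans p k m s t := by
  have h := hB.measureReal_cyl_inter_of_mem hp hlt (I := {s}) (fun _ => k) (s := s) (t := t)
    (by simp) (by simp) hst m
  have : cyl X {s} (fun _ => k) = {ω | X s ω = k} := by ext; simp [cyl]
  rwa [this] at h

end Birth

/-! ### Construction of the chain from its transition function -/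

/-- Kolmogorov's extension theorem for finite state spaces. -/
theorem exists_isProjectiveLimit_of_finite {ι : Type*} {α : ι → Type*}
    [∀ i, MeasurableSpace (α i)] [∀ i, Finite (α i)]
    {P : ∀ I : Finset ι, Measure (∀ i : I, α i)} [∀ I, IsFiniteMeasure (P I)]
    (hP : IsProjectiveMeasureFamily P) : ∃ μ : Measure (∀ i, α i), IsProjectiveLimit μ P := by
  have hzero : ∀ ⦃A : ℕ → Set (∀ i, α i)⦄, (∀ n, A n ∈ measurableCylinders α) → Antitone A →
      ⋂ n, A n = ∅ → Tendsto (fun n => projectiveFamilyContent hP (A n)) atTop (𝓝 0) := by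
    intro A hA hanti hinter
    -- With discrete topologies the product is compact and cylinders are closed, so decreasing
    -- cylinders with empty intersection are eventually empty. The content is therefore continuous
    -- at the empty set.
    let _ : ∀ i, TopologicalSpace (α i) := fun _ => ⊥
    have : ∀ i, DiscreteTopology (α i) := fun _ => ⟨rfl⟩
    have hclosed : ∀ n, IsClosed (A n) := by
      intro n
      obtain ⟨I, S, -, hS⟩ := (mem_measurableCylinders _).1 (hA n)
      rw [hS]
      exact IsClosed.cylinder I (isClosed_discrete S)
    obtain ⟨N, hN⟩ : ∃ N, A N = ∅ := by
      by_contra! hne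
      have := IsCompact.nonempty_iInter_of_sequence_nonempty_isCompact_isClosed A
        (fun n => hanti (Nat.le_succ n)) hne (hclosed 0).isCompact hclosed
      rw [hinter] at this
      exact Set.not_nonempty_empty this
    refine tendsto_const_nhds.congr' ?_
    filter_upwards [eventually_ge_atTop N] with n hn
    have : A n = ∅ := Set.subset_empty_iff.1 (hN ▸ hanti hn)
    rw [this, addContent_empty]
  have hsub : (projectiveFamilyContent hP).IsSigmaSubadditive :=
    isSigmaSubadditive_of_addContent_iUnion_eq_tsum isSetRing_measurableCylinders
      fun f hf hU hd => addContent_iUnion_eq_sum_of_tendsto_zero isSetRing_measurableCylinders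
        (projectiveFamilyContent hP) (fun s _ => projectiveFamilyContent_ne_top _) hzero hf hU hd
  refine ⟨(projectiveFamilyContent hP).measure isSetSemiring_measurableCylinders
    generateFrom_measurableCylinders.ge hsub, fun I => ?_⟩
  ext S hS
  rw [Measure.map_apply (Finset.measurable_restrict I) hS, AddContent.measure_eq, ← cylinder,
    projectiveFamilyContent_cylinder hP hS]
  · exact generateFrom_measurableCylinders.symm
  · exact cylinder_mem_measurableCylinders _ _ hS

/-- The probability that the chain with transition function `trans p`, started from `x` at time `s`,
follows the path `w` at the times of the list. -/
def pathWeight (p : ℝ → ℕ → ℝ) : ℝ≥0 → ℕ → List ℝ≥0 → (ℝ≥0 → ℕ) → ℝ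
  | _, _, [], _ => 1
  | s, x, t :: l, w => trans p x (w t) s t * pathWeight p t (w t) l w

section PathWeight

variable {p : ℝ → ℕ → ℝ} {J : ℕ}

theorem pathWeight_congr {l : List ℝ≥0} {w w' : ℝ≥0 → ℕ} (h : ∀ t ∈ l, w t = w' t) (s : ℝ≥0)
    (x : ℕ) : pathWeight p s x l w = pathWeight p s x l w' := by
  induction l generalizing s x with
  | nil => rfl
  | cons t l ih =>
    rw [pathWeight, pathWeight, h t (by simp), ih fun u hu => h u (by simp [hu])]

theorem IsRateFamily.pathWeight_nonneg (hp : IsRateFamily p J) {l : List ℝ≥0} {s : ℝ≥0}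
    (hl : (s :: l).Pairwise (· ≤ ·)) (x : ℕ) (w : ℝ≥0 → ℕ) : 0 ≤ pathWeight p s x l w := by
  induction l generalizing s x with
  | nil => exact zero_le_one
  | cons t l ih =>
    rw [List.pairwise_cons] at hl
    exact mul_nonneg (hp.trans_nonneg _ _ (NNReal.coe_le_coe.2 (hl.1 t (by simp)))) (ih hl.2 _)

theorem pathWeight_concat (l : List ℝ≥0) (u t s : ℝ≥0) (x : ℕ) (w : ℝ≥0 → ℕ) :
    pathWeight p s x (l ++ [u] ++ [t]) w =
      pathWeight p s x (l ++ [u]) w * trans p (w u) (w t) u t := by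
  induction l generalizing s x with
  | nil => simp [pathWeight]
  | cons a l ih =>
    simp only [List.cons_append, pathWeight]
    rw [ih, mul_assoc]

/-- Summing out one time: at the end of the list the transition probabilities add up to 1, elsewhere
Chapman–Kolmogorov merges two steps into one. -/
theorem IsRateFamily.sum_pathWeight (hp : IsRateFamily p J) (l₁ l₂ : List ℝ≥0) {t s : ℝ≥0}
    (hl : (s :: (l₁ ++ t :: l₂)).Pairwise (· ≤ ·)) (h₁ : t ∉ l₁) (h₂ : t ∉ l₂) {x : ℕ} (hx : x < J)
    {w : ℝ≥0 → ℕ} (hw : ∀ u, w u < J) :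
    ∑ y ∈ Finset.range J, pathWeight p s x (l₁ ++ t :: l₂) (Function.update w t y) =
      pathWeight p s x (l₁ ++ l₂) w := by
  induction l₁ generalizing s x with
  | nil =>
    simp only [List.nil_append, pathWeight, Function.update_self]
    cases l₂ with
    | nil => simpa [pathWeight] using hp.sum_trans hx s t
    | cons t' l =>
      have hne : t' ≠ t := fun h => h₂ (by simp [h])
      have hw' : ∀ y, pathWeight p t' (w t') l (Function.update w t y) = pathWeight p t' (w t') l w :=
        fun y => pathWeight_congr (fun u hu => Function.update_of_ne
          (fun h => h₂ (by simp [← h, hu])) _ _) _ _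
      simp only [pathWeight, Function.update_of_ne hne, hw', ← mul_assoc]
      rw [← Finset.sum_mul, hp.chapman_kolmogorov hx]
      simp only [List.nil_append, List.pairwise_cons] at hl
      exact NNReal.coe_le_coe.2 (hl.2.1 t' (by simp))
  | cons a l ih =>
    have hne : a ≠ t := fun h => h₁ (by simp [h])
    simp only [List.cons_append, pathWeight, Function.update_of_ne hne]
    rw [← Finset.mul_sum, ih (List.pairwise_cons.1 hl).2 (fun h => h₁ (by simp [h])) (hw a)]

end PathWeight

theorem sort_eq_of_toFinset_eq {I : Finset ℝ≥0} {l : List ℝ≥0} (hnd : l.Nodup)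
    (hl : l.Pairwise (· ≤ ·)) (h : l.toFinset = I) : I.sort = l := by
  rw [← h]
  exact (List.toFinset_sort _ hnd).2 hl

theorem sort_insert_max {I : Finset ℝ≥0} {t : ℝ≥0} (h : ∀ u ∈ I, u < t) :
    (insert t I).sort = I.sort ++ [t] := by
  have ht : t ∉ I := fun ht => (h t ht).false
  refine sort_eq_of_toFinset_eq ?_ ?_ ?_
  · rw [List.nodup_append]
    refine ⟨I.sort_nodup _, by simp, fun a ha b hb => ?_⟩
    simp only [List.mem_singleton] at hb
    subst hb
    exact fun hab => ht (hab ▸ (Finset.mem_sort _).1 ha)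
  · rw [List.pairwise_append]
    refine ⟨I.pairwise_sort _, by simp, fun a ha b hb => ?_⟩
    simp only [List.mem_singleton] at hb
    subst hb
    exact (h a ((Finset.mem_sort _).1 ha)).le
  · ext u
    simp

section ChainLaw

variable {p : ℝ → ℕ → ℝ} {J : ℕ}

/-- The extension by zero of a path on a finite set of times. -/
def extendPath {I : Finset ℝ≥0} (z : I → Fin J) (t : ℝ≥0) : ℕ :=
  if h : t ∈ I then z ⟨t, h⟩ else 0

theorem extendPath_lt (hJ : 0 < J) {I : Finset ℝ≥0} (z : I → Fin J) (t : ℝ≥0) :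
    extendPath z t < J := by
  unfold extendPath
  split_ifs
  · exact (z _).2
  · exact hJ

/-- The law at the times of `I` of the chain with transition function `trans p` started from `0`. -/
def chainLaw (p : ℝ → ℕ → ℝ) (J : ℕ) (I : Finset ℝ≥0) : Measure (I → Fin J) :=
  ∑ z : I → Fin J, ENNReal.ofReal (pathWeight p 0 0 I.sort (extendPath z)) • Measure.dirac z

instance isFiniteMeasure_chainLaw (I : Finset ℝ≥0) : IsFiniteMeasure (chainLaw p J I) := by
  refine ⟨?_⟩
  simp only [chainLaw, Measure.coe_finsetSum, Finset.sum_apply, Measure.smul_apply, smul_eq_mul,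
    measure_univ, mul_one]
  exact ENNReal.sum_lt_top.2 fun _ _ => ENNReal.ofReal_lt_top

theorem chainLaw_apply (I : Finset ℝ≥0) (S : Set (I → Fin J)) [DecidablePred (· ∈ S)] :
    chainLaw p J I S = ∑ z : I → Fin J,
      if z ∈ S then ENNReal.ofReal (pathWeight p 0 0 I.sort (extendPath z)) else 0 := by
  simp only [chainLaw, Measure.coe_finsetSum, Finset.sum_apply, Measure.smul_apply, smul_eq_mul]
  refine Finset.sum_congr rfl fun z _ => ?_
  rw [Measure.dirac_apply' z (Set.toFinite S).measurableSet]
  by_cases h : z ∈ S <;> simp [h]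

theorem chainLaw_singleton (I : Finset ℝ≥0) (z : I → Fin J) :
    chainLaw p J I {z} = ENNReal.ofReal (pathWeight p 0 0 I.sort (extendPath z)) := by
  classical
  rw [chainLaw_apply]
  simp

theorem pairwise_zero_cons_sort (I : Finset ℝ≥0) : ((0 : ℝ≥0) :: I.sort).Pairwise (· ≤ ·) :=
  List.pairwise_cons.2 ⟨fun _ _ => zero_le, I.pairwise_sort _⟩

theorem IsRateFamily.chainLaw_erase (hp : IsRateFamily p J) (hJ : 0 < J) {I : Finset ℝ≥0} {t : ℝ≥0}
    (ht : t ∈ I) :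
    chainLaw p J (I.erase t) = (chainLaw p J I).map
      (Finset.restrict₂ (π := fun _ => Fin J) (Finset.erase_subset t I)) := by
  classical
  refine Measure.ext_of_singleton fun z => ?_
  rw [Measure.map_apply (Finset.measurable_restrict₂ (X := fun _ => Fin J) _) (measurableSet_singleton z),
    chainLaw_singleton, chainLaw_apply, ← Finset.sum_filter]
  obtain ⟨l₁, l₂, hl⟩ := List.append_of_mem ((Finset.mem_sort (· ≤ ·)).2 ht)
  have hnd : (l₁ ++ t :: l₂).Nodup := hl ▸ I.sort_nodup _
  have hpw : ((0 : ℝ≥0) :: (l₁ ++ t :: l₂)).Pairwise (· ≤ ·) := hl ▸ pairwise_zero_cons_sort I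
  have h₁ : t ∉ l₁ := fun h => (List.nodup_append.1 hnd).2.2 t h t (by simp) rfl
  have h₂ : t ∉ l₂ := (List.nodup_cons.1 (List.nodup_append.1 hnd).2.1).1
  have hsub : (l₁ ++ l₂).Sublist (l₁ ++ t :: l₂) :=
    List.Sublist.append_left (List.sublist_cons_self t l₂) l₁
  have herase : (I.erase t).sort = l₁ ++ l₂ := by
    refine sort_eq_of_toFinset_eq (hnd.sublist hsub) ((List.pairwise_cons.1 hpw).2.sublist hsub) ?_
    ext u
    rw [Finset.mem_erase, ← Finset.mem_sort (s := I) (· ≤ ·), hl]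
    simp only [List.mem_toFinset, List.mem_append, List.mem_cons]
    constructor
    · intro h
      refine ⟨?_, by tauto⟩
      rintro rfl
      tauto
    · tauto
  rw [herase, ← hp.sum_pathWeight l₁ l₂ hpw h₁ h₂ hJ (extendPath_lt hJ z), Finset.sum_range,
    ENNReal.ofReal_sum_of_nonneg fun y _ => hp.pathWeight_nonneg hpw _ _, ← hl]
  -- A state at `t` corresponds to an extension of `z` from `I.erase t` to `I`.
  refine Finset.sum_bij'
    (fun (y : Fin J) _ => fun u : I => if h : (u : ℝ≥0) = t then y
      else z ⟨u, Finset.mem_erase.2 ⟨h, u.2⟩⟩)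
    (fun z' _ => z' ⟨t, ht⟩) ?_ ?_ ?_ ?_ ?_
  · intro y _
    simp only [Finset.mem_filter, Finset.mem_univ, true_and, Set.mem_preimage,
      Set.mem_singleton_iff]
    ext u
    have : (u : ℝ≥0) ≠ t := (Finset.mem_erase.1 u.2).1
    simp [Finset.restrict₂, this]
  · intro z' _
    exact Finset.mem_univ _
  · intro y _
    simp
  · intro z' hz'
    simp only [Finset.mem_filter, Finset.mem_univ, true_and, Set.mem_preimage,
      Set.mem_singleton_iff] at hz'
    ext u
    by_cases h : (u : ℝ≥0) = t
    · obtain ⟨u, hu⟩ := u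
      dsimp only at h
      subst h
      simp
    · simp [h, ← hz', Finset.restrict₂]
  · intro y _
    congr 1
    refine pathWeight_congr (fun u hu => ?_) _ _
    have huI : u ∈ I := (Finset.mem_sort _).1 hu
    by_cases h : u = t
    · subst h
      simp [extendPath, ht]
    · simp [extendPath, h, huI]

/-- Consistency for one erased time suffices; the times of `I \ H` are removed one by one. -/
theorem IsRateFamily.isProjectiveMeasureFamily_chainLaw (hp : IsRateFamily p J) (hJ : 0 < J) :
    IsProjectiveMeasureFamily (α := fun _ => Fin J) (chainLaw p J) := by
  intro I H hHI
  induction hn : (I \ H).card generalizing I with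
  | zero =>
    have : I = H := (Finset.sdiff_eq_empty_iff_subset.1 (Finset.card_eq_zero.1 hn)).antisymm hHI
    subst this
    exact Measure.map_id.symm
  | succ n ih =>
    obtain ⟨t, ht⟩ : (I \ H).Nonempty := Finset.card_pos.1 (by omega)
    have htI := (Finset.mem_sdiff.1 ht).1
    have htH := (Finset.mem_sdiff.1 ht).2
    have hsub : H ⊆ I.erase t := fun u hu =>
      Finset.mem_erase.2 ⟨fun h => htH (h ▸ hu), hHI hu⟩
    have hcard : (I.erase t \ H).card = n := by
      rw [Finset.erase_sdiff_comm, Finset.card_erase_of_mem ht]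
      omega
    rw [ih (I.erase t) hsub hcard, hp.chainLaw_erase hJ htI,
      Measure.map_map (Finset.measurable_restrict₂ (X := fun _ => Fin J) _) (Finset.measurable_restrict₂ (X := fun _ => Fin J) _)]
    rfl

/-- There is a process with the finite-dimensional distributions prescribed by `trans p`. -/
theorem IsRateFamily.exists_chain (hp : IsRateFamily p J) (hJ : 0 < J) :
    ∃ μ : Measure (ℝ≥0 → Fin J), IsProbabilityMeasure μ ∧
      ∀ (I : Finset ℝ≥0) (x : ℝ≥0 → ℕ), (∀ t, x t < J) →
        μ.real (cyl (fun t ω => (ω t : ℕ)) I x) = pathWeight p 0 0 I.sort x := by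
  obtain ⟨μ, hμ⟩ := exists_isProjectiveLimit_of_finite (hp.isProjectiveMeasureFamily_chainLaw hJ)
  have hcyl : ∀ (I : Finset ℝ≥0) (x : ℝ≥0 → ℕ), (∀ t, x t < J) →
        μ (cyl (fun t ω => (ω t : ℕ)) I x) = ENNReal.ofReal (pathWeight p 0 0 I.sort x) := by
    intro I x hx
    have h1 : cyl (fun t (ω : ℝ≥0 → Fin J) => (ω t : ℕ)) I x =
        cylinder (α := fun _ => Fin J) I {fun i : I => (⟨x i, hx i⟩ : Fin J)} := by
      ext ω
      simp only [cyl, Set.mem_ofPred_eq, mem_cylinder, Set.mem_singleton_iff, funext_iff,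
        Finset.restrict, Subtype.forall, Fin.ext_iff]
    rw [h1, hμ.measure_cylinder _ (measurableSet_singleton _), chainLaw_singleton]
    congr 1
    refine pathWeight_congr (fun u hu => ?_) _ _
    simp [extendPath, (Finset.mem_sort _).1 hu]
  refine ⟨μ, ⟨?_⟩, fun I x hx => ?_⟩
  · have := hcyl ∅ (fun _ => 0) fun _ => hJ
    simpa [cyl_empty, pathWeight] using this
  · rw [measureReal_def, hcyl I x hx,
      ENNReal.toReal_ofReal (hp.pathWeight_nonneg (pairwise_zero_cons_sort I) _ _)]

end ChainLaw

/-! ### Monotone paths, small increments and the right-continuous modification -/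

section Paths

theorem isCadlag_of_monotone {x : ℝ≥0 → ℕ} {J : ℕ} (hmono : Monotone x) (hlt : ∀ t, x t < J)
    (hr : ∀ t, ∃ u > t, x u = x t) : IsCadlag x := by
  refine ⟨fun t => ?_, fun t ht => ?_⟩
  · obtain ⟨u, htu, hu⟩ := hr t
    filter_upwards [Ioo_mem_nhdsGT htu] with s hs
    exact le_antisymm ((hmono hs.2.le).trans hu.le) (hmono hs.1.le)
  · have hne : (x '' Set.Iio t).Nonempty := ⟨x 0, 0, ht, rfl⟩
    have hbdd : BddAbove (x '' Set.Iio t) := ⟨J, by rintro _ ⟨s, _, rfl⟩; exact (hlt s).le⟩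
    obtain ⟨s, hs, hsx⟩ := Nat.sSup_mem hne hbdd
    refine ⟨x s, ?_⟩
    filter_upwards [Ioo_mem_nhdsLT hs] with u hu
    exact le_antisymm (hsx ▸ le_csSup hbdd ⟨u, hu.2, rfl⟩) (hmono hu.1.le)

theorem hasLeftLimit_of_eq {x : ℝ≥0 → ℕ} (hmono : Monotone x) {s t : ℝ≥0} (hst : s < t)
    (h : x s = x t) : HasLeftLimit x t (x t) := by
  filter_upwards [Ioo_mem_nhdsLT hst] with u hu
  exact le_antisymm (hmono hu.2.le) (h ▸ hmono hu.1.le)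

end Paths

theorem exists_left_close {t : ℝ≥0} (ht : 0 < t) {C ε : ℝ} (hC : 0 ≤ C) (hε : 0 < ε) :
    ∃ s < t, C * ((t : ℝ) - s) ≤ ε := by
  have ht' : 0 < (t : ℝ) := ht
  -- The divisor `C + 1` allows `C = 0`; the minimum with `t` keeps the earlier time non-negative.
  have hδ : 0 < min (t : ℝ) (ε / (C + 1)) := by positivity
  have hs0 : 0 ≤ (t : ℝ) - min (t : ℝ) (ε / (C + 1)) := sub_nonneg.2 (min_le_left _ _)
  refine ⟨((t : ℝ) - min (t : ℝ) (ε / (C + 1))).toNNReal, ?_, ?_⟩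
  · rw [← NNReal.coe_lt_coe, Real.coe_toNNReal _ hs0]
    linarith
  · rw [Real.coe_toNNReal _ hs0, sub_sub_cancel]
    have hd := min_le_right (t : ℝ) (ε / (C + 1))
    rw [le_div_iff₀ (by positivity)] at hd
    nlinarith

theorem exists_right_close (t : ℝ≥0) {C ε : ℝ} (hC : 0 ≤ C) (hε : 0 < ε) :
    ∃ u > t, u ≤ t + 1 ∧ ∀ s, t ≤ s → s ≤ u → C * ((s : ℝ) - t) ≤ ε := by
  have hδ : 0 < min 1 (ε / (C + 1)) := by positivity
  refine ⟨t + (min 1 (ε / (C + 1))).toNNReal, lt_add_of_pos_right t (by simpa using hδ), ?_,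
    fun s hts hsu => ?_⟩
  · rw [← NNReal.coe_le_coe, NNReal.coe_add, NNReal.coe_add, Real.coe_toNNReal _ hδ.le]
    simp
  · have hsu' : (s : ℝ) ≤ t + min 1 (ε / (C + 1)) := by
      have := NNReal.coe_le_coe.2 hsu
      rwa [NNReal.coe_add, Real.coe_toNNReal _ hδ.le] at this
    have hd : (s : ℝ) - t ≤ ε / (C + 1) := by linarith [min_le_right 1 (ε / (C + 1))]
    have hd0 : 0 ≤ (s : ℝ) - t := sub_nonneg.2 (NNReal.coe_le_coe.2 hts)
    rw [le_div_iff₀ (by positivity)] at hd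
    nlinarith

section TwoTimes

variable {Ω : Type*} [MeasurableSpace Ω] {P : Measure Ω} [IsProbabilityMeasure P]
  {X : ℝ≥0 → Ω → ℕ} {p : ℝ → ℕ → ℝ} {J : ℕ}

/-- On a monotone path, a jump at `t` forces `X s ≠ X t` for every `s < t`, an event of arbitrarily
small probability. -/
theorem ae_hasLeftLimit (hmono : ∀ᵐ ω ∂P, Monotone fun t => X t ω) {t : ℝ≥0}
    (hsmall : ∀ ε > 0, ∃ s < t, P.real {ω | X s ω ≠ X t ω} ≤ ε) :
    ∀ᵐ ω ∂P, HasLeftLimit (fun s => X s ω) t (X t ω) := by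
  have h0 : P {ω | Monotone (fun t => X t ω) ∧ ¬ HasLeftLimit (fun s => X s ω) t (X t ω)} = 0 := by
    rw [← measureReal_eq_zero_iff]
    refine le_antisymm (le_of_forall_pos_le_add fun ε hε => ?_) measureReal_nonneg
    obtain ⟨s, hst, hs⟩ := hsmall ε hε
    rw [zero_add]
    exact (measureReal_mono fun ω hω h => hω.2 (hasLeftLimit_of_eq hω.1 hst h)).trans hs
  filter_upwards [hmono, measure_eq_zero_iff_ae_notMem.1 h0] with ω h1 h2
  by_contra h3
  exact h2 ⟨h1, h3⟩

/-- A union bound over pairs of states; it is applied to decreasing, moving, and moving by at least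
two. -/
theorem measureReal_rel_le (hlt : ∀ t ω, X t ω < J) {s t : ℝ≥0}
    (h2 : ∀ k m, P.real ({ω | X s ω = k} ∩ {ω | X t ω = m}) =
      P.real {ω | X s ω = k} * trans p k m s t) {R : ℕ → ℕ → Prop} {c : ℝ} (hc : 0 ≤ c)
    (hR : ∀ k < J, ∀ m < J, R k m → trans p k m s t ≤ c) :
    P.real {ω | R (X s ω) (X t ω)} ≤ J * J * c := by
  classical
  calc P.real {ω | R (X s ω) (X t ω)}
      ≤ P.real (⋃ a ∈ ((Finset.range J ×ˢ Finset.range J).filter fun a => R a.1 a.2),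
        ({ω | X s ω = a.1} ∩ {ω | X t ω = a.2})) := by
        refine measureReal_mono (fun ω hω => ?_) (measure_ne_top _ _)
        simp only [Set.mem_iUnion]
        exact ⟨(X s ω, X t ω), by simpa [hlt] using hω, rfl, rfl⟩
    _ ≤ ∑ a ∈ ((Finset.range J ×ˢ Finset.range J).filter fun a => R a.1 a.2),
        P.real ({ω | X s ω = a.1} ∩ {ω | X t ω = a.2}) := measureReal_biUnion_finset_le _ _
    _ ≤ ∑ a ∈ ((Finset.range J ×ˢ Finset.range J).filter fun a => R a.1 a.2), c := by
        refine Finset.sum_le_sum fun a ha => ?_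
        simp only [Finset.mem_filter, Finset.mem_product, Finset.mem_range] at ha
        rw [h2]
        have h1 := hR _ ha.1.1 _ ha.1.2 ha.2
        calc _ ≤ P.real {ω | X s ω = a.1} * c := by gcongr
          _ ≤ 1 * c := by gcongr; exact measureReal_le_one
          _ = c := one_mul c
    _ ≤ ∑ a ∈ Finset.range J ×ˢ Finset.range J, c :=
        Finset.sum_le_sum_of_subset_of_nonneg (Finset.filter_subset _ _) fun _ _ _ => hc
    _ = J * J * c := by simp

theorem ae_le_of_trans (hlt : ∀ t ω, X t ω < J) {s t : ℝ≥0}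
    (h2 : ∀ k m, P.real ({ω | X s ω = k} ∩ {ω | X t ω = m}) =
      P.real {ω | X s ω = k} * trans p k m s t) : ∀ᵐ ω ∂P, X s ω ≤ X t ω := by
  have h := measureReal_rel_le hlt h2 (R := fun k m => m < k) le_rfl
    fun k _ m _ hkm => (trans_eq_zero_of_lt hkm s t).le
  rw [mul_zero] at h
  have h0 : P {ω | X t ω < X s ω} = 0 :=
    (measureReal_eq_zero_iff).1 (le_antisymm h measureReal_nonneg)
  filter_upwards [measure_eq_zero_iff_ae_notMem.1 h0] with ω hω
  simpa using hω

theorem IsRateFamily.exists_increment_bound (hp : IsRateFamily p J) (hlt : ∀ t ω, X t ω < J)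
    (h2 : ∀ s t : ℝ≥0, s ≤ t → ∀ k m, P.real ({ω | X s ω = k} ∩ {ω | X t ω = m}) =
      P.real {ω | X s ω = k} * trans p k m s t) (T : ℝ≥0) :
    ∃ C : ℝ, 0 ≤ C ∧ ∀ s t : ℝ≥0, s ≤ t → t ≤ T →
      P.real {ω | X s ω ≠ X t ω} ≤ C * (t - s) ∧
      P.real {ω | X s ω + 2 ≤ X t ω} ≤ C * (t - s) ^ 2 := by
  obtain ⟨C, hC0, hC⟩ := hp.exists_bound T
  -- One constant serves both the linear and the quadratic estimate.
  refine ⟨J * J * C + J * J * C ^ 2, by positivity, fun s t hst htT => ?_⟩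
  have hst' : (s : ℝ) ≤ t := NNReal.coe_le_coe.2 hst
  have hd : 0 ≤ (t : ℝ) - s := sub_nonneg.2 hst'
  have hpow : ∀ k < J, ∀ i, trans p k (k + i) s t ≤ (C * (t - s)) ^ i := fun k hk i =>
    hp.trans_add_le_pow hk (T := T) (fun u hu k => hC u ⟨s.2.trans hu.1, hu.2⟩ k) i hst'
      (NNReal.coe_le_coe.2 htT)
  have hle : ∀ k < J, ∀ m j, k + j ≤ m → trans p k m s t ≤ (C * (t - s)) ^ j := by
    intro k hk m j hjm
    have hm := hpow k hk (m - k)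
    rw [show k + (m - k) = m by omega] at hm
    rcases le_total (C * ((t : ℝ) - s)) 1 with h1 | h1
    · exact hm.trans (pow_le_pow_of_le_one (by positivity) h1 (by omega))
    · exact (hp.trans_le_one hk m hst').trans (one_le_pow₀ h1)
  constructor
  · have h := measureReal_rel_le hlt (h2 s t hst) (R := fun k m => k ≠ m) (c := C * (t - s))
      (by positivity) fun k hk m _ hkm => by
        rcases lt_or_gt_of_ne hkm with h | h
        · simpa using hle k hk m 1 h
        · rw [trans_eq_zero_of_lt h]; positivity
    refine h.trans ?_
    have : 0 ≤ J * J * C ^ 2 * ((t : ℝ) - s) := by positivity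
    linarith
  · have h := measureReal_rel_le hlt (h2 s t hst) (R := fun k m => k + 2 ≤ m)
      (c := (C * (t - s)) ^ 2) (by positivity) fun k hk m _ hkm => hle k hk m 2 hkm
    refine h.trans ?_
    have : 0 ≤ J * J * C * ((t : ℝ) - s) ^ 2 := by positivity
    rw [mul_pow]
    linarith

end TwoTimes

section Modification

variable {Ω : Type*} {X : ℝ≥0 → Ω → ℕ} {J : ℕ}

/-- The right-continuous version of a non-decreasing process: the infimum over a countable dense set
of later times. -/
def rightMod (X : ℝ≥0 → Ω → ℕ) (t : ℝ≥0) (ω : Ω) : ℕ :=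
  ⨅ n : {n : ℕ // t < TopologicalSpace.denseSeq ℝ≥0 n}, X (TopologicalSpace.denseSeq ℝ≥0 n) ω

theorem exists_denseSeq_between {s t : ℝ≥0} (h : s < t) :
    ∃ n, s < TopologicalSpace.denseSeq ℝ≥0 n ∧ TopologicalSpace.denseSeq ℝ≥0 n < t := by
  obtain ⟨_, ⟨n, rfl⟩, h1, h2⟩ := (TopologicalSpace.denseRange_denseSeq ℝ≥0).exists_between h
  exact ⟨n, h1, h2⟩

theorem rightMod_le {t : ℝ≥0} {n : ℕ} (h : t < TopologicalSpace.denseSeq ℝ≥0 n) (ω : Ω) :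
    rightMod X t ω ≤ X (TopologicalSpace.denseSeq ℝ≥0 n) ω :=
  ciInf_le (OrderBot.bddBelow _) (⟨n, h⟩ : {n : ℕ // t < TopologicalSpace.denseSeq ℝ≥0 n})

instance nonempty_denseSeq_gt (t : ℝ≥0) :
    Nonempty {n : ℕ // t < TopologicalSpace.denseSeq ℝ≥0 n} := by
  obtain ⟨n, h, -⟩ := exists_denseSeq_between (lt_add_one t)
  exact ⟨⟨n, h⟩⟩

theorem le_rightMod {t : ℝ≥0} {ω : Ω} {a : ℕ} (h : ∀ n, t < TopologicalSpace.denseSeq ℝ≥0 n →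
    a ≤ X (TopologicalSpace.denseSeq ℝ≥0 n) ω) : a ≤ rightMod X t ω :=
  le_ciInf fun n => h n n.2

theorem exists_eq_rightMod (X : ℝ≥0 → Ω → ℕ) (t : ℝ≥0) (ω : Ω) :
    ∃ n, t < TopologicalSpace.denseSeq ℝ≥0 n ∧
      X (TopologicalSpace.denseSeq ℝ≥0 n) ω = rightMod X t ω := by
  obtain ⟨n, hn⟩ := Nat.sInf_mem (Set.range_nonempty fun n : {n : ℕ //
    t < TopologicalSpace.denseSeq ℝ≥0 n} => X (TopologicalSpace.denseSeq ℝ≥0 n) ω)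
  exact ⟨n, n.2, hn⟩

theorem monotone_rightMod (X : ℝ≥0 → Ω → ℕ) (ω : Ω) : Monotone fun t => rightMod X t ω :=
  fun _ _ hst => le_rightMod fun _ hn => rightMod_le (hst.trans_lt hn) ω

theorem rightMod_lt (hlt : ∀ t ω, X t ω < J) (t : ℝ≥0) (ω : Ω) : rightMod X t ω < J := by
  obtain ⟨n, hn⟩ := nonempty_denseSeq_gt t
  exact (rightMod_le hn ω).trans_lt (hlt _ _)

/-- An infimum of naturals is attained, at some dense time after `t`, so the modification is
constant from `t` up to that time. -/
theorem isCadlag_rightMod (hlt : ∀ t ω, X t ω < J) (ω : Ω) : IsCadlag fun t => rightMod X t ω := by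
  refine isCadlag_of_monotone (monotone_rightMod X ω) (fun t => rightMod_lt hlt t ω) fun t => ?_
  obtain ⟨n, hn, hX⟩ := exists_eq_rightMod X t ω
  obtain ⟨u, h1, h2⟩ := exists_between hn
  exact ⟨u, h1, le_antisymm ((rightMod_le h2 ω).trans hX.le) (monotone_rightMod X ω h1.le)⟩

variable [MeasurableSpace Ω] {P : Measure Ω} [IsProbabilityMeasure P]

theorem measurable_rightMod (hX : ∀ t, Measurable (X t)) (t : ℝ≥0) : Measurable (rightMod X t) :=
  Measurable.iInf fun _ => hX _

/-- Monotonicity along the countable dense set gives one inequality. Strict inequality would force a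
move between `t` and arbitrarily close later times, which has probability zero in the limit. -/
theorem rightMod_ae_eq (hmono : ∀ s t : ℝ≥0, s ≤ t → ∀ᵐ ω ∂P, X s ω ≤ X t ω)
    {t : ℝ≥0} (hsmall : ∀ ε > 0, ∃ u > t, ∀ s, t ≤ s → s ≤ u → P.real {ω | X t ω ≠ X s ω} ≤ ε) :
    ∀ᵐ ω ∂P, rightMod X t ω = X t ω := by
  have hle : ∀ᵐ ω ∂P, X t ω ≤ rightMod X t ω := by
    have : ∀ᵐ ω ∂P, ∀ n : ℕ, t < TopologicalSpace.denseSeq ℝ≥0 n →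
        X t ω ≤ X (TopologicalSpace.denseSeq ℝ≥0 n) ω := by
      rw [ae_all_iff]
      intro n
      by_cases h : t < TopologicalSpace.denseSeq ℝ≥0 n
      · filter_upwards [hmono _ _ h.le] with ω hω _ using hω
      · exact ae_of_all _ fun ω h' => absurd h' h
    filter_upwards [this] with ω hω using le_rightMod hω
  have h0 : P {ω | X t ω < rightMod X t ω} = 0 := by
    rw [← measureReal_eq_zero_iff]
    refine le_antisymm (le_of_forall_pos_le_add fun ε hε => ?_) measureReal_nonneg
    obtain ⟨u, htu, hu⟩ := hsmall ε hε
    obtain ⟨n, h1, h2⟩ := exists_denseSeq_between htu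
    rw [zero_add]
    refine (measureReal_mono fun ω hω => ?_).trans (hu _ h1.le h2.le)
    exact ((hω : X t ω < rightMod X t ω).trans_le (rightMod_le h1 ω)).ne
  filter_upwards [hle, measure_eq_zero_iff_ae_notMem.1 h0] with ω h1 h2
  exact le_antisymm (not_lt.1 h2) h1

end Modification

/-- This is the forward equation at the starting time, where the mass vector is the indicator of
`k`. -/
theorem IsRateFamily.isLittleO_trans {p : ℝ → ℕ → ℝ} {J : ℕ} (hp : IsRateFamily p J) (t : ℝ≥0)
    (k m : ℕ) :
    (fun h : ℝ≥0 => trans p k m t (t + h : ℝ≥0)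
        - (if m = k then 1 - (h : ℝ) * p t k else if m = k + 1 then (h : ℝ) * p t k else 0))
      =o[𝓝[>] 0] fun h : ℝ≥0 => (h : ℝ) := by
  have hd := hasDerivAt_iff_isLittleO.1 (hp.hasDerivAt_trans k m t t)
  have htend : Tendsto (fun h : ℝ≥0 => ((t + h : ℝ≥0) : ℝ)) (𝓝[>] 0) (𝓝 (t : ℝ)) := by
    have : Tendsto (fun h : ℝ≥0 => ((t + h : ℝ≥0) : ℝ)) (𝓝 0) (𝓝 ((t + 0 : ℝ≥0) : ℝ)) :=
      (NNReal.continuous_coe.comp (continuous_const.add continuous_id)).tendsto 0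
    rw [add_zero] at this
    exact this.mono_left nhdsWithin_le_nhds
  refine (hd.comp_tendsto htend).congr (fun h => ?_) fun h => ?_
  · simp only [Function.comp, trans_self, smul_eq_mul]
    have hs := sum_mul_rates (p := p) (fun i => if k = i then (1 : ℝ) else 0) t h
      (show m < k + m + 1 by omega)
    simp only [ite_mul, one_mul, zero_mul] at hs
    rw [Finset.sum_ite_eq, if_pos (Finset.mem_range.2 (by omega))] at hs
    rw [hs]
    push_cast
    ring
  · simp [Function.comp]

/-- Birth processes with given rates exist. -/
theorem IsRateFamily.exists_isBirth {p : ℝ → ℕ → ℝ} {J : ℕ} (hp : IsRateFamily p J)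
    (hJ : 0 < J) :
    ∃ (μ : Measure (ℝ≥0 → Fin J)) (B : ℝ≥0 → (ℝ≥0 → Fin J) → ℕ), IsProbabilityMeasure μ ∧
      (∀ t ω, B t ω < J) ∧ IsBirthProcess p B μ := by
  obtain ⟨μ, hμ, hcyl⟩ := hp.exists_chain hJ
  set X : ℝ≥0 → (ℝ≥0 → Fin J) → ℕ := fun t ω => (ω t : ℕ) with hXdef
  have hlt : ∀ t ω, X t ω < J := fun t ω => (ω t).2
  have hmeas : ∀ t, Measurable (X t) := fun t =>
    (measurable_of_countable (fun i : Fin J => (i : ℕ))).comp (measurable_pi_apply t)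
  have hempty : ∀ t m, J ≤ m → {ω | X t ω = m} = ∅ := by
    intro t m hm
    ext ω
    have := hlt t ω
    simp only [Set.mem_ofPred_eq, Set.mem_empty_iff_false, iff_false]
    omega
  -- Appending a last time multiplies the path weight by one transition probability; this contains
  -- both the Markov property and the two-time laws.
  have hstep : ∀ (I : Finset ℝ≥0) (x : ℝ≥0 → ℕ) (s t : ℝ≥0) (y : ℕ), s ∈ I → (∀ u ∈ I, u ≤ s) →
      s < t → μ.real (cyl X I x ∩ {ω | X t ω = y}) = μ.real (cyl X I x) * trans p (x s) y s t := by
    intro I x s t y hs hmax hst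
    by_cases hx : ∀ u ∈ I, x u < J
    · rcases Nat.lt_or_ge y J with hy | hy
      -- Off the relevant times `x` is replaced by 0, since `hcyl` requires every value to be a
      -- state.
      · set x' : ℝ≥0 → ℕ := fun u => if u ∈ I then x u else if u = t then y else 0 with hx'
        have htI : t ∉ I := fun h => (hmax t h).not_gt hst
        have hx'J : ∀ u, x' u < J := by
          intro u
          simp only [hx']
          split_ifs with h1 h2
          · exact hx u h1
          · exact hy
          · exact hJ
        have hIx : ∀ u ∈ I, x u = x' u := fun u hu => by simp [hx', hu]
        have hx't : x' t = y := by simp [hx', htI]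
        have hIs : I = insert s (I.erase s) := (Finset.insert_erase hs).symm
        have hsort : I.sort = (I.erase s).sort ++ [s] := by
          conv_lhs => rw [hIs]
          exact sort_insert_max fun u hu => lt_of_le_of_ne
            (hmax u (Finset.mem_of_mem_erase hu)) (Finset.ne_of_mem_erase hu)
        have h1 := hcyl (insert t I) x' hx'J
        rw [cyl_insert, sort_insert_max fun u hu => (hmax u hu).trans_lt hst, hsort,
          pathWeight_concat, ← hsort, ← hcyl I x' hx'J, hx't, ← hIx s hs] at h1
        rw [cyl_congr X hIx]
        exact h1
      · rw [hempty t y hy, hp.trans_eq_zero_of_le (hx s hs) hy]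
        simp
    · push Not at hx
      obtain ⟨u, hu, hux⟩ := hx
      have hsub : cyl X I x ⊆ {ω | X u ω = x u} := fun ω hω => hω u hu
      have : cyl X I x = ∅ := Set.subset_empty_iff.1 (hempty u _ hux ▸ hsub)
      simp [this]
  have h2 : ∀ s t : ℝ≥0, s ≤ t → ∀ k m, μ.real ({ω | X s ω = k} ∩ {ω | X t ω = m}) =
      μ.real {ω | X s ω = k} * trans p k m s t := by
    intro s t hst k m
    rcases hst.eq_or_lt with rfl | hst
    · rw [trans_self]
      split_ifs with h
      · subst h; simp
      · have : {ω | X s ω = k} ∩ {ω | X s ω = m} = ∅ := by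
          ext ω
          simp only [Set.mem_inter_iff, Set.mem_ofPred_eq, Set.mem_empty_iff_false, iff_false,
            not_and]
          exact fun h1 h2 => h (h1.symm.trans h2)
        simp [this]
    · have h := hstep {s} (fun _ => k) s t m (by simp) (by simp) hst
      have hc : cyl X {s} (fun _ => k) = {ω | X s ω = k} := by ext; simp [cyl]
      rwa [hc] at h
  have hinit : μ {ω | ¬ X 0 ω = 0} = 0 := by
    have h := hcyl {0} (fun _ => 0) fun _ => hJ
    have hc : cyl X {0} (fun _ => 0) = {ω | X 0 ω = 0} := by ext; simp [cyl]
    rw [hc, Finset.sort_singleton] at h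
    simp only [pathWeight, NNReal.coe_zero, trans_self, if_true, mul_one] at h
    refine (prob_compl_eq_zero_iff (measurableSet_eq_state hmeas 0 0)).2 ?_
    rw [measureReal_def] at h
    exact (ENNReal.toReal_eq_one_iff _).1 h
  have hmonoX : ∀ s t : ℝ≥0, s ≤ t → ∀ᵐ ω ∂μ, X s ω ≤ X t ω := fun s t hst =>
    ae_le_of_trans hlt (h2 s t hst)
  have hBX : ∀ t, ∀ᵐ ω ∂μ, rightMod X t ω = X t ω := by
    intro t
    refine rightMod_ae_eq hmonoX fun ε hε => ?_
    obtain ⟨C, hC0, hC⟩ := hp.exists_increment_bound hlt h2 (t + 1)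
    obtain ⟨u, htu, hu1, hu⟩ := exists_right_close t hC0 hε
    exact ⟨u, htu, fun s hts hsu => (hC t s hts (hsu.trans hu1)).1.trans (hu s hts hsu)⟩
  have hcylB : ∀ I x, cyl (rightMod X) I x =ᵐ[μ] cyl X I x := by
    intro I x
    have : ∀ᵐ ω ∂μ, ∀ u ∈ (I : Set ℝ≥0), rightMod X u ω = X u ω :=
      (ae_ball_iff I.countable_toSet).2 fun u _ => hBX u
    filter_upwards [this] with ω hω
    exact propext (forall₂_congr fun u hu => by rw [hω u hu])
  have heqB : ∀ t m, {ω | rightMod X t ω = m} =ᵐ[μ] {ω | X t ω = m} := by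
    intro t m
    filter_upwards [hBX t] with ω hω
    exact propext (by change rightMod X t ω = m ↔ X t ω = m; rw [hω])
  have h2B : ∀ s t : ℝ≥0, s ≤ t → ∀ k m,
      μ.real ({ω | rightMod X s ω = k} ∩ {ω | rightMod X t ω = m}) =
        μ.real {ω | rightMod X s ω = k} * trans p k m s t := fun s t hst k m => by
    rw [measureReal_congr ((heqB s k).inter (heqB t m)), measureReal_congr (heqB s k), h2 s t hst]
  have hltB := rightMod_lt hlt
  have hmeasB := measurable_rightMod hmeas
  refine ⟨μ, rightMod X, hμ, hltB, hmeasB, isCadlag_rightMod hlt, fun t ht => ?_, ?_, ?_,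
    fun t k m h0 => ?_⟩
  · refine ae_hasLeftLimit (ae_of_all _ (monotone_rightMod X)) fun ε hε => ?_
    obtain ⟨C, hC0, hC⟩ := hp.exists_increment_bound hltB h2B t
    obtain ⟨s, hst, hs⟩ := exists_left_close ht hC0 hε
    exact ⟨s, hst, (hC s t hst.le le_rfl).1.trans hs⟩
  · filter_upwards [hBX 0, measure_eq_zero_iff_ae_notMem.1 hinit] with ω h1 h3
    rw [h1]
    exact not_not.1 h3
  · rw [isMarkov_iff hmeasB]
    intro I x s t y hs hmax hst
    rw [measureReal_congr ((hcylB I x).inter (heqB t y)), measureReal_congr (hcylB I x),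
      hstep I x s t y hs hmax hst, h2B s t hst.le, mul_assoc, mul_comm (trans p _ _ _ _)]
  · refine (hp.isLittleO_trans t k m).congr_left fun h => ?_
    rw [condReal_apply (measurableSet_eq_state hmeasB _ _), h2B t (t + h) le_self_add,
      inv_mul_cancel_left₀]
    rw [measureReal_def]
    exact (ENNReal.toReal_pos h0 (measure_ne_top _ _)).ne'

/-! ### Unit jumps and time grids -/

section UnitJumps

theorem le_leftLimit_add_one_of_grid {x : ℝ≥0 → ℕ} (hmono : Monotone x) {M N : ℕ} (hN : 0 < N)
    (hgrid : ∀ i < M * N, x (((i + 1 : ℕ) : ℝ≥0) / N) ≤ x ((i : ℝ≥0) / N) + 1) {t : ℝ≥0} (ht : 0 < t)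
    (htM : t ≤ M) {a : ℕ} (ha : HasLeftLimit x t a) : x t ≤ a + 1 := by
  have hN' : (0 : ℝ≥0) < N := Nat.cast_pos.2 hN
  -- The ceiling picks the cell with i/N < t ≤ (i+1)/N; the left limit at `t` is at least the value
  -- at i/N.
  have hpos : 0 < ⌈t * N⌉₊ := Nat.ceil_pos.2 (mul_pos ht hN')
  obtain ⟨i, hi⟩ : ∃ i, ⌈t * N⌉₊ = i + 1 := ⟨⌈t * N⌉₊ - 1, by omega⟩
  have h1 : (i : ℝ≥0) / N < t := by
    rw [div_lt_iff₀ hN']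
    exact Nat.lt_ceil.1 (by omega)
  have h2 : t ≤ ((i + 1 : ℕ) : ℝ≥0) / N := by
    rw [le_div_iff₀ hN', ← hi]
    exact Nat.le_ceil _
  have hiM : i < M * N := by
    have : ⌈t * N⌉₊ ≤ M * N := Nat.ceil_le.2 (by push_cast; gcongr)
    omega
  have : (𝓝[<] t).NeBot := nhdsLT_neBot_of_exists_lt ⟨0, ht⟩
  obtain ⟨s, hs, hsI⟩ := (ha.and (Ioo_mem_nhdsLT h1)).exists
  calc x t ≤ x (((i + 1 : ℕ) : ℝ≥0) / N) := hmono h2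
    _ ≤ x ((i : ℝ≥0) / N) + 1 := hgrid i hiM
    _ ≤ a + 1 := by rw [← hs]; gcongr; exact hmono hsI.1.le

/-- A cadlag non-decreasing path with unit jumps grows by at most one on short intervals. -/
theorem exists_increment_le_one {x : ℝ≥0 → ℕ} (hmono : Monotone x) (hc : IsCadlag x)
    (hunit : ∀ t, 0 < t → ∀ a, HasLeftLimit x t a → x t ≤ a + 1) (T : ℝ≥0) :
    ∃ ε > 0, ∀ s u : ℝ≥0, s ≤ u → u ≤ T → (u : ℝ) - s < ε → x u ≤ x s + 1 := by
  -- Near each time the path takes only two adjacent values; a Lebesgue number makes this uniform on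
  -- `[0, T]`.
  have hloc : ∀ t : ℝ≥0, ∃ a, ∀ᶠ s in 𝓝 t, a ≤ x s ∧ x s ≤ a + 1 := by
    intro t
    have hright : ∀ᶠ s in 𝓝[≥] t, x s = x t := by
      rw [← Set.Ioi_insert, nhdsWithin_insert]
      exact eventually_sup.2 ⟨rfl, hc.1 t⟩
    rcases eq_or_lt_of_le (zero_le : 0 ≤ t) with h | h
    · refine ⟨x t, ?_⟩
      have h0 : Set.Ici t = Set.univ := Set.eq_univ_of_forall fun s => Set.mem_Ici.2 (h ▸ zero_le)
      rw [h0, nhdsWithin_univ] at hright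
      filter_upwards [hright] with s hs
      omega
    · obtain ⟨a, ha⟩ := hc.2 t h
      have hta := hunit t h a ha
      have hat : a ≤ x t := by
        have : (𝓝[<] t).NeBot := nhdsLT_neBot_of_exists_lt ⟨0, h⟩
        obtain ⟨s, hs, hst⟩ := (ha.and self_mem_nhdsWithin).exists
        exact hs ▸ hmono (le_of_lt hst)
      refine ⟨a, ?_⟩
      rw [← nhdsLT_sup_nhdsGE]
      refine eventually_sup.2 ⟨?_, ?_⟩
      · filter_upwards [ha] with s hs
        omega
      · filter_upwards [hright] with s hs
        omega
  choose a ha using hloc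
  obtain ⟨ε, hε, h⟩ := lebesgue_number_lemma_of_metric (isCompact_Icc (a := 0) (b := T))
    (c := fun t => interior {s | a t ≤ x s ∧ x s ≤ a t + 1}) (fun _ => isOpen_interior)
    (fun t _ => Set.mem_iUnion.2 ⟨t, mem_interior_iff_mem_nhds.2 (ha t)⟩)
  refine ⟨ε, hε, fun s u hsu huT hus => ?_⟩
  obtain ⟨t, ht⟩ := h s ⟨zero_le, hsu.trans huT⟩
  have h1 := (interior_subset (ht (Metric.mem_ball_self hε))).1
  have hu : u ∈ Metric.ball s ε := by
    rw [Metric.mem_ball, NNReal.dist_eq, abs_of_nonneg (sub_nonneg.2 (NNReal.coe_le_coe.2 hsu))]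
    exact hus
  have h2 := (interior_subset (ht hu)).2
  omega

/-- At the first index where `f` exceeds `k`, unit steps force the value `k` just before and `k + 1`
there. -/
theorem exists_step {f : ℕ → ℕ} {N k : ℕ} (h0 : f 0 = k) (hN : k + 1 ≤ f N)
    (hstep : ∀ i < N, f (i + 1) ≤ f i + 1) : ∃ i < N, f i = k ∧ f (i + 1) = k + 1 := by
  classical
  have hex : ∃ i, k + 1 ≤ f i := ⟨N, hN⟩
  have hle : Nat.find hex ≤ N := Nat.find_min' hex hN
  have hspec := Nat.find_spec hex
  have hmin := fun m => Nat.find_min hex (m := m)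
  revert hle hspec hmin
  generalize Nat.find hex = i
  intro hle hspec hmin
  cases i with
  | zero => omega
  | succ i =>
    by_contra hcon
    have hi := hmin i (by omega)
    have hs := hstep i (by omega)
    exact hcon ⟨i, by omega, by omega, by omega⟩

end UnitJumps

section Processes

variable {Ω : Type*} [MeasurableSpace Ω] {P : Measure Ω}

/-- The countably many comparisons on a dense set hold simultaneously almost surely;
right-continuity extends them to all times. -/
theorem ae_monotone {X : ℝ≥0 → Ω → ℕ} (hc : ∀ ω, IsCadlag fun t => X t ω)
    (hle : ∀ s t : ℝ≥0, s ≤ t → ∀ᵐ ω ∂P, X s ω ≤ X t ω) : ∀ᵐ ω ∂P, Monotone fun t => X t ω := by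
  have hd : ∀ᵐ ω ∂P, ∀ m n : ℕ, TopologicalSpace.denseSeq ℝ≥0 m ≤ TopologicalSpace.denseSeq ℝ≥0 n →
      X (TopologicalSpace.denseSeq ℝ≥0 m) ω ≤ X (TopologicalSpace.denseSeq ℝ≥0 n) ω := by
    rw [ae_all_iff]
    intro m
    rw [ae_all_iff]
    intro n
    by_cases h : TopologicalSpace.denseSeq ℝ≥0 m ≤ TopologicalSpace.denseSeq ℝ≥0 n
    · filter_upwards [hle _ _ h] with ω hω _ using hω
    · exact ae_of_all _ fun ω h' => absurd h' h
  filter_upwards [hd] with ω hω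
  have hr : ∀ t u : ℝ≥0, t < u → ∃ n, t < TopologicalSpace.denseSeq ℝ≥0 n ∧
      TopologicalSpace.denseSeq ℝ≥0 n < u ∧ X (TopologicalSpace.denseSeq ℝ≥0 n) ω = X t ω := by
    intro t u htu
    obtain ⟨b, hb, hb'⟩ := (mem_nhdsGT_iff_exists_Ioo_subset' htu).1 ((hc ω).1 t)
    obtain ⟨n, h1, h2⟩ := exists_denseSeq_between (lt_min hb htu)
    exact ⟨n, h1, h2.trans_le (min_le_right _ _), hb' ⟨h1, h2.trans_le (min_le_left _ _)⟩⟩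
  intro s t hst
  rcases hst.eq_or_lt with rfl | hst
  · exact le_rfl
  obtain ⟨m, -, hm2, hm⟩ := hr s t hst
  obtain ⟨n, hn1, -, hn⟩ := hr t (t + 1) (lt_add_one t)
  change X s ω ≤ X t ω
  rw [← hm, ← hn]
  exact hω m n (hm2.trans hn1).le

variable [IsProbabilityMeasure P]

theorem measureReal_mono_of_ae {A B : Set Ω} (h : ∀ᵐ ω ∂P, ω ∈ A → ω ∈ B) :
    P.real A ≤ P.real B :=
  ENNReal.toReal_mono (measure_ne_top _ _) (measure_mono_ae h)

/-- On `[0, M]` with mesh 1/N there are MN cells, each bad with probability at most C/N². The total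
MC/N tends to 0, so almost surely some grid has no bad cell. -/
theorem ae_unit_jumps {Y : ℝ≥0 → Ω → ℕ} (hmono : ∀ᵐ ω ∂P, Monotone fun t => Y t ω)
    (hY : ∀ T : ℝ≥0, ∃ C : ℝ, 0 ≤ C ∧ ∀ s t : ℝ≥0, s ≤ t → t ≤ T →
      P.real {ω | Y s ω + 2 ≤ Y t ω} ≤ C * (t - s) ^ 2) :
    ∀ᵐ ω ∂P, ∀ t, 0 < t → ∀ a, HasLeftLimit (fun s => Y s ω) t a → Y t ω ≤ a + 1 := by
  have hM : ∀ M : ℕ, ∀ᵐ ω ∂P, ∃ N : ℕ, 0 < N ∧ ∀ i < M * N,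
      Y (((i + 1 : ℕ) : ℝ≥0) / N) ω ≤ Y ((i : ℝ≥0) / N) ω + 1 := by
    intro M
    obtain ⟨C, hC0, hC⟩ := hY M
    set bad : ℕ → Set Ω := fun N => ⋃ i ∈ Finset.range (M * N),
      {ω | Y ((i : ℝ≥0) / N) ω + 2 ≤ Y (((i + 1 : ℕ) : ℝ≥0) / N) ω} with hbad
    have hbound : ∀ N : ℕ, 0 < N → P.real (bad N) ≤ M * C / N := by
      intro N hN
      have hN' : (0 : ℝ) < N := Nat.cast_pos.2 hN
      calc P.real (bad N) ≤ ∑ i ∈ Finset.range (M * N),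
            P.real {ω | Y ((i : ℝ≥0) / N) ω + 2 ≤ Y (((i + 1 : ℕ) : ℝ≥0) / N) ω} :=
            measureReal_biUnion_finset_le _ _
        _ ≤ ∑ i ∈ Finset.range (M * N), C * (1 / N) ^ 2 := by
            refine Finset.sum_le_sum fun i hi => ?_
            have hi' : i + 1 ≤ M * N := Finset.mem_range.1 hi
            refine (hC _ _ ?_ ?_).trans (le_of_eq ?_)
            · gcongr; omega
            · rw [div_le_iff₀ (Nat.cast_pos.2 hN)]
              exact_mod_cast hi'
            · push_cast
              field_simp
              ring
        _ = M * C / N := by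
            rw [Finset.sum_const, Finset.card_range, nsmul_eq_mul]
            push_cast
            field_simp
    have h0 : P (⋂ N ∈ {N : ℕ | 0 < N}, bad N) = 0 := by
      rw [← measureReal_eq_zero_iff]
      refine le_antisymm (le_of_forall_pos_le_add fun ε hε => ?_) measureReal_nonneg
      obtain ⟨N, hN⟩ := exists_nat_gt (M * C / ε)
      have hN0 : 0 < N := by
        have : 0 ≤ M * C / ε := by positivity
        exact_mod_cast this.trans_lt hN
      rw [zero_add]
      refine ((measureReal_mono (Set.biInter_subset_of_mem hN0) (measure_ne_top _ _)).trans (hbound N hN0)).trans ?_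
      rw [div_lt_iff₀ hε] at hN
      rw [div_le_iff₀ (Nat.cast_pos.2 hN0)]
      linarith
    filter_upwards [measure_eq_zero_iff_ae_notMem.1 h0] with ω hω
    simp only [Set.mem_iInter, not_forall] at hω
    obtain ⟨N, hN, hω⟩ := hω
    refine ⟨N, hN, fun i hi => ?_⟩
    by_contra hcon
    refine hω (Set.mem_biUnion (Finset.mem_coe.2 (Finset.mem_range.2 hi)) ?_)
    change _ + 2 ≤ _
    omega
  filter_upwards [hmono, ae_all_iff.2 hM] with ω h1 h2 t ht a ha
  obtain ⟨M, hMt⟩ := exists_nat_ge t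
  obtain ⟨N, hN, hg⟩ := h2 M
  exact le_leftLimit_add_one_of_grid h1 hN hg ht hMt ha

/-- The sum grows by two only if one coordinate does, or if two distinct coordinates move;
independence makes the latter a product of two O(h) probabilities. -/
theorem exists_sum_increment_bound {n : ℕ} {X : Fin n → ℝ≥0 → Ω → ℕ}
    (hind : iIndepFun (fun (j : Fin n) (ω : Ω) (t : ℝ≥0) => X j t ω) P)
    (hmono : ∀ j, ∀ᵐ ω ∂P, Monotone fun t => X j t ω)
    (T : ℝ≥0) (hX : ∀ j, ∃ C : ℝ, 0 ≤ C ∧ ∀ s t : ℝ≥0, s ≤ t → t ≤ T →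
      P.real {ω | X j s ω ≠ X j t ω} ≤ C * (t - s) ∧
      P.real {ω | X j s ω + 2 ≤ X j t ω} ≤ C * (t - s) ^ 2) :
    ∃ C : ℝ, 0 ≤ C ∧ ∀ s t : ℝ≥0, s ≤ t → t ≤ T →
      P.real {ω | (∑ j, X j s ω) + 2 ≤ ∑ j, X j t ω} ≤ C * (t - s) ^ 2 := by
  choose C hC0 hC using hX
  refine ⟨∑ j, C j + ∑ i, ∑ j, C i * C j, add_nonneg (Finset.sum_nonneg fun j _ => hC0 j)
    (Finset.sum_nonneg fun i _ => Finset.sum_nonneg fun j _ => mul_nonneg (hC0 i) (hC0 j)),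
    fun s t hst htT => ?_⟩
  have hd : 0 ≤ (t : ℝ) - s := sub_nonneg.2 (NNReal.coe_le_coe.2 hst)
  set A : Fin n → Set Ω := fun j => {ω | X j s ω + 2 ≤ X j t ω}
  set B : Fin n → Fin n → Set Ω := fun i j =>
    if i = j then ∅ else {ω | X i s ω ≠ X i t ω} ∩ {ω | X j s ω ≠ X j t ω} with hBdef
  have hB : ∀ i j, P.real (B i j) ≤ C i * C j * (t - s) ^ 2 := by
    intro i j
    simp only [hBdef]
    split_ifs with h
    · simp only [measureReal_empty]
      exact mul_nonneg (mul_nonneg (hC0 i) (hC0 j)) (sq_nonneg _)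
    · have hm : MeasurableSet {f : ℝ≥0 → ℕ | f s ≠ f t} :=
        (measurableSet_eq_fun (measurable_pi_apply s) (measurable_pi_apply t)).compl
      have := (hind.indepFun h).measure_inter_preimage_eq_mul _ _ hm hm
      have h2 := congrArg ENNReal.toReal this
      rw [ENNReal.toReal_mul] at h2
      refine h2.le.trans ?_
      calc _ ≤ (C i * (t - s)) * (C j * (t - s)) := by
            refine mul_le_mul (hC i s t hst htT).1 (hC j s t hst htT).1 ENNReal.toReal_nonneg ?_
            exact mul_nonneg (hC0 i) hd
        _ = _ := by ring
  have hsub : P.real {ω | (∑ j, X j s ω) + 2 ≤ ∑ j, X j t ω} ≤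
      P.real ((⋃ j ∈ Finset.univ, A j) ∪ ⋃ i ∈ Finset.univ, ⋃ j ∈ Finset.univ, B i j) := by
    refine measureReal_mono_of_ae ?_
    filter_upwards [ae_all_iff.2 hmono] with ω hω h
    have hle : ∀ j, X j s ω ≤ X j t ω := fun j => hω j hst
    by_contra hcon
    simp only [Set.mem_union, Set.mem_iUnion, Finset.mem_univ, exists_const, not_or,
      not_exists] at hcon
    have h1 : ∀ j, X j t ω ≤ X j s ω + 1 := fun j => by
      have := hcon.1 j
      change ¬ (_ + 2 ≤ _) at this
      omega
    have h2 : ∀ i j, i ≠ j → X i s ω ≠ X i t ω → X j s ω = X j t ω := fun i j hij hi => by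
      have := hcon.2 i j
      simp only [hBdef, if_neg hij] at this
      by_contra hj
      exact this ⟨hi, hj⟩
    have h3 : ∑ j, X j t ω ≤ (∑ j, X j s ω) + 1 := by
      by_cases hex : ∃ i, X i s ω ≠ X i t ω
      · obtain ⟨i, hi⟩ := hex
        rw [← Finset.add_sum_erase _ _ (Finset.mem_univ i),
          ← Finset.add_sum_erase _ (fun j => X j s ω) (Finset.mem_univ i),
          Finset.sum_congr rfl fun j hj => (h2 i j (Finset.ne_of_mem_erase hj).symm hi).symm]
        have := h1 i
        omega
      · push Not at hex
        simp [hex]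
    have h' : (∑ j, X j s ω) + 2 ≤ ∑ j, X j t ω := h
    omega
  refine hsub.trans ((measureReal_union_le _ _).trans ?_)
  rw [add_mul, Finset.sum_mul, Finset.sum_mul]
  refine add_le_add ((measureReal_biUnion_finset_le _ _).trans
    (Finset.sum_le_sum fun j _ => (hC j s t hst htT).2)) ?_
  refine (measureReal_biUnion_finset_le _ _).trans (Finset.sum_le_sum fun i _ => ?_)
  refine (measureReal_biUnion_finset_le _ _).trans ?_
  rw [Finset.sum_mul]
  exact Finset.sum_le_sum fun j _ => hB i j

end Processes

/-! ### Truncated geometric marginals force the birth rates -/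

/-- A process on `0, …, J - 1` with almost surely non-decreasing paths whose value at time `t` has
the truncated geometric distribution with parameter `t`. -/
structure IsTruncGeomProcess {Ω : Type*} [MeasurableSpace Ω] (J : ℕ) (X : ℝ≥0 → Ω → ℕ)
    (P : Measure Ω) : Prop where
  measurable : ∀ t, Measurable (X t)
  lt : ∀ t ω, X t ω < J
  mono : ∀ᵐ ω ∂P, Monotone fun t => X t ω
  marginal : ∀ (t : ℝ≥0) (k : ℕ), P.real {ω | X t ω = k} = truncGeom J t k

section

variable {Ω : Type*} [MeasurableSpace Ω] {P : Measure Ω} {X : ℝ≥0 → Ω → ℕ} {J : ℕ}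

theorem IsBirthProcess.congr_rates {p p' : ℝ → ℕ → ℝ} (hB : IsBirthProcess p X P)
    (h : ∀ (t : ℝ≥0) (k : ℕ), P {ω | X t ω = k} ≠ 0 → p t k = p' t k) : IsBirthProcess p' X P :=
  ⟨hB.measurable, hB.cadlag, hB.no_fixed_jump, hB.initial, hB.markov, fun t k m h0 => by
    rw [← h t k h0]; exact hB.rates t k m h0⟩

theorem isBirthProcess_rate_iff (hlt : ∀ t ω, X t ω < J) :
    IsBirthProcess (rate J) X P ↔ IsBirthProcess (birthRate J) X P := by
  have h : ∀ (t : ℝ≥0) (k : ℕ), P {ω | X t ω = k} ≠ 0 → rate J t k = birthRate J t k := by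
    intro t k h0
    obtain ⟨ω, hω⟩ := nonempty_of_measure_ne_zero h0
    exact (birthRate_eq ((hω : X t ω = k) ▸ hlt t ω) t.2).symm
  exact ⟨fun hB => hB.congr_rates h, fun hB => hB.congr_rates fun t k h0 => (h t k h0).symm⟩

variable [IsProbabilityMeasure P]

theorem IsTruncGeomProcess.pos (hX : IsTruncGeomProcess J X P) : 0 < J := by
  obtain ⟨ω⟩ := nonempty_of_isProbabilityMeasure P
  exact (Nat.zero_le _).trans_lt (hX.lt 0 ω)

theorem IsTruncGeomProcess.measureReal_le (hX : IsTruncGeomProcess J X P) (t : ℝ≥0) (k : ℕ) :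
    P.real {ω | X t ω ≤ k} = truncGeomCdf J k t := by
  rw [← sum_truncGeom, Finset.sum_congr rfl fun i _ => (hX.marginal t i).symm,
    ← measureReal_biUnion_finset]
  · congr 1
    ext ω
    simp
  · intro i _ j _ hij
    exact Set.disjoint_left.2 fun ω h1 h2 => hij (h1.symm.trans h2)
  · exact fun i _ => measurableSet_eq_state hX.measurable t i

/-- By monotonicity {X_t ≤ k} is almost surely contained in {X_s ≤ k}, so the marginals alone
determine the crossing probability. -/
theorem IsTruncGeomProcess.measureReal_cross (hX : IsTruncGeomProcess J X P) {s t : ℝ≥0}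
    (hst : s ≤ t) (k : ℕ) :
    P.real {ω | X s ω ≤ k ∧ k < X t ω} = truncGeomCdf J k s - truncGeomCdf J k t := by
  have h1 := measureReal_inter_add_sdiff (μ := P) (s := {ω | X s ω ≤ k})
    (measurableSet_le (hX.measurable t) measurable_const : MeasurableSet {ω | X t ω ≤ k})
  have h2 : P.real ({ω | X s ω ≤ k} ∩ {ω | X t ω ≤ k}) = P.real {ω | X t ω ≤ k} := by
    refine le_antisymm (measureReal_mono Set.inter_subset_right) (measureReal_mono_of_ae ?_)
    filter_upwards [hX.mono] with ω hω h
    exact ⟨(hω hst).trans h, h⟩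
  have h3 : {ω | X s ω ≤ k} \ {ω | X t ω ≤ k} = {ω | X s ω ≤ k ∧ k < X t ω} := by
    ext ω; simp
  rw [h2, h3, hX.measureReal_le, hX.measureReal_le] at h1
  linarith

/-- A move crosses the level of its starting state; each crossing probability is Lipschitz in time
by the mean value inequality. -/
theorem IsTruncGeomProcess.exists_ne_bound (hX : IsTruncGeomProcess J X P) (T : ℝ≥0) :
    ∃ C : ℝ, 0 ≤ C ∧ ∀ s t : ℝ≥0, s ≤ t → t ≤ T → P.real {ω | X s ω ≠ X t ω} ≤ C * (t - s) := by
  have hp := isRateFamily_birthRate J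
  obtain ⟨C, hC0, hC⟩ := hp.exists_bound T
  refine ⟨J * C, by positivity, fun s t hst htT => ?_⟩
  have hst' : (s : ℝ) ≤ t := NNReal.coe_le_coe.2 hst
  have htT' : (t : ℝ) ≤ T := NNReal.coe_le_coe.2 htT
  have hcross : ∀ k, P.real {ω | X s ω ≤ k ∧ k < X t ω} ≤ C * (t - s) := by
    intro k
    rw [hX.measureReal_cross hst]
    have := Convex.norm_image_sub_le_of_norm_hasDerivWithin_le (f := truncGeomCdf J k)
      (s := Set.Icc 0 (T : ℝ)) (C := C) (x := t) (y := s)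
      (fun x hx => (hasDerivAt_truncGeomCdf hX.pos k hx.1).hasDerivWithinAt)
      (fun x hx => ?_) (convex_Icc _ _) ⟨t.2, htT'⟩ ⟨s.2, hst'.trans htT'⟩
    · rw [Real.norm_eq_abs, Real.norm_eq_abs, abs_sub_comm (s : ℝ),
        abs_of_nonneg (sub_nonneg.2 hst')] at this
      exact (le_abs_self _).trans this
    · have h1 := truncGeom_nonneg J k hx.1
      rw [norm_neg, Real.norm_eq_abs, abs_of_nonneg (mul_nonneg h1 (hp.nonneg x k))]
      calc _ ≤ 1 * C := mul_le_mul (truncGeom_le_one k hx.1) (hC x hx k) (hp.nonneg x k) zero_le_one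
        _ = C := one_mul C
  calc P.real {ω | X s ω ≠ X t ω}
      ≤ P.real (⋃ k ∈ Finset.range J, {ω | X s ω ≤ k ∧ k < X t ω}) := by
        refine measureReal_mono_of_ae ?_
        filter_upwards [hX.mono] with ω hω h
        simp only [Set.mem_iUnion]
        exact ⟨X s ω, Finset.mem_range.2 (hX.lt s ω), le_rfl, lt_of_le_of_ne (hω hst) h⟩
    _ ≤ ∑ k ∈ Finset.range J, P.real {ω | X s ω ≤ k ∧ k < X t ω} :=
        measureReal_biUnion_finset_le _ _
    _ ≤ ∑ k ∈ Finset.range J, C * ((t : ℝ) - s) := Finset.sum_le_sum fun k _ => hcross k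
    _ = _ := by rw [Finset.sum_const, Finset.card_range, nsmul_eq_mul, mul_assoc]

/-- The Markov property for the event of leaving a state. -/
theorem IsMarkov.inter_ne (hm : ∀ t, Measurable (X t)) (hM : IsMarkov X P) {s t u : ℝ≥0}
    (hst : s ≤ t) (htu : t < u) (a b c : ℕ) :
    P.real ({ω | X s ω = a} ∩ {ω | X t ω = b} ∩ {ω | X u ω ≠ c}) * P.real {ω | X t ω = b} =
      P.real ({ω | X s ω = a} ∩ {ω | X t ω = b}) *
        P.real ({ω | X t ω = b} ∩ {ω | X u ω ≠ c}) := by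
  have h := hM.cyl_inter hm (I := {s}) (fun _ => a) (t := t) (u := u) (by simpa using hst) htu b c
  have hcyl : cyl X {s} (fun _ => a) = {ω | X s ω = a} := by ext; simp [cyl]
  rw [hcyl] at h
  have hdiff : ∀ A : Set Ω, P.real (A ∩ {ω | X u ω ≠ c}) =
      P.real A - P.real (A ∩ {ω | X u ω = c}) := by
    intro A
    have h1 := measureReal_inter_add_sdiff (μ := P) (s := A) (measurableSet_eq_state hm u c)
    have h2 : A \ {ω | X u ω = c} = A ∩ {ω | X u ω ≠ c} := rfl
    rw [h2] at h1
    linarith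
  rw [hdiff, hdiff, sub_mul, mul_sub, h]

/-- Cut `[t, t + h]` into N pieces. With unit jumps and N large, a path from `k` to at least `k + 2`
steps from `k` to `k + 1` across one piece and has left `k + 1` by `t + h`. The Markov property at
the intermediate grid time bounds this by (Kh/N)(Kh)/c per piece; sum over the pieces and let N tend
to infinity. -/
theorem IsTruncGeomProcess.two_jumps_le (hX : IsTruncGeomProcess J X P)
    (hc : ∀ ω, IsCadlag fun t => X t ω)
    (hunit : ∀ᵐ ω ∂P, ∀ t, 0 < t → ∀ a, HasLeftLimit (fun s => X s ω) t a → X t ω ≤ a + 1)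
    (hM : IsMarkov X P) {t : ℝ≥0} (ht : 0 < t) (k : ℕ) :
    ∃ C : ℝ, 0 ≤ C ∧ ∀ h : ℝ≥0, h ≤ 1 →
      P.real ({ω | X t ω = k} ∩ {ω | k + 2 ≤ X (t + h) ω}) ≤ C * h ^ 2 := by
  rcases Nat.lt_or_ge (k + 1) J with hk | hk
  swap
  · refine ⟨0, le_rfl, fun h _ => ?_⟩
    have : {ω | k + 2 ≤ X (t + h) ω} = ∅ := by
      ext ω
      have := hX.lt (t + h) ω
      simp only [Set.mem_ofPred_eq, Set.mem_empty_iff_false, iff_false]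
      omega
    simp [this]
  obtain ⟨K, hK0, hK⟩ := hX.exists_ne_bound (t + 1)
  -- A uniform lower bound `c` for the probability of `k + 1` on `[t, t + 1]`; it is positive
  -- because `t > 0`.
  obtain ⟨s₀, hs₀, hmin⟩ := (isCompact_Icc (a := (t : ℝ)) (b := t + 1)).exists_isMinOn
    (Set.nonempty_Icc.2 (by linarith)) (f := fun s => truncGeom J s (k + 1)) fun s hs =>
      (hasDerivAt_truncGeom hX.pos (k + 1) (t.2.trans hs.1)).continuousAt.continuousWithinAt
  set c := truncGeom J s₀ (k + 1) with hcdef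
  have hc0 : 0 < c := truncGeom_pos hk ((NNReal.coe_pos.2 ht).trans_le hs₀.1)
  refine ⟨K * K / c, by positivity, fun h hh => ?_⟩
  set A : Set Ω := {ω | X t ω = k} ∩ {ω | k + 2 ≤ X (t + h) ω} with hA
  set g : ℕ → ℕ → ℝ≥0 := fun N i => t + i * (h / N) with hg
  set D : ℕ → Set Ω := fun N => ⋃ i ∈ Finset.range N,
    ({ω | X (g N i) ω = k} ∩ {ω | X (g N (i + 1)) ω = k + 1}) with hD
  have hgN : ∀ N, 0 < N → g N N = t + h := by
    intro N hN
    have : (N : ℝ≥0) ≠ 0 := Nat.cast_ne_zero.2 hN.ne'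
    simp only [hg]
    field_simp
  have hgmono : ∀ N, Monotone (g N) := fun N i j hij => by
    simp only [hg]; gcongr
  have hgt : ∀ N i, t ≤ g N i := fun N i => le_self_add
  have hgdiff : ∀ N i, (g N (i + 1) : ℝ) - g N i = h / N := by
    intro N i
    simp only [hg]
    push_cast
    ring
  have hth1 : t + h ≤ t + 1 := by gcongr
  have hstep : ∀ N, 0 < N → ∀ i < N, P.real ({ω | X (g N i) ω = k} ∩
      {ω | X (g N (i + 1)) ω = k + 1} ∩ {ω | X (t + h) ω ≠ k + 1}) ≤ K * (h / N) * (K * h / c) := by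
    intro N hN i hi
    have hle : g N (i + 1) ≤ t + h := hgN N hN ▸ hgmono N (by omega)
    have hle' : (g N (i + 1) : ℝ) ≤ t + h := by exact_mod_cast hle
    rcases hle.eq_or_lt with he | hlt
    · have : {ω | X (g N i) ω = k} ∩ {ω | X (g N (i + 1)) ω = k + 1} ∩ {ω | X (t + h) ω ≠ k + 1} =
          ∅ := by
        rw [he]
        ext ω
        simp only [Set.mem_inter_iff, Set.mem_ofPred_eq, Set.mem_empty_iff_false, iff_false]
        tauto
      rw [this, measureReal_empty]
      positivity
    · have hmk := hM.inter_ne hX.measurable (hgmono N (Nat.le_succ i)) hlt k (k + 1) (k + 1)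
      have hmarg : c ≤ P.real {ω | X (g N (i + 1)) ω = k + 1} := by
        rw [hX.marginal]
        refine hmin ⟨NNReal.coe_le_coe.2 (hgt N _), ?_⟩
        have : (h : ℝ) ≤ 1 := hh
        linarith
      have h1 : P.real ({ω | X (g N i) ω = k} ∩ {ω | X (g N (i + 1)) ω = k + 1}) ≤ K * (h / N) := by
        rw [← hgdiff N i]
        refine le_trans (measureReal_mono fun ω hω => ?_)
          (hK _ _ (hgmono N (Nat.le_succ i)) (hle.trans hth1))
        have h1 : X (g N i) ω = k := hω.1
        have h2 : X (g N (i + 1)) ω = k + 1 := hω.2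
        change X (g N i) ω ≠ X (g N (i + 1)) ω
        omega
      have h2 : P.real ({ω | X (g N (i + 1)) ω = k + 1} ∩ {ω | X (t + h) ω ≠ k + 1}) ≤ K * h := by
        refine le_trans (measureReal_mono fun ω hω => ?_) ((hK _ _ hle hth1).trans ?_)
        · have h1 : X (g N (i + 1)) ω = k + 1 := hω.1
          have h2 : X (t + h) ω ≠ k + 1 := hω.2
          change X (g N (i + 1)) ω ≠ X (t + h) ω
          omega
        · have := NNReal.coe_le_coe.2 (hgt N (i + 1))
          push_cast
          gcongr
          linarith
      have hpos := hc0.trans_le hmarg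
      rw [← mul_div_assoc, le_div_iff₀ hc0]
      calc _ ≤ P.real ({ω | X (g N i) ω = k} ∩ {ω | X (g N (i + 1)) ω = k + 1} ∩
            {ω | X (t + h) ω ≠ k + 1}) * P.real {ω | X (g N (i + 1)) ω = k + 1} := by gcongr
        _ = _ := hmk
        _ ≤ K * (h / N) * (K * h) := by gcongr
  have hAD : ∀ N, 0 < N → P.real A ≤ K * K / c * h ^ 2 + P.real (A \ D N) := by
    intro N hN
    have hNR : (N : ℝ) ≠ 0 := Nat.cast_ne_zero.2 hN.ne'
    have hcov : A ⊆ (⋃ i ∈ Finset.range N, ({ω | X (g N i) ω = k} ∩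
        {ω | X (g N (i + 1)) ω = k + 1} ∩ {ω | X (t + h) ω ≠ k + 1})) ∪ A \ D N := by
      intro ω hω
      by_cases hωD : ω ∈ D N
      · left
        simp only [hD, Set.mem_iUnion] at hωD ⊢
        obtain ⟨i, hi, h1⟩ := hωD
        refine ⟨i, hi, h1, ?_⟩
        have : k + 2 ≤ X (t + h) ω := hω.2
        change X (t + h) ω ≠ k + 1
        omega
      · exact Or.inr ⟨hω, hωD⟩
    refine (measureReal_mono hcov (measure_ne_top _ _)).trans ((measureReal_union_le _ _).trans ?_)
    gcongr
    refine (measureReal_biUnion_finset_le _ _).trans ((Finset.sum_le_sum fun i hi =>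
      hstep N hN i (Finset.mem_range.1 hi)).trans (le_of_eq ?_))
    rw [Finset.sum_const, Finset.card_range, nsmul_eq_mul]
    field_simp
  have hmeasA : MeasurableSet A := (measurableSet_eq_state hX.measurable t k).inter
    (measurableSet_le measurable_const (hX.measurable _))
  have hmeasD : ∀ N, MeasurableSet (D N) := fun N => Finset.measurableSet_biUnion _ fun i _ =>
    (measurableSet_eq_state hX.measurable _ _).inter (measurableSet_eq_state hX.measurable _ _)
  -- Almost every path grows by at most one over each piece once the mesh is small, and is then
  -- caught by `D N`.
  have hlim : Tendsto (fun N => P.real (A \ D N)) atTop (𝓝 0) := by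
    have h0 : Tendsto (fun N => P (A \ D N)) atTop (𝓝 (P ∅)) := by
      refine tendsto_measure_of_ae_tendsto_indicator_of_isFiniteMeasure atTop MeasurableSet.empty
        (fun N => hmeasA.diff (hmeasD N)) ?_
      filter_upwards [hX.mono, hunit] with ω hmono hun
      obtain ⟨ε, hε, hinc⟩ := exists_increment_le_one hmono (hc ω) hun (t + h)
      obtain ⟨N₀, hN₀⟩ := exists_nat_gt ((h : ℝ) / ε)
      filter_upwards [eventually_ge_atTop (N₀ + 1)] with N hN
      have hN0 : 0 < N := by omega
      simp only [Set.mem_empty_iff_false, iff_false]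
      rintro ⟨hω, hωD⟩
      refine hωD ?_
      have hNε : (h : ℝ) / N < ε := by
        have h1 : (N₀ : ℝ) ≤ N := by exact_mod_cast (by omega : N₀ ≤ N)
        rw [div_lt_iff₀ hε] at hN₀
        rw [div_lt_iff₀ (Nat.cast_pos.2 hN0)]
        nlinarith
      obtain ⟨i, hi, h1, h2⟩ := exists_step (f := fun i => X (g N i) ω) (N := N) (k := k)
        (by simpa [hg] using hω.1)
        (by
          have : k + 2 ≤ X (t + h) ω := hω.2
          rw [hgN N hN0]
          omega)
        fun i hi => hinc _ _ (hgmono N (Nat.le_succ i)) (hgN N hN0 ▸ hgmono N (by omega))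
          (by rw [hgdiff]; exact hNε)
      exact Set.mem_biUnion (Finset.mem_coe.2 (Finset.mem_range.2 hi)) ⟨h1, h2⟩
    rw [measure_empty] at h0
    exact (ENNReal.tendsto_toReal ENNReal.zero_ne_top).comp h0
  have := ge_of_tendsto' (f := fun N => K * K / c * h ^ 2 + P.real (A \ D (N + 1)))
    (x := atTop) ((tendsto_const_nhds.add (hlim.comp (tendsto_add_atTop_nat 1))))
    (fun N => hAD (N + 1) (Nat.succ_pos N))
  simpa using this

theorem tendsto_coe_add_nhdsGT (t : ℝ≥0) :
    Tendsto (fun h : ℝ≥0 => ((t + h : ℝ≥0) : ℝ)) (𝓝[>] 0) (𝓝 (t : ℝ)) := by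
  have : Tendsto (fun h : ℝ≥0 => ((t + h : ℝ≥0) : ℝ)) (𝓝 0) (𝓝 ((t + 0 : ℝ≥0) : ℝ)) :=
    (NNReal.continuous_coe.comp (continuous_const.add continuous_id)).tendsto 0
  rw [add_zero] at this
  exact this.mono_left nhdsWithin_le_nhds

theorem IsTruncGeomProcess.isLittleO_cross (hX : IsTruncGeomProcess J X P) (t : ℝ≥0) (k : ℕ) :
    (fun h : ℝ≥0 => P.real {ω | X t ω ≤ k ∧ k < X (t + h) ω} -
      h * (truncGeom J t k * birthRate J t k)) =o[𝓝[>] 0] fun h : ℝ≥0 => (h : ℝ) := by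
  have hd := hasDerivAt_iff_isLittleO.1 (hasDerivAt_truncGeomCdf hX.pos k t.2)
  refine (hd.comp_tendsto (tendsto_coe_add_nhdsGT t)).neg_left.congr (fun h => ?_) fun h => ?_
  · rw [hX.measureReal_cross le_self_add]
    simp only [Function.comp, smul_eq_mul]
    push_cast
    simp only [NNReal.val_eq_coe]
    ring
  · simp [Function.comp]

theorem isLittleO_of_sq_bound {f : ℝ≥0 → ℝ} {C : ℝ} (hf : ∀ h, 0 ≤ f h)
    (h : ∀ h : ℝ≥0, h ≤ 1 → f h ≤ C * (h : ℝ) ^ 2) :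
    f =o[𝓝[>] 0] fun h : ℝ≥0 => (h : ℝ) := by
  have h1 : f =O[𝓝[>] 0] fun h : ℝ≥0 => (h : ℝ) ^ 2 := by
    refine Asymptotics.IsBigO.of_bound C ?_
    filter_upwards [Ioo_mem_nhdsGT (zero_lt_one' ℝ≥0)] with x hx
    rw [Real.norm_eq_abs, abs_of_nonneg (hf x), Real.norm_eq_abs, abs_of_nonneg (sq_nonneg _)]
    exact h x hx.2.le
  refine h1.trans_isLittleO ?_
  have h2 : (fun x : ℝ => x ^ 2) =o[𝓝 0] fun x : ℝ => x := by
    simpa using Asymptotics.isLittleO_pow_pow (𝕜 := ℝ) (show 1 < 2 by norm_num)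
  have htend : Tendsto (fun h : ℝ≥0 => (h : ℝ)) (𝓝[>] 0) (𝓝 0) := by
    simpa using tendsto_coe_add_nhdsGT 0
  exact h2.comp_tendsto htend

theorem IsTruncGeomProcess.isLittleO_two_jumps (hX : IsTruncGeomProcess J X P)
    (hc : ∀ ω, IsCadlag fun t => X t ω)
    (hunit : ∀ᵐ ω ∂P, ∀ t, 0 < t → ∀ a, HasLeftLimit (fun s => X s ω) t a → X t ω ≤ a + 1)
    (hM : IsMarkov X P) (t : ℝ≥0) :
    (fun h : ℝ≥0 => P.real {ω | X t ω + 2 ≤ X (t + h) ω}) =o[𝓝[>] 0] fun h : ℝ≥0 => (h : ℝ) := by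
  rcases eq_or_lt_of_le (zero_le : 0 ≤ t) with rfl | ht
  -- At time 0 no lower bound `c` is available. The process starts at 0, so a double jump crosses
  -- level 1, where the flux is o(h) since state 1 has no mass.
  · have h1 := hX.isLittleO_cross 0 1
    rw [NNReal.coe_zero, truncGeom_zero hX.pos] at h1
    simp only [one_ne_zero, if_false, zero_mul, mul_zero, sub_zero] at h1
    refine (Asymptotics.IsBigO.of_bound 1 (Eventually.of_forall fun h => ?_)).trans_isLittleO h1
    rw [one_mul, Real.norm_of_nonneg measureReal_nonneg, Real.norm_of_nonneg measureReal_nonneg]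
    refine measureReal_mono_of_ae ?_
    have h0 : P {ω | X 0 ω = 0}ᶜ = 0 := by
      rw [prob_compl_eq_zero_iff (measurableSet_eq_state hX.measurable 0 0)]
      have := hX.marginal 0 0
      rw [NNReal.coe_zero, truncGeom_zero hX.pos, if_pos rfl, measureReal_def] at this
      exact (ENNReal.toReal_eq_one_iff _).1 this
    filter_upwards [measure_eq_zero_iff_ae_notMem.1 h0] with ω hω h2
    have h3 : X 0 ω = 0 := not_not.1 hω
    have h4 : X 0 ω + 2 ≤ X (0 + h) ω := h2
    exact ⟨by omega, by omega⟩
  · choose C hC0 hC using fun k => hX.two_jumps_le hc hunit hM ht k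
    refine isLittleO_of_sq_bound (C := ∑ k ∈ Finset.range J, C k) (fun _ => measureReal_nonneg)
      fun h hh => ?_
    rw [Finset.sum_mul]
    calc _ ≤ P.real (⋃ k ∈ Finset.range J, ({ω | X t ω = k} ∩ {ω | k + 2 ≤ X (t + h) ω})) := by
          refine measureReal_mono (fun ω hω => ?_) (measure_ne_top _ _)
          simp only [Set.mem_iUnion]
          exact ⟨X t ω, Finset.mem_range.2 (hX.lt t ω), rfl, hω⟩
      _ ≤ _ := (measureReal_biUnion_finset_le _ _).trans
          (Finset.sum_le_sum fun k _ => hC k h hh)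

/-- A Markov process with truncated geometric marginals and non-decreasing paths with unit jumps is
a birth process. -/
theorem IsTruncGeomProcess.isBirthProcess (hX : IsTruncGeomProcess J X P)
    (hc : ∀ ω, IsCadlag fun t => X t ω)
    (hunit : ∀ᵐ ω ∂P, ∀ t, 0 < t → ∀ a, HasLeftLimit (fun s => X s ω) t a → X t ω ≤ a + 1)
    (hM : IsMarkov X P) : IsBirthProcess (birthRate J) X P := by
  refine ⟨hX.measurable, hc, fun t ht => ?_, ?_, hM, fun t k m h0 => ?_⟩
  · refine ae_hasLeftLimit hX.mono fun ε hε => ?_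
    obtain ⟨C, hC0, hC⟩ := hX.exists_ne_bound t
    obtain ⟨s, hst, hs⟩ := exists_left_close ht hC0 hε
    exact ⟨s, hst, (hC s t hst.le le_rfl).trans hs⟩
  · have h0 : P {ω | X 0 ω = 0}ᶜ = 0 := by
      rw [prob_compl_eq_zero_iff (measurableSet_eq_state hX.measurable 0 0)]
      have := hX.marginal 0 0
      rw [NNReal.coe_zero, truncGeom_zero hX.pos, if_pos rfl, measureReal_def] at this
      exact (ENNReal.toReal_eq_one_iff _).1 this
    filter_upwards [measure_eq_zero_iff_ae_notMem.1 h0] with ω hω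
    exact not_not.1 hω
  · have hπ : P.real {ω | X t ω = k} ≠ 0 := by
      rw [measureReal_def]
      exact (ENNReal.toReal_pos h0 (measure_ne_top _ _)).ne'
    have hcross := hX.isLittleO_cross t k
    have htwo := hX.isLittleO_two_jumps hc hunit hM t
    -- Every error below is dominated by the double-jump probability plus the error in the flux.
    have hsum := htwo.add hcross.norm_left
    have hmain : (fun h : ℝ≥0 => P.real ({ω | X t ω = k} ∩ {ω | X (t + h) ω = m}) -
        P.real {ω | X t ω = k} * (if m = k then 1 - (h : ℝ) * birthRate J t k else
          if m = k + 1 then (h : ℝ) * birthRate J t k else 0)) =o[𝓝[>] 0]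
        fun h : ℝ≥0 => (h : ℝ) := by
      refine (Asymptotics.IsBigO.of_bound 1 (Eventually.of_forall fun h => ?_)).trans_isLittleO hsum
      rw [one_mul, Real.norm_of_nonneg (add_nonneg measureReal_nonneg (norm_nonneg _)),
        ← hX.marginal]
      have hth : t ≤ t + h := le_self_add
      set π := P.real {ω | X t ω = k}
      set r := birthRate J t k
      set a := P.real {ω | X t ω ≤ k ∧ k < X (t + h) ω} with ha
      set R := P.real {ω | X t ω + 2 ≤ X (t + h) ω} with hR
      have hR0 : 0 ≤ R := measureReal_nonneg
      have habs := abs_le.1 (le_refl |a - h * (π * r)|)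
      rw [Real.norm_eq_abs, Real.norm_eq_abs]
      -- Leaving `k`, or moving from `k` to `k + 1`, differs from crossing level `k` only by double
      -- jumps.
      have hexp : ∀ B : Set Ω, (∀ᵐ ω ∂P, ω ∈ B → X t ω ≤ k ∧ k < X (t + h) ω) →
          (∀ᵐ ω ∂P, X t ω ≤ k ∧ k < X (t + h) ω → ω ∉ B → X t ω + 2 ≤ X (t + h) ω) →
          P.real B ≤ a ∧ a ≤ P.real B + R := by
        intro B h1 h2
        refine ⟨measureReal_mono_of_ae h1, le_trans (measureReal_mono_of_ae ?_)
          (measureReal_union_le _ _)⟩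
        filter_upwards [h2] with ω hω h3
        by_cases hB : ω ∈ B
        · exact Or.inl hB
        · exact Or.inr (hω h3 hB)
      split_ifs with hmk hmk1
      · subst hmk
        obtain ⟨h1, h2⟩ := hexp ({ω | X t ω = m} ∩ {ω | X (t + h) ω ≠ m}) (by
            filter_upwards [hX.mono] with ω hω h3
            have h4 : X t ω = m := h3.1
            have h5 : X (t + h) ω ≠ m := h3.2
            have h6 : X t ω ≤ X (t + h) ω := hω hth
            omega) (by
            filter_upwards [hX.mono] with ω hω h3 h4
            have h6 : X t ω ≤ X (t + h) ω := hω hth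
            by_contra h7
            exact h4 ⟨show X t ω = m by omega, show X (t + h) ω ≠ m by omega⟩)
        have hsplit := measureReal_inter_add_sdiff (μ := P) (s := {ω | X t ω = m})
          (measurableSet_eq_state hX.measurable (t + h) m)
        have hset : {ω | X t ω = m} \ {ω | X (t + h) ω = m} =
          {ω | X t ω = m} ∩ {ω | X (t + h) ω ≠ m} := rfl
        rw [hset] at hsplit
        rw [abs_le]
        constructor <;> linarith
      · subst hmk1
        obtain ⟨h1, h2⟩ := hexp ({ω | X t ω = k} ∩ {ω | X (t + h) ω = k + 1}) (by
            refine ae_of_all _ fun ω h3 => ?_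
            have h4 : X t ω = k := h3.1
            have h5 : X (t + h) ω = k + 1 := h3.2
            omega) (by
            refine ae_of_all _ fun ω h3 h4 => ?_
            by_contra h7
            exact h4 ⟨show X t ω = k by omega, show X (t + h) ω = k + 1 by omega⟩)
        rw [abs_le]
        constructor <;> linarith
      · rw [mul_zero, sub_zero, abs_of_nonneg measureReal_nonneg]
        refine le_trans (measureReal_mono_of_ae ?_) (le_add_of_nonneg_right (abs_nonneg _))
        filter_upwards [hX.mono] with ω hω h3
        have h4 : X t ω = k := h3.1
        have h5 : X (t + h) ω = m := h3.2
        have h6 : X t ω ≤ X (t + h) ω := hω hth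
        change X t ω + 2 ≤ X (t + h) ω
        omega
    refine (hmain.const_mul_left (P.real {ω | X t ω = k})⁻¹).congr_left fun h => ?_
    rw [condReal_apply (measurableSet_eq_state hX.measurable _ _), mul_sub,
      inv_mul_cancel_left₀ hπ]

/-- The truncated geometric laws and the laws of the process solve the same forward equation, both
starting from the point mass at 0. -/
theorem IsBirthProcess.isTruncGeom (hB : IsBirthProcess (birthRate J) X P)
    (hlt : ∀ t ω, X t ω < J) : IsTruncGeomProcess J X P := by
  have hp := isRateFamily_birthRate J
  have hJ : 0 < J := by
    obtain ⟨ω⟩ := nonempty_of_isProbabilityMeasure P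
    exact (Nat.zero_le _).trans_lt (hlt 0 ω)
  refine ⟨hB.measurable, hlt, ae_monotone hB.cadlag fun s t hst =>
    ae_le_of_trans hlt fun k m => hB.measureReal_inter hp hlt hst k m, fun t k => ?_⟩
  rw [hB.measureReal_eq hp hlt]
  have hd : ∀ m (u : ℝ), 0 ≤ u → HasDerivAt (fun u => truncGeom J u m)
    (forwardRHS (birthRate J) u (fun i => truncGeom J u i) m) u :=
    fun m u hu => hasDerivAt_truncGeom hJ m hu
  refine hp.eq_of_forward (s := 0) (D := fun m u => trans (birthRate J) 0 m 0 u)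
    (D' := fun m u => truncGeom J u m)
    (fun m => (hp.continuous_trans 0 m 0).continuousOn)
    (fun m u hu => (hd m u hu).continuousAt.continuousWithinAt)
    (fun m u _ => (hp.hasDerivAt_trans 0 m 0 u).hasDerivWithinAt)
    (fun m u hu => (hd m u hu).hasDerivWithinAt) (fun m => ?_) k t.2
  simp only [trans_self, truncGeom_zero hJ, eq_comm]

end

/-! ### From permutations to independent coordinates -/

instance discreteMeasurableSpacePermFin (n : ℕ) : DiscreteMeasurableSpace (Equiv.Perm (Fin n)) :=
  ⟨fun _ => trivial⟩

section Inversions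

variable {n : ℕ}

theorem inv_eq_sum (σ : Equiv.Perm (Fin n)) : inv σ = ∑ j, invAt σ j := by
  simp only [inv, invAt, Finset.card_filter]
  rw [Fintype.sum_prod_type_right]

theorem toCode_Phi (c : Code n) : toCode (Phi n c) = c :=
  (Equiv.ofBijective toCode (toCode_bijective n)).apply_symm_apply c

theorem Phi_toCode (σ : Equiv.Perm (Fin n)) : Phi n (toCode σ) = σ :=
  (Equiv.ofBijective toCode (toCode_bijective n)).symm_apply_apply σ

theorem invAt_Phi (c : Code n) (j : Fin n) : invAt (Phi n c) j = c j :=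
  congrArg Fin.val (congrFun (toCode_Phi c) j)

theorem perm_eq_iff {σ τ : Equiv.Perm (Fin n)} : σ = τ ↔ ∀ j, invAt σ j = invAt τ j :=
  ⟨fun h _ => h ▸ rfl, fun h => toCode_injective n (funext fun j => Fin.ext (h j))⟩

theorem mallowsProb_eq_prod (t : ℝ) (σ : Equiv.Perm (Fin n)) :
    mallowsProb n t σ = ∏ j : Fin n, truncGeom ((j : ℕ) + 1) t (invAt σ j) := by
  have h1 : ∏ k ∈ Finset.Icc 1 n, ∑ l ∈ Finset.range k, t ^ l =
      ∏ j : Fin n, geomSum ((j : ℕ) + 1) t := by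
    rw [Fin.prod_univ_eq_prod_range (fun j => geomSum (j + 1) t) n, Finset.range_eq_Ico,
      Finset.prod_Ico_add' (fun j => geomSum j t) 0 n 1, zero_add]
    rfl
  rw [mallowsProb, h1, inv_eq_sum, ← Finset.prod_pow_eq_pow_sum, ← Finset.prod_div_distrib]
  exact Finset.prod_congr rfl fun j _ => by rw [truncGeom, if_pos (invAt_lt σ j)]

theorem sum_univ_truncGeom {J : ℕ} (hJ : 0 < J) {t : ℝ} (ht : 0 ≤ t) :
    ∑ a : Fin J, truncGeom J t a = 1 := by
  obtain ⟨i, rfl⟩ : ∃ i, J = i + 1 := ⟨J - 1, by omega⟩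
  rw [Fin.sum_univ_eq_sum_range (fun a => truncGeom (i + 1) t a), sum_truncGeom, truncGeomCdf,
    min_self, div_self (zero_lt_one.trans_le (geomSum_ge_one hJ ht)).ne']

end Inversions

section Cadlag

variable {α β : Type*}

theorem IsCadlag.map {x : ℝ≥0 → α} (hx : IsCadlag x) (f : α → β) : IsCadlag fun t => f (x t) :=
  ⟨fun t => (hx.1 t).mono fun _ h => congrArg f h, fun t ht =>
    let ⟨a, ha⟩ := hx.2 t ht
    ⟨f a, Eventually.mono ha fun _ h => congrArg f h⟩⟩

theorem HasLeftLimit.unique {x : ℝ≥0 → α} {t : ℝ≥0} (ht : 0 < t) {a b : α}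
    (ha : HasLeftLimit x t a) (hb : HasLeftLimit x t b) : a = b := by
  have : (𝓝[<] t).NeBot := nhdsLT_neBot_of_exists_lt ⟨0, ht⟩
  obtain ⟨s, h1, h2⟩ := (Eventually.and ha hb).exists
  exact h1.symm.trans h2

theorem HasLeftLimit.le {x : ℝ≥0 → ℕ} (hx : Monotone x) {t : ℝ≥0} (ht : 0 < t) {a : ℕ}
    (ha : HasLeftLimit x t a) : a ≤ x t := by
  have : (𝓝[<] t).NeBot := nhdsLT_neBot_of_exists_lt ⟨0, ht⟩
  obtain ⟨s, h1, h2⟩ := (Eventually.and ha self_mem_nhdsWithin).exists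
  exact h1 ▸ hx (le_of_lt h2)

theorem isCadlag_of_invAt {n : ℕ} {x : ℝ≥0 → Equiv.Perm (Fin n)}
    (h : ∀ j, IsCadlag fun t => invAt (x t) j) : IsCadlag x := by
  refine ⟨fun t => ?_, fun t ht => ?_⟩
  · filter_upwards [eventually_all.2 fun j => (h j).1 t] with s hs
    exact perm_eq_iff.2 hs
  · choose a ha using fun j => (h j).2 t ht
    have hall := eventually_all.2 ha
    have : (𝓝[<] t).NeBot := nhdsLT_neBot_of_exists_lt ⟨0, ht⟩
    obtain ⟨s, hs⟩ := hall.exists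
    refine ⟨x s, ?_⟩
    filter_upwards [hall] with u hu
    exact perm_eq_iff.2 fun j => (hu j).trans (hs j).symm

end Cadlag

section Independence

theorem cyl_eq_forall_invAt {Ω : Type*} {n : ℕ} (M : ℝ≥0 → Ω → Equiv.Perm (Fin n)) (I : Finset ℝ≥0)
    (σ : ℝ≥0 → Equiv.Perm (Fin n)) :
    cyl M I σ = {ω | ∀ j, (fun t => invAt (M t ω) j) ∈
      {f : ℝ≥0 → ℕ | ∀ t ∈ I, f t = invAt (σ t) j}} := by
  ext ω
  simp only [cyl, Set.mem_ofPred_eq, perm_eq_iff]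
  exact ⟨fun h j t ht => h t ht j, fun h t ht j => h j t ht⟩

variable {Ω : Type*} [MeasurableSpace Ω] {P : Measure Ω} {n : ℕ}
  {M : ℝ≥0 → Ω → Equiv.Perm (Fin n)}

theorem HasIndependentInversions.measureReal_eq_prod (hind : HasIndependentInversions M P)
    {S : Fin n → Set (ℝ≥0 → ℕ)} (hS : ∀ j, MeasurableSet (S j)) :
    P.real {ω | ∀ j, (fun t => invAt (M t ω) j) ∈ S j} =
      ∏ j, P.real {ω | (fun t => invAt (M t ω) j) ∈ S j} := by
  have h := hind.measure_inter_preimage_eq_mul Finset.univ (sets := S) fun j _ => hS j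
  simp only [measureReal_def]
  rw [← ENNReal.toReal_prod]
  refine congrArg ENNReal.toReal ((congrArg P ?_).trans h)
  ext ω
  simp

theorem measurableSet_path_cyl (I : Finset ℝ≥0) (x : ℝ≥0 → ℕ) :
    MeasurableSet {f : ℝ≥0 → ℕ | ∀ t ∈ I, f t = x t} :=
  measurableSet_cyl (X := fun t (f : ℝ≥0 → ℕ) => f t) (fun t => measurable_pi_apply t) I x

theorem HasIndependentInversions.measureReal_cyl (hind : HasIndependentInversions M P)
    (I : Finset ℝ≥0) (σ : ℝ≥0 → Equiv.Perm (Fin n)) :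
    P.real (cyl M I σ) =
      ∏ j, P.real (cyl (fun t ω => invAt (M t ω) j) I fun t => invAt (σ t) j) := by
  rw [cyl_eq_forall_invAt, hind.measureReal_eq_prod fun j => measurableSet_path_cyl I _]
  rfl

variable [IsProbabilityMeasure P]

/-- Independence factors each cylinder probability, and the product-form Markov identities of the
coordinates multiply. -/
theorem isMarkov_of_invAt (hm : ∀ t, Measurable (M t)) (hind : HasIndependentInversions M P)
    (hM : ∀ j, IsMarkov (fun t ω => invAt (M t ω) j) P) : IsMarkov M P := by
  have hmj : ∀ (j : Fin n) (t : ℝ≥0), Measurable fun ω => invAt (M t ω) j := fun j t =>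
    (measurable_of_countable fun σ : Equiv.Perm (Fin n) => invAt σ j).comp (hm t)
  rw [isMarkov_iff hm]
  intro I σ s t τ hs hmax hst
  have hne : t ∉ I := fun h => (hmax t h).not_gt hst
  -- Recording `τ` at time `t` makes all four events cylinders along one path.
  set σ' : ℝ≥0 → Equiv.Perm (Fin n) := Function.update σ t τ with hσ'
  have hσI : ∀ u ∈ I, σ' u = σ u := fun u hu =>
    Function.update_of_ne (ne_of_mem_of_not_mem hu hne) _ _
  have hσt : σ' t = τ := Function.update_self _ _ _
  have e1 : cyl M I σ ∩ {ω | M t ω = τ} = cyl M (insert t I) σ' := by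
    rw [cyl_insert, hσt, cyl_congr M hσI]
  have e2 : {ω | M s ω = σ s} = cyl M {s} σ' := by
    ext; simp [cyl, hσI s hs]
  have e3 : {ω | M s ω = σ s} ∩ {ω | M t ω = τ} = cyl M (insert t {s}) σ' := by
    rw [cyl_insert, hσt, e2]
  rw [e3, e1, e2, ← cyl_congr M hσI, hind.measureReal_cyl, hind.measureReal_cyl,
    hind.measureReal_cyl, hind.measureReal_cyl, ← Finset.prod_mul_distrib,
    ← Finset.prod_mul_distrib]
  refine Finset.prod_congr rfl fun j _ => ?_
  have h := (isMarkov_iff (hmj j)).1 (hM j) I (fun t => invAt (σ' t) j) s t (invAt (σ' t) j) hs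
    hmax hst
  have e4 : cyl (fun t ω => invAt (M t ω) j) {s} (fun t => invAt (σ' t) j) =
      {ω | invAt (M s ω) j = invAt (σ' s) j} := by ext; simp [cyl]
  rw [cyl_insert, cyl_insert, e4]
  exact h

/-- A function of a Markov process need not be Markov. Here the other coordinates are frozen along a
path of positive probability, and independence lets their factors cancel. -/
theorem IsMarkov.invAt (hm : ∀ t, Measurable (M t)) (hind : HasIndependentInversions M P)
    (hM : IsMarkov M P) (j : Fin n) : IsMarkov (fun t ω => invAt (M t ω) j) P := by
  classical
  have hmj : ∀ (j : Fin n) (t : ℝ≥0), Measurable fun ω => Mallows.invAt (M t ω) j := fun j t =>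
    (measurable_of_countable fun σ : Equiv.Perm (Fin n) => Mallows.invAt σ j).comp (hm t)
  set X : Fin n → ℝ≥0 → Ω → ℕ := fun j t ω => Mallows.invAt (M t ω) j with hX
  rw [isMarkov_iff (hmj j)]
  intro I x s t y hs hmax hst
  change P.real (cyl (X j) I x ∩ {ω | X j t ω = y}) * P.real {ω | X j s ω = x s} =
    P.real (cyl (X j) I x) * P.real ({ω | X j s ω = x s} ∩ {ω | X j t ω = y})
  by_cases h0 : P (cyl (X j) I x) = 0
  · rw [measureReal_def, measureReal_def, measureReal_def P (cyl (X j) I x), h0,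
      measure_mono_null Set.inter_subset_left h0]
    simp
  -- The cylinder of the coordinate is a finite union over permutation paths on `I`, so one of them
  -- has positive probability.
  obtain ⟨σ, hσ⟩ : ∃ σ : ℝ≥0 → Equiv.Perm (Fin n), P (cyl (X j) I x ∩ cyl M I σ) ≠ 0 := by
    by_contra! hcon
    refine h0 (measure_mono_null (t := ⋃ z : I → Equiv.Perm (Fin n), cyl (X j) I x ∩
      cyl M I fun u => if h : u ∈ I then z ⟨u, h⟩ else 1) (fun ω hω => ?_)
      (measure_iUnion_null fun z => hcon _))
    exact Set.mem_iUnion.2 ⟨fun u => M u ω, hω, fun u hu => by simp [hu]⟩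
  have hσx : ∀ u ∈ I, Mallows.invAt (σ u) j = x u := by
    obtain ⟨ω, h1, h2⟩ := nonempty_of_measure_ne_zero hσ
    intro u hu
    rw [← h1 u hu, ← h2 u hu]
  have hpos : P.real (cyl M I σ) ≠ 0 := by
    rw [measureReal_def]
    exact (ENNReal.toReal_pos (fun h => hσ (measure_mono_null Set.inter_subset_right h))
      (measure_ne_top _ _)).ne'
  have hmarkov : P.real (cyl M I σ ∩ {ω | X j t ω = y}) * P.real {ω | M s ω = σ s} =
      P.real (cyl M I σ) * P.real ({ω | M s ω = σ s} ∩ {ω | X j t ω = y}) := by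
    have hsplit : ∀ A : Set Ω, MeasurableSet A → P.real (A ∩ {ω | X j t ω = y}) =
        ∑ τ ∈ Finset.univ.filter (fun τ : Equiv.Perm (Fin n) => Mallows.invAt τ j = y),
          P.real (A ∩ {ω | M t ω = τ}) := by
      intro A hA
      rw [← measureReal_biUnion_finset]
      · congr 1
        ext ω
        simp only [Set.mem_inter_iff, Set.mem_ofPred_eq, Set.mem_iUnion, Finset.mem_filter,
          Finset.mem_univ, true_and, hX]
        exact ⟨fun h => ⟨M t ω, h.2, h.1, rfl⟩, fun ⟨τ, h1, h2, h3⟩ => ⟨h2, h3 ▸ h1⟩⟩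
      · intro τ _ τ' _ hne
        exact Set.disjoint_left.2 fun ω h1 h2 => hne (h1.2.symm.trans h2.2)
      · exact fun τ _ => hA.inter (measurableSet_eq_state hm t τ)
    rw [hsplit _ (measurableSet_cyl hm I σ), hsplit _ (measurableSet_eq_state hm s _),
      Finset.sum_mul, Finset.mul_sum]
    exact Finset.sum_congr rfl fun τ _ => (isMarkov_iff hm).1 hM I σ s t τ hs hmax hst
  have hprod : ∀ K : Finset ℝ≥0, P.real (cyl M K σ ∩ {ω | X j t ω = y}) =
      P.real (cyl (X j) K (fun u => Mallows.invAt (σ u) j) ∩ {ω | X j t ω = y}) *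
        ∏ i ∈ Finset.univ.erase j, P.real (cyl (X i) K fun u => Mallows.invAt (σ u) i) := by
    intro K
    set S : Fin n → Set (ℝ≥0 → ℕ) := fun i => {f | ∀ u ∈ K, f u = Mallows.invAt (σ u) i} ∩
      (if i = j then {f | f t = y} else Set.univ) with hS
    have hSm : ∀ i, MeasurableSet (S i) := by
      intro i
      refine (measurableSet_path_cyl K _).inter ?_
      split_ifs
      · exact measurableSet_eq_state (X := fun t (f : ℝ≥0 → ℕ) => f t)
          (fun t => measurable_pi_apply t) t y
      · exact MeasurableSet.univ
    have h1 : cyl M K σ ∩ {ω | X j t ω = y} = {ω | ∀ i, (fun u => X i u ω) ∈ S i} := by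
      rw [cyl_eq_forall_invAt]
      ext ω
      simp only [Set.mem_inter_iff, Set.mem_ofPred_eq, hS]
      constructor
      · rintro ⟨h1, h2⟩ i
        refine ⟨h1 i, ?_⟩
        split_ifs with h
        · subst h; exact h2
        · trivial
      · intro h
        refine ⟨fun i => (h i).1, ?_⟩
        have := (h j).2
        rw [if_pos rfl] at this
        exact this
    rw [h1, hind.measureReal_eq_prod hSm, ← Finset.mul_prod_erase _ _ (Finset.mem_univ j)]
    congr 1
    · congr 1
      ext ω
      simp [hS, cyl, hX]
    · refine Finset.prod_congr rfl fun i hi => ?_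
      congr 1
      ext ω
      simp [hS, cyl, hX, Finset.ne_of_mem_erase hi]
  have hprod' : ∀ K : Finset ℝ≥0, P.real (cyl M K σ) =
      P.real (cyl (X j) K (fun u => Mallows.invAt (σ u) j)) *
        ∏ i ∈ Finset.univ.erase j, P.real (cyl (X i) K fun u => Mallows.invAt (σ u) i) := by
    intro K
    rw [hind.measureReal_cyl, ← Finset.mul_prod_erase _ _ (Finset.mem_univ j)]
  have eM : {ω | M s ω = σ s} = cyl M {s} σ := by ext; simp [cyl]
  have eX : cyl (X j) {s} (fun u => Mallows.invAt (σ u) j) = {ω | X j s ω = x s} := by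
    ext; simp [cyl, hσx s hs]
  have hposs : P.real (cyl M {s} σ) ≠ 0 := by
    have hsub : cyl M I σ ⊆ cyl M {s} σ := fun ω hω u hu => by
      rw [Finset.mem_singleton.1 hu]
      exact hω s hs
    exact ((measureReal_nonneg.lt_of_ne' hpos).trans_le (measureReal_mono hsub)).ne'
  rw [eM, hprod, hprod', hprod', hprod, eX, cyl_congr (X j) hσx] at hmarkov
  rw [hprod' I] at hpos
  rw [hprod' {s}] at hposs
  have ha := right_ne_zero_of_mul hpos
  have hb := right_ne_zero_of_mul hposs
  refine mul_right_cancel₀ (mul_ne_zero ha hb) ?_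
  linear_combination hmarkov

end Independence

/-! ### Regular Markov Mallows processes and birth Mallows processes -/

section Main

variable {Ω : Type*} [MeasurableSpace Ω] {P : Measure Ω} {n : ℕ}
  {M : ℝ≥0 → Ω → Equiv.Perm (Fin n)}

theorem isBirthMallowsProcess_iff : IsBirthMallowsProcess M P ↔
    (∀ j : Fin n, IsBirthProcess (rate ((j : ℕ) + 1)) (fun t ω => invAt (M t ω) j) P) ∧
      HasIndependentInversions M P := by
  constructor
  · rintro ⟨B, hB, hind, hM⟩
    have h : ∀ (j : Fin n) (t : ℝ≥0) (ω : Ω), invAt (M t ω) j = B t ω j := fun j t ω => by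
      rw [hM, invAt_Phi]
    refine ⟨fun j => ?_, ?_⟩
    · simp only [h]; exact hB j
    · unfold HasIndependentInversions
      simp only [h]
      exact hind
  · rintro ⟨hB, hind⟩
    exact ⟨fun t ω => toCode (M t ω), hB, hind, fun t ω => (Phi_toCode _).symm⟩

/-- Sum the product weights over codes with `j`-th entry `k`; every other coordinate sums to 1. -/
theorem IsMallowsProcess.measureReal_invAt [IsProbabilityMeasure P] (hM : IsMallowsProcess M P)
    (j : Fin n) (t : ℝ≥0) (k : ℕ) :
    P.real {ω | invAt (M t ω) j = k} = truncGeom ((j : ℕ) + 1) t k := by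
  classical
  set s : (i : Fin n) → Finset (Fin ((i : ℕ) + 1)) := fun i =>
    Finset.univ.filter fun a => i = j → (a : ℕ) = k with hs
  have hmem : ∀ c : Code n, c ∈ Fintype.piFinset s ↔ (c j : ℕ) = k := by
    intro c
    simp only [Fintype.mem_piFinset, hs, Finset.mem_filter, Finset.mem_univ, true_and]
    exact ⟨fun h => h j rfl, fun h i hi => hi ▸ h⟩
  have hset : {ω | invAt (M t ω) j = k} = ⋃ c ∈ Fintype.piFinset s, {ω | M t ω = Phi n c} := by
    ext ω
    simp only [Set.mem_ofPred_eq, Set.mem_iUnion, hmem, exists_prop]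
    constructor
    · exact fun h => ⟨toCode (M t ω), h, (Phi_toCode _).symm⟩
    · rintro ⟨c, hc, h⟩
      rw [h, invAt_Phi, hc]
  rw [hset, measureReal_biUnion_finset]
  · simp only [hM.marginal, mallowsProb_eq_prod, invAt_Phi]
    rw [← Finset.prod_univ_sum s fun i a => truncGeom ((i : ℕ) + 1) t a,
      Finset.prod_eq_single j]
    · rcases Nat.lt_or_ge k ((j : ℕ) + 1) with hk | hk
      · rw [Finset.sum_eq_single (⟨k, hk⟩ : Fin ((j : ℕ) + 1))]
        · intro a ha hne
          exact absurd (Fin.ext ((Finset.mem_filter.1 ha).2 rfl)) hne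
        · intro h
          exact absurd (Finset.mem_filter.2 ⟨Finset.mem_univ _, fun _ => rfl⟩) h
      · rw [truncGeom, if_neg (not_lt.2 hk)]
        refine Finset.sum_eq_zero fun a ha => ?_
        have := (Finset.mem_filter.1 ha).2 rfl
        have := a.2
        omega
    · intro i _ hij
      rw [← sum_univ_truncGeom (Nat.succ_pos (i : ℕ)) t.2]
      refine Finset.sum_congr ?_ fun _ _ => rfl
      ext a
      simp [hs, hij]
    · exact fun h => absurd (Finset.mem_univ j) h
  · intro c _ c' _ hne
    exact Set.disjoint_left.2 fun ω h1 h2 => hne ((Phi n).injective (h1.symm.trans h2))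
  · exact fun c _ => measurableSet_eq_state hM.measurable t _

theorem IsRegularMallowsProcess.isBirth [IsProbabilityMeasure P]
    (hR : IsRegularMallowsProcess M P) (hM : IsMarkov M P) : IsBirthMallowsProcess M P := by
  refine isBirthMallowsProcess_iff.2 ⟨fun j => ?_, hR.indep⟩
  have hlt : ∀ t ω, invAt (M t ω) j < (j : ℕ) + 1 := fun t ω => invAt_lt _ j
  rw [isBirthProcess_rate_iff hlt]
  have hmono : ∀ᵐ ω ∂P, ∀ j, Monotone fun t => invAt (M t ω) j := by
    filter_upwards [hR.smooth.1.2] with ω hω j s t hst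
    rcases hst.eq_or_lt with rfl | h
    · exact le_rfl
    · exact hω s t h j
  refine IsTruncGeomProcess.isBirthProcess ⟨fun t => ?_, hlt, ?_, hR.mallows.measureReal_invAt j⟩
    (fun ω => (hR.mallows.cadlag ω).map fun σ => invAt σ j) ?_
    (hM.invAt hR.mallows.measurable hR.indep j)
  · exact (measurable_of_countable fun σ : Equiv.Perm (Fin n) => invAt σ j).comp
      (hR.mallows.measurable t)
  · filter_upwards [hmono] with ω hω using hω j
  · filter_upwards [hmono, hR.smooth.2] with ω hω hunit t ht a ha
    obtain ⟨σ, hσ⟩ := (hR.mallows.cadlag ω).2 t ht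
    have hσj : ∀ i, HasLeftLimit (fun s => invAt (M s ω) i) t (invAt σ i) := fun i =>
      Eventually.mono hσ fun _ h => congrArg (fun σ => invAt σ i) h
    -- No coordinate decreases at a jump, so a unit bound on the total jump bounds each coordinate's
    -- jump.
    have hle : ∀ i, invAt σ i ≤ invAt (M t ω) i := fun i => (hσj i).le (hω i) ht
    have hinv := hunit t ht σ hσ
    rw [HasLeftLimit.unique ht ha (hσj j)]
    rw [inv_eq_sum, inv_eq_sum, ← Finset.add_sum_erase _ _ (Finset.mem_univ j),
      ← Finset.add_sum_erase _ (fun i => invAt σ i) (Finset.mem_univ j)] at hinv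
    have := Finset.sum_le_sum fun i (_ : i ∈ Finset.univ.erase j) => hle i
    omega

theorem IsBirthMallowsProcess.isRegular_and_isMarkov [IsProbabilityMeasure P]
    (hB : IsBirthMallowsProcess M P) : IsRegularMallowsProcess M P ∧ IsMarkov M P := by
  obtain ⟨hB, hind⟩ := isBirthMallowsProcess_iff.1 hB
  have hlt : ∀ (j : Fin n) (t : ℝ≥0) (ω : Ω), invAt (M t ω) j < (j : ℕ) + 1 :=
    fun j t ω => invAt_lt _ j
  have hB' : ∀ j : Fin n, IsBirthProcess (birthRate ((j : ℕ) + 1))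
    (fun t ω => invAt (M t ω) j) P := fun j => (isBirthProcess_rate_iff (hlt j)).1 (hB j)
  have hG := fun j => (hB' j).isTruncGeom (hlt j)
  have hmono : ∀ᵐ ω ∂P, ∀ j, Monotone fun t => invAt (M t ω) j :=
    ae_all_iff.2 fun j => (hG j).mono
  have hmonoInv : ∀ᵐ ω ∂P, Monotone fun t => inv (M t ω) := by
    filter_upwards [hmono] with ω hω s t hst
    simp only [inv_eq_sum]
    exact Finset.sum_le_sum fun j _ => hω j hst
  have hm : ∀ t, Measurable (M t) := by
    intro t
    refine measurable_to_countable' fun σ => ?_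
    have : M t ⁻¹' {σ} = ⋂ j, {ω | invAt (M t ω) j = invAt σ j} := by
      ext ω
      simp [perm_eq_iff]
    rw [this]
    exact MeasurableSet.iInter fun j => measurableSet_eq_state (hB j).measurable t _
  refine ⟨⟨⟨hm, fun ω => isCadlag_of_invAt fun j => (hB j).cadlag ω, fun t σ => ?_⟩,
    ⟨⟨?_, ?_⟩, ?_⟩, hind⟩, isMarkov_of_invAt hm hind fun j => (hB j).markov⟩
  · have h := hind.measureReal_cyl {t} fun _ => σ
    have e1 : cyl M {t} (fun _ => σ) = {ω | M t ω = σ} := by ext; simp [cyl]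
    rw [e1] at h
    rw [h, mallowsProb_eq_prod]
    refine Finset.prod_congr rfl fun j _ => ?_
    rw [← (hG j).marginal]
    congr 1
    ext; simp [cyl]
  · filter_upwards [hmonoInv] with ω hω s t hst using hω hst.le
  · filter_upwards [hmono] with ω hω s t hst j using hω j hst.le
  · have hjumps := ae_unit_jumps (Y := fun t ω => inv (M t ω)) hmonoInv fun T => by
      simp only [inv_eq_sum]
      exact exists_sum_increment_bound hind (fun j => (hG j).mono) T fun j =>
        (isRateFamily_birthRate _).exists_increment_bound (hlt j)
          (fun s t hst k m => (hB' j).measureReal_inter (isRateFamily_birthRate _) (hlt j) hst k m) T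
    filter_upwards [hjumps] with ω hω t ht σ hσ
    exact hω t ht _ (Eventually.mono hσ fun _ h => congrArg inv h)

theorem IsBirthMallowsProcess.measureReal_cyl_eq [IsProbabilityMeasure P] {Ω' : Type*}
    [MeasurableSpace Ω'] {P' : Measure Ω'} [IsProbabilityMeasure P']
    {M' : ℝ≥0 → Ω' → Equiv.Perm (Fin n)} (hB : IsBirthMallowsProcess M P)
    (hB' : IsBirthMallowsProcess M' P') (I : Finset ℝ≥0) (σ : ℝ≥0 → Equiv.Perm (Fin n)) :
    P.real (cyl M I σ) = P'.real (cyl M' I σ) := by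
  obtain ⟨hB, hind⟩ := isBirthMallowsProcess_iff.1 hB
  obtain ⟨hB', hind'⟩ := isBirthMallowsProcess_iff.1 hB'
  rw [hind.measureReal_cyl, hind'.measureReal_cyl]
  refine Finset.prod_congr rfl fun j _ => ?_
  have hlt : ∀ t ω, invAt (M t ω) j < (j : ℕ) + 1 := fun t ω => invAt_lt _ j
  have hlt' : ∀ t ω, invAt (M' t ω) j < (j : ℕ) + 1 := fun t ω => invAt_lt _ j
  exact ((isBirthProcess_rate_iff hlt).1 (hB j)).measureReal_cyl_eq (isRateFamily_birthRate _) hlt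
    ((isBirthProcess_rate_iff hlt').1 (hB' j)) hlt' I _

theorem map_restrict_singleton (hm : ∀ t, Measurable (M t)) (I : Finset ℝ≥0)
    (z : I → Equiv.Perm (Fin n)) :
    (P.map fun ω => I.restrict (M · ω)) {z} =
      P (cyl M I fun u => if hu : u ∈ I then z ⟨u, hu⟩ else 1) := by
  have hM : Measurable fun ω => I.restrict (M · ω) := measurable_pi_lambda _ fun u => hm u
  rw [Measure.map_apply hM (measurableSet_singleton z)]
  congr 1
  ext ω
  simp only [Set.mem_preimage, Set.mem_singleton_iff, cyl, Set.mem_ofPred_eq, funext_iff,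
    Subtype.forall, Finset.restrict]
  exact forall₂_congr fun u hu => by simp [hu]

theorem identDistrib_of_measureReal_cyl_eq [IsProbabilityMeasure P] {Ω' : Type*}
    [MeasurableSpace Ω'] {P' : Measure Ω'} [IsProbabilityMeasure P']
    {M' : ℝ≥0 → Ω' → Equiv.Perm (Fin n)} (hm : ∀ t, Measurable (M t)) (hm' : ∀ t, Measurable (M' t))
    (h : ∀ I σ, P.real (cyl M I σ) = P'.real (cyl M' I σ)) :
    IdentDistrib (fun ω t => M t ω) (fun ω t => M' t ω) P P' := by
  have hM : Measurable fun ω t => M t ω := measurable_pi_lambda _ hm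
  have hM' : Measurable fun ω t => M' t ω := measurable_pi_lambda _ hm'
  refine ⟨hM.aemeasurable, hM'.aemeasurable, ?_⟩
  have h1 := isProjectiveLimit_map (X := M) (P := P) hM.aemeasurable
  have h2 := isProjectiveLimit_map (X := M') (P := P') hM'.aemeasurable
  have hfam : (fun I : Finset ℝ≥0 => P.map fun ω => I.restrict (M · ω)) =
      fun I : Finset ℝ≥0 => P'.map fun ω => I.restrict (M' · ω) := by
    funext I
    refine Measure.ext_of_singleton fun z => ?_
    rw [map_restrict_singleton hm, map_restrict_singleton hm']
    exact (ENNReal.toReal_eq_toReal_iff' (measure_ne_top _ _) (measure_ne_top _ _)).1 (h I _)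
  rw [hfam] at h1
  exact h1.unique h2

theorem cond_preimage {Ω' : Type*} [MeasurableSpace Ω'] {P' : Measure Ω'} {f : Ω' → Ω}
    (hf : MeasurePreserving f P' P) {A B : Set Ω} (hA : MeasurableSet A) (hB : MeasurableSet B) :
    P'[|f ⁻¹' A] (f ⁻¹' B) = P[|A] B := by
  rw [cond_apply (hf.measurable hA), cond_apply hA, ← Set.preimage_inter,
    hf.measure_preimage hA.nullMeasurableSet, hf.measure_preimage (hA.inter hB).nullMeasurableSet]

/-- Used to lift each coordinate process to the product space along its projection. -/
theorem IsBirthProcess.comp {Ω' : Type*} [MeasurableSpace Ω'] {P' : Measure Ω'} {f : Ω' → Ω}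
    (hf : MeasurePreserving f P' P) {p : ℝ → ℕ → ℝ} {X : ℝ≥0 → Ω → ℕ} (hB : IsBirthProcess p X P) :
    IsBirthProcess p (fun t ω => X t (f ω)) P' := by
  have hstate := measurableSet_eq_state hB.measurable
  refine ⟨fun t => (hB.measurable t).comp hf.measurable, fun ω => hB.cadlag (f ω),
    fun t ht => hf.quasiMeasurePreserving.ae (hB.no_fixed_jump t ht),
    hf.quasiMeasurePreserving.ae hB.initial, fun k s t hs hst x y h0 => ?_, fun t k m h0 => ?_⟩
  · have hA : MeasurableSet {ω | ∀ i, X (s i) ω = x i} := by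
      have : {ω | ∀ i, X (s i) ω = x i} = ⋂ i, {ω | X (s i) ω = x i} := by ext; simp
      rw [this]
      exact MeasurableSet.iInter fun i => hstate _ _
    have h1 := hB.markov k s t hs hst x y (by
      rwa [← hf.measure_preimage hA.nullMeasurableSet])
    rw [← cond_preimage hf hA (hstate t y), ← cond_preimage hf (hstate _ _) (hstate t y)] at h1
    exact h1
  · have h1 := hB.rates t k m (by
      rwa [← hf.measure_preimage (hstate t k).nullMeasurableSet])
    refine h1.congr_left fun h => ?_
    congr 1
    exact congrArg ENNReal.toReal (cond_preimage hf (hstate t k) (hstate (t + h) m)).symm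

/-- Birth Mallows processes exist. -/
theorem exists_isBirthMallowsProcess (n : ℕ) :
    ∃ (Ω : Type) (_ : MeasurableSpace Ω) (P : Measure Ω) (M : ℝ≥0 → Ω → Equiv.Perm (Fin n)),
      IsProbabilityMeasure P ∧ IsBirthMallowsProcess M P := by
  choose μ B hμ hlt hB using fun j : Fin n =>
    (isRateFamily_birthRate ((j : ℕ) + 1)).exists_isBirth (Nat.succ_pos _)
  refine ⟨(j : Fin n) → ℝ≥0 → Fin ((j : ℕ) + 1), inferInstance, Measure.pi μ,
    fun t ω => Phi n fun j => ⟨B j t (ω j), hlt j t (ω j)⟩, inferInstance,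
    fun t ω j => ⟨B j t (ω j), hlt j t (ω j)⟩, fun j => ?_, ?_, fun t ω => rfl⟩
  · exact ((isBirthProcess_rate_iff (hlt j)).2 (hB j)).comp (measurePreserving_eval μ j)
  · exact iIndepFun_pi (X := fun j ω t => B j t ω) fun j =>
      (measurable_pi_lambda _ fun t => (hB j).measurable t).aemeasurable

end Main

end Mallows

end

theorem theorem1p1 (n : ℕ) :
    -- existence
    (∃ (Ω : Type) (_ : MeasurableSpace Ω) (P : Measure Ω) (M : ℝ≥0 → Ω → Equiv.Perm (Fin n)),
      IsProbabilityMeasure P ∧ Mallows.IsRegularMallowsProcess M P ∧ Mallows.IsMarkov M P) ∧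
    -- uniqueness in law
    (∀ (Ω : Type u) (_ : MeasurableSpace Ω) (P : Measure Ω) (M : ℝ≥0 → Ω → Equiv.Perm (Fin n))
      (Ω' : Type v) (_ : MeasurableSpace Ω') (P' : Measure Ω') (M' : ℝ≥0 → Ω' → Equiv.Perm (Fin n)),
      IsProbabilityMeasure P → IsProbabilityMeasure P' →
      Mallows.IsRegularMallowsProcess M P → Mallows.IsMarkov M P →
      Mallows.IsRegularMallowsProcess M' P' → Mallows.IsMarkov M' P' →
      IdentDistrib (fun ω t => M t ω) (fun ω t => M' t ω) P P') ∧
    -- identification with the birth Mallows process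
    (∀ (Ω : Type u) (_ : MeasurableSpace Ω) (P : Measure Ω) (M : ℝ≥0 → Ω → Equiv.Perm (Fin n)),
      IsProbabilityMeasure P →
      ((Mallows.IsRegularMallowsProcess M P ∧ Mallows.IsMarkov M P) ↔
        Mallows.IsBirthMallowsProcess M P)) := by
  refine ⟨?_, ?_, ?_⟩
  · obtain ⟨Ω, mΩ, P, M, hP, hB⟩ := Mallows.exists_isBirthMallowsProcess n
    exact ⟨Ω, mΩ, P, M, hP, hB.isRegular_and_isMarkov⟩
  · intro Ω _ P M Ω' _ P' M' hP hP' hR hM hR' hM'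
    exact Mallows.identDistrib_of_measureReal_cyl_eq hR.mallows.measurable hR'.mallows.measurable
      ((hR.isBirth hM).measureReal_cyl_eq (hR'.isBirth hM'))
  · intro Ω _ P M hP
    exact ⟨fun h => h.1.isBirth h.2, fun h => h.isRegular_and_isMarkov⟩
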